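/- Let $n\ge 2$ be even, let $G=\mathrm{SO}(2n)$, and let $K\cong\mathrm{SO}(2n-1)$ be the stabilizer in $G$ of the last standard basis vector of $\mathbb R^{2n}$, so that $G/K=S^{2n-1}$ is the unit sphere with its round metric. Let $\tau_{n-1}$ be the representation of $K$ on the complex-valued alternating $(n-1)$-forms on the tangent space of $S^{2n-1}$ at this vector. For a finite subgroup $\Gamma\subset G$ and an irreducible finite-dimensional continuous complex representation $\pi$ of $G$, let $n_\Gamma(\pi)=\dim\mathrm{Hom}_G(V_\pi,L^2(\Gamma\backslash G))$. Two finite subgroups $\Gamma,\Gamma'$ of $G$ are called $\tau_{n-1}$-representation equivalent in $G$ if $n_\Gamma(\pi)=n_{\Gamma'}(\pi)$ for all irreducible $\pi$ with $\mathrm{Hom}_K(\tau_{n-1},\pi|_K)\ne 0$; the spaces $\Gamma\backslash S^{2n-1}$ and $\Gamma'\backslash S^{2n-1}$ are isospectral on $p$-forms if every eigenvalue of the Hodge–Laplace operator on $\Gamma$-invariant smooth complex $p$-forms on $S^{2n-1}$ occurs with the same multiplicity for $\Gamma'$, and conversely. Write $R(\theta)=\begin{pmatrix}\cos\theta&\sin\theta\\-\sin\theta&\cos\theta\end{pmatrix}$.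 Let $q>n$ be an integer, let $\Gamma$ be the subgroup of $G$ generated by $\mathrm{diag}\big(R(\tfrac{2\pi}{q}),\dots,R(\tfrac{2\pi}{q}),R(\tfrac{2\pi}{q})\big)$, and let $\Gamma'$ be the subgroup generated by $\mathrm{diag}\big(R(\tfrac{2\pi}{q}),\dots,R(\tfrac{2\pi}{q}),R(-\tfrac{2\pi}{q})\big)$. Then: 1. $\Gamma$ and $\Gamma'$ are cyclic of order $q$, act freely on $S^{2n-1}$ (so that the quotients are lens spaces), and are conjugate in $\mathrm O(2n)$; 2. $\Gamma\backslash S^{2n-1}$ and $\Gamma'\backslash S^{2n-1}$ are isospectral on $(n-1)$-forms; 3. $\Gamma$ and $\Gamma'$ are not $\tau_{n-1}$-representation equivalent in $G$. More precisely, there are irreducible representations $\pi_+$ and $\pi_-$ of $G$, with highest weights $\varepsilon_1+\dots+\varepsilon_{n-1}+\varepsilon_n$ and $\varepsilon_1+\dots+\varepsilon_{n-1}-\varepsilon_n$ respectively (for the maximal torus of the elements $\mathrm{diag}(R(\theta_1),\dots,R(\theta_n))$, the weight $\sum_j a_j\varepsilon_j$ being the character $e^{-i\sum_j a_j\theta_j}$,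 and the positive roots $\varepsilon_i\pm\varepsilon_j$, $i<j$), such that $\mathrm{Hom}_K(\tau_{n-1},\pi_\pm|_K)\neq0$ and $$n_\Gamma(\pi_\pm)-n_{\Gamma'}(\pi_\pm)=\pm(-1)^{n/2}\binom{n}{n/2}.$$ -/

import Mathlib

open MeasureTheory


noncomputable section

namespace LensForms

/-! ### The group `SO(2n)`

Coordinates of `ℝ^{2n}` are labelled by `Fin 2 × Fin n`; the coordinates `(0, j)` and `(1, j)` span
the `j`-th coordinate plane. -/

/-- The group `SO(2n)`. -/
abbrev SO (n : ℕ) := Matrix.specialOrthogonalGroup (Fin 2 × Fin n) ℝ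

/-- Euclidean space `ℝ^{2n}`. -/
abbrev E (n : ℕ) := EuclideanSpace ℝ (Fin 2 × Fin n)

/-- The standard action of `SO(2n)` on `ℝ^{2n}`. -/
def act {n : ℕ} : SO n →* (E n →L[ℝ] E n) :=
  (Matrix.toEuclideanCLM (n := Fin 2 × Fin n) (𝕜 := ℝ) :
    Matrix (Fin 2 × Fin n) (Fin 2 × Fin n) ℝ →* (E n →L[ℝ] E n)).comp
      (Matrix.specialOrthogonalGroup (Fin 2 × Fin n) ℝ).subtype

instance (n : ℕ) : IsTopologicalGroup (SO n) where
  continuous_inv := by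
    refine Continuous.subtype_mk (f := fun g : SO n => g.1.transpose) ?_ _
    exact continuous_subtype_val.matrix_transpose

theorem isCompact_SO (n : ℕ) :
    IsCompact {A : Matrix (Fin 2 × Fin n) (Fin 2 × Fin n) ℝ |
      A ∈ Matrix.specialOrthogonalGroup (Fin 2 × Fin n) ℝ} := by
  have hc : IsCompact (Set.univ.pi fun _ => Set.univ.pi fun _ => Set.Icc (-1) 1 :
      Set ((Fin 2 × Fin n) → (Fin 2 × Fin n) → ℝ)) :=
    isCompact_univ_pi fun _ => isCompact_univ_pi fun _ => isCompact_Icc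
  refine hc.of_isClosed_subset ?_ ?_
  · have : {A : Matrix (Fin 2 × Fin n) (Fin 2 × Fin n) ℝ |
        A ∈ Matrix.specialOrthogonalGroup (Fin 2 × Fin n) ℝ} =
        {A | A * A.transpose = 1} ∩ {A | A.det = 1} := by
      ext A
      simp only [Set.mem_ofPred_eq, Set.mem_inter_iff]
      rw [Matrix.mem_specialOrthogonalGroup_iff, Matrix.mem_orthogonalGroup_iff]
    change IsClosed {A : Matrix (Fin 2 × Fin n) (Fin 2 × Fin n) ℝ |
      A ∈ Matrix.specialOrthogonalGroup (Fin 2 × Fin n) ℝ}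
    rw [this]
    exact (isClosed_eq (continuous_id.mul continuous_id.matrix_transpose) continuous_const).inter
      (isClosed_eq continuous_id.matrix_det continuous_const)
  · intro A hA
    have h := (Matrix.mem_orthogonalGroup_iff _ _).1 (Matrix.mem_specialOrthogonalGroup_iff.1 hA).1
    simp only [Set.mem_univ_pi, Set.mem_Icc]
    intro i j
    have h1 := congrFun (congrFun h i) i
    rw [Matrix.one_apply_eq] at h1
    have h2 : A i j * A i j ≤ 1 := h1 ▸ Finset.single_le_sum
      (f := fun k => A i k * A i k) (fun k _ => mul_self_nonneg _) (Finset.mem_univ j)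
    constructor <;> nlinarith

instance (n : ℕ) : CompactSpace (SO n) := isCompact_iff_compactSpace.1 (isCompact_SO n)

instance (n : ℕ) : MeasurableSpace (SO n) := borel _

instance (n : ℕ) : BorelSpace (SO n) := ⟨rfl⟩

/-! ### Representations of `SO(2n)` and multiplicities in `L²(Γ\G)` -/

/-- Normalized Haar measure on `SO(2n)`. -/
def haarSO (n : ℕ) : Measure (SO n) := Measure.haarMeasure ⊤

instance (n : ℕ) : (haarSO n).IsHaarMeasure := by unfold haarSO; infer_instance

instance (n : ℕ) : IsProbabilityMeasure (haarSO n) :=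
  ⟨by simpa [haarSO] using Measure.haarMeasure_self (K₀ := (⊤ : TopologicalSpace.PositiveCompacts (SO n)))⟩

instance (n : ℕ) : (haarSO n).IsMulRightInvariant where
  map_mul_right_eq_self g := by
    have : IsProbabilityMeasure (Measure.map (· * g) (haarSO n)) :=
      Measure.isProbabilityMeasure_map (measurable_mul_const g).aemeasurable
    exact Measure.isHaarMeasure_eq_of_isProbabilityMeasure _ _

/-- The right regular representation of `G = SO(2n)` on `L²(G)`: `(g · f)(x) = f(x g)`. -/
def rightRegular (n : ℕ) : Representation ℂ (SO n) (Lp ℂ 2 (haarSO n)) where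
  toFun g :=
    { toFun := fun f => DomMulAct.mk (MulOpposite.op g) • f
      map_add' := fun f f' => smul_add _ f f'
      map_smul' := fun c f => smul_comm _ c f }
  map_one' := by ext1 f; exact one_smul _ f
  map_mul' g h := by ext1 f; exact mul_smul (DomMulAct.mk (MulOpposite.op g)) (DomMulAct.mk (MulOpposite.op h)) f

/-- `L²(Γ\G)`, realized as the space of `f ∈ L²(G)` with `f(γ x) = f(x)` for all `γ ∈ Γ`, with the
right regular representation. -/
def L2Quotient {n : ℕ} (Γ : Subgroup (SO n)) : Subrepresentation (rightRegular n) where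
  toSubmodule :=
    { carrier := {f | ∀ γ ∈ Γ, DomMulAct.mk γ • f = f}
      add_mem' := fun {a b} ha hb γ hγ => by rw [smul_add, ha γ hγ, hb γ hγ]
      zero_mem' := fun γ _ => smul_zero _
      smul_mem' := fun c f hf γ hγ => by rw [smul_comm, hf γ hγ] }
  apply_mem_toSubmodule g f hf γ hγ := by
    change DomMulAct.mk γ • (DomMulAct.mk (MulOpposite.op g) • f) = DomMulAct.mk (MulOpposite.op g) • f
    rw [smul_comm, hf γ hγ]

section Rep

variable {n : ℕ} {V : Type} [AddCommGroup V] [Module ℂ V]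

/-- `n_Γ(π) = dim Hom_G(V_π, L²(Γ\G))`. -/
def mult (Γ : Subgroup (SO n)) (π : Representation ℂ (SO n) V) : ℕ :=
  Module.finrank ℂ (Representation.IntertwiningMap π (L2Quotient Γ).toRepresentation)

/-- `π` represents a class of the unitary dual of the compact group `SO(2n)`: a finite-dimensional,
irreducible representation with continuous matrix coefficients (such a representation is
unitarizable, and every irreducible unitary representation of a compact group is of this kind). -/
structure IsIrrep (π : Representation ℂ (SO n) V) : Prop where
  finiteDimensional : FiniteDimensional ℂ V
  continuous : ∀ (f : Module.Dual ℂ V) (v : V), Continuous fun g => f (π g v)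
  irreducible : π.IsIrreducible

/-- The `2 × 2` rotation block `R(θ)`. -/
def rot (θ : ℝ) : Matrix (Fin 2) (Fin 2) ℝ :=
  !![Real.cos θ, Real.sin θ; -Real.sin θ, Real.cos θ]

/-- The element `diag(R(θ₁), …, R(θₙ))` of the standard maximal torus of `SO(2n)`. -/
def torus (θ : Fin n → ℝ) : SO n :=
  ⟨Matrix.blockDiagonal fun j => rot (θ j), by
    have hr : ∀ t, rot t * (rot t).transpose = 1 := fun t => by
      ext i j
      fin_cases i <;> fin_cases j <;>
        simp [rot, Matrix.mul_apply, Fin.sum_univ_two] <;> nlinarith [Real.sin_sq_add_cos_sq t]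
    rw [Matrix.mem_specialOrthogonalGroup_iff, Matrix.mem_orthogonalGroup_iff]
    constructor
    · rw [Matrix.blockDiagonal_transpose, ← Matrix.blockDiagonal_mul]
      simp only [hr]
      exact Matrix.blockDiagonal_one
    · rw [Matrix.det_blockDiagonal]
      refine Finset.prod_eq_one fun j _ => ?_
      rw [rot, Matrix.det_fin_two_of]
      nlinarith [Real.sin_sq_add_cos_sq (θ j)]⟩

/-- The weight space of the weight `∑ aⱼ εⱼ`, where `diag(R(θ₁), …, R(θₙ))` acts by
`exp(-i ∑ aⱼ θⱼ)`. -/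
def weightSpace (π : Representation ℂ (SO n) V) (a : Fin n → ℤ) : Submodule ℂ V :=
  ⨅ θ : Fin n → ℝ,
    Module.End.eigenspace (π (torus θ)) (Complex.exp (-Complex.I * ∑ j, (a j : ℂ) * (θ j : ℂ)))

/-- The positive roots `εᵢ ± εⱼ`, `i < j`, of `SO(2n)`. -/
def positiveRoots (n : ℕ) : Set (Fin n → ℤ) :=
  {α | ∃ i j : Fin n, i < j ∧
    (α = Pi.single i 1 + Pi.single j 1 ∨ α = Pi.single i 1 - Pi.single j 1)}

/-- `Λ` is the highest weight of `π`: it is a weight, and every weight is obtained from `Λ` by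
subtracting a sum of positive roots. -/
def HasHighestWeight (π : Representation ℂ (SO n) V) (Λ : Fin n → ℤ) : Prop :=
  weightSpace π Λ ≠ ⊥ ∧
    ∀ η : Fin n → ℤ, weightSpace π η ≠ ⊥ → Λ - η ∈ AddSubmonoid.closure (positiveRoots n)

end Rep

/-! ### The representation `τ_p` of the isotropy group -/

/-- Complex-valued alternating `p`-forms on `ℝ^{2n}` that vanish as soon as one argument is `x`.
For a unit vector `x` these are (by restriction) the alternating `p`-forms on
`T_x S^{2n-1} = x^⊥`, that is, `⋀^p (T_x^* S^{2n-1})_ℂ`. -/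
def cotangent {n : ℕ} (x : E n) (p : ℕ) : Submodule ℂ (E n [⋀^Fin p]→L[ℝ] ℂ) where
  carrier := {α | ∀ v : Fin p → E n, (∃ i, v i = x) → α v = 0}
  add_mem' ha hb v hv := by simp [ha v hv, hb v hv]
  zero_mem' v _ := by simp
  smul_mem' c α hα v hv := by simp [hα v hv]

/-- The standard basis vector of `ℝ^{2n}` with label `o`. -/
def basePoint {n : ℕ} (o : Fin 2 × Fin n) : E n := EuclideanSpace.single o 1

/-- The isotropy group `K ≅ SO(2n-1)` of the base point in `SO(2n)`. For the last coordinate `o` it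
is `SO(2n-1)` embedded in the upper left-hand block. -/
def isotropy {n : ℕ} (o : Fin 2 × Fin n) : Subgroup (SO n) where
  carrier := {k | act k (basePoint o) = basePoint o}
  mul_mem' {a b} ha hb := by
    have ha' : act a (basePoint o) = basePoint o := ha
    have hb' : act b (basePoint o) = basePoint o := hb
    change act (a * b) (basePoint o) = basePoint o
    rw [map_mul, mul_apply_eq_comp, hb', ha']
  one_mem' := by
    change act 1 (basePoint o) = basePoint o
    rw [map_one, one_apply_eq_self]
  inv_mem' {a} ha := by
    have ha' : act a (basePoint o) = basePoint o := ha
    change act a⁻¹ (basePoint o) = basePoint o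
    conv_lhs => rw [← ha']
    rw [← mul_apply_eq_comp, ← map_mul, inv_mul_cancel, map_one,
      one_apply_eq_self]

/-- The representation `τ_p` of the isotropy group `K` on `⋀^p(𝔭_ℂ^*)`, where
`𝔭 = T_o(G/K) = o^⊥`: `(τ_p(k) α)(v₁, …, v_p) = α(k⁻¹ v₁, …, k⁻¹ v_p)`. -/
def tau {n : ℕ} (o : Fin 2 × Fin n) (p : ℕ) :
    Representation ℂ (isotropy o) (cotangent (basePoint o) p) where
  toFun k :=
    { toFun := fun α =>
        ⟨α.1.compContinuousLinearMap (act (k⁻¹).1), by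
          rintro v ⟨i, hi⟩
          refine α.2 _ ⟨i, ?_⟩
          change act (k⁻¹).1 (v i) = basePoint o
          rw [hi]
          exact (k⁻¹).2⟩
      map_add' := fun _ _ => rfl
      map_smul' := fun _ _ => rfl }
  map_one' := by
    ext α v
    change α.1 (fun i => act ((1 : isotropy o)⁻¹).1 (v i)) = α.1 v
    rw [inv_one, Subgroup.coe_one, map_one]
    rfl
  map_mul' k l := by
    ext α v
    change α.1 (fun i => act ((k * l)⁻¹).1 (v i)) =
      α.1 (fun i => act (l⁻¹).1 (act (k⁻¹).1 (v i)))
    rw [mul_inv_rev, Subgroup.coe_mul, map_mul]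
    rfl

/-- `π ∈ Ĝ_{τ_p}`: `Hom_K(τ_p, π|_K) ≠ 0`. -/
def IsSpherical {n : ℕ} {V : Type} [AddCommGroup V] [Module ℂ V] (o : Fin 2 × Fin n) (p : ℕ)
    (π : Representation ℂ (SO n) V) : Prop :=
  ∃ T : Representation.IntertwiningMap (tau o p) (π.comp (isotropy o).subtype), T ≠ 0

/-- `Γ` and `Γ'` are `τ_p`-representation equivalent in `SO(2n)`: `n_Γ(π) = n_Γ'(π)` for all
`π ∈ Ĝ_{τ_p}`. -/
def RepEquivalent {n : ℕ} (o : Fin 2 × Fin n) (p : ℕ) (Γ Γ' : Subgroup (SO n)) : Prop :=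
  ∀ (V : Type) [AddCommGroup V] [Module ℂ V] (π : Representation ℂ (SO n) V),
    IsIrrep π → IsSpherical o p π → mult Γ π = mult Γ' π

/-! ### Differential forms and the Hodge Laplacian on the round sphere `S^{2n-1}` -/

/-- A (not necessarily smooth) family of complex-valued alternating `p`-forms on `ℝ^{2n}`
parametrized by the unit sphere. A differential `p`-form on the sphere is such a family `α`
with `α x ∈ cotangent x p` for all `x`. -/
abbrev Form (n p : ℕ) := Metric.sphere (0 : E n) 1 → E n [⋀^Fin p]→L[ℝ] ℂ

/-- The pullback `r^*α` of a differential form on the sphere under the radial retraction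
`r(y) = y / ‖y‖` of `ℝ^{2n} ∖ {0}`. As `D r(y) v` is `‖y‖⁻¹ v` up to a multiple of `r(y)`, this is
`(r^*α)_y = ‖y‖^{-p} α_{r(y)}`. -/
def ext {n p : ℕ} (α : Form n p) (y : E n) : E n [⋀^Fin p]→L[ℝ] ℂ :=
  if h : y = 0 then 0
  else ((‖y‖⁻¹) ^ p) • α ⟨‖y‖⁻¹ • y, by simp [norm_smul, norm_ne_zero_iff.2 h]⟩

/-- `α` is a smooth differential `p`-form on the sphere. -/
def IsSmooth {n p : ℕ} (α : Form n p) : Prop :=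
  (∀ x : Metric.sphere (0 : E n) 1, α x ∈ cotangent (x : E n) p) ∧ ContDiffOn ℝ (⊤ : ℕ∞) (ext α) {0}ᶜ

/-- The exterior derivative of a differential form on the sphere, `dα = (d r^*α)|_S`. -/
def d {n p : ℕ} (α : Form n p) : Form n (p + 1) := fun x => extDeriv (ext α) x

/-- The codifferential `δα = -∑ᵢ ι_{eᵢ} ∇_{eᵢ} α` of a differential form on the round sphere. The
Levi-Civita connection of the sphere is the tangential part of the flat one, and the direction
normal to the sphere contributes `0` because `r^*α` is homogeneous and `ι_x α_x = 0`; so the sum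
may be taken over the standard basis of `ℝ^{2n}`. -/
def codiff {n p : ℕ} (α : Form n (p + 1)) : Form n p := fun x =>
  -∑ i, (fderiv ℝ (ext α) (x : E n) (EuclideanSpace.single i 1)).curryLeft
    (EuclideanSpace.single i 1)

/-- The Hodge Laplacian `dδ + δd` on `p`-forms (with `δ = 0` on functions). -/
def hodgeLaplacian {n : ℕ} : (p : ℕ) → Form n p → Form n p
  | 0, α => codiff (d α)
  | _ + 1, α => d (codiff α) + codiff (d α)

/-- `α` is invariant under `Γ`: `γ^*α = α` for all `γ ∈ Γ`. -/
def IsInvariant {n p : ℕ} (Γ : Subgroup (SO n)) (α : Form n p) : Prop :=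
  ∀ γ ∈ Γ, ∀ x y : Metric.sphere (0 : E n) 1, (y : E n) = act γ x →
    (α y).compContinuousLinearMap (act γ) = α x

section Linearity

variable {n p : ℕ}

theorem ext_add (α η : Form n p) : ext (α + η) = ext α + ext η := by
  funext y
  by_cases h : y = 0 <;> simp [ext, h]

theorem ext_smul (c : ℂ) (α : Form n p) : ext (c • α) = c • ext α := by
  funext y
  by_cases h : y = 0
  · simp only [ext, h, dite_true, Pi.smul_apply]
    ext v
    simp
  · simp only [ext, h, dite_false, Pi.smul_apply]
    exact smul_comm _ _ _

/-- Smoothness of the extension of the restriction to the sphere of a form on `ℝ^{2n} ∖ {0}`. -/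
theorem contDiffOn_ext {F : E n → E n [⋀^Fin p]→L[ℝ] ℂ} (hF : ContDiffOn ℝ (⊤ : ℕ∞) F {0}ᶜ) :
    ContDiffOn ℝ (⊤ : ℕ∞) (ext (fun x : Metric.sphere (0 : E n) 1 => F x)) {0}ᶜ := by
  have hn : ContDiffOn ℝ (⊤ : ℕ∞) (fun y : E n => ‖y‖⁻¹) {0}ᶜ := by
    refine ContDiffOn.inv (fun y hy => (contDiffAt_norm ℝ hy).contDiffWithinAt) ?_
    intro y hy
    exact norm_ne_zero_iff.2 hy
  have hr : ContDiffOn ℝ (⊤ : ℕ∞) (fun y : E n => ‖y‖⁻¹ • y) {0}ᶜ := hn.smul contDiffOn_id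
  have hm : Set.MapsTo (fun y : E n => ‖y‖⁻¹ • y) {0}ᶜ {0}ᶜ := by
    intro y hy
    simpa using hy
  refine ((hn.pow p).smul (hF.comp hr hm)).congr ?_
  intro y hy
  have hy' : y ≠ 0 := hy
  simp [ext, hy']

theorem contDiffOn_fderiv_ext {α : Form n p} (h : ContDiffOn ℝ (⊤ : ℕ∞) (ext α) {0}ᶜ) :
    ContDiffOn ℝ (⊤ : ℕ∞) (fderiv ℝ (ext α)) {0}ᶜ :=
  h.fderiv_of_isOpen isOpen_compl_singleton (by simp)

theorem contDiffOn_d {α : Form n p} (h : ContDiffOn ℝ (⊤ : ℕ∞) (ext α) {0}ᶜ) :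
    ContDiffOn ℝ (⊤ : ℕ∞) (ext (d α)) {0}ᶜ := by
  have hL : ContDiff ℝ (⊤ : ℕ∞) (fun f : E n →L[ℝ] E n [⋀^Fin p]→L[ℝ] ℂ =>
      ContinuousAlternatingMap.alternatizeUncurryFin f) :=
    ContinuousLinearMap.contDiff (𝕜 := ℝ) (E := E n →L[ℝ] E n [⋀^Fin p]→L[ℝ] ℂ)
      (F := E n [⋀^Fin (p + 1)]→L[ℝ] ℂ)
      (ContinuousAlternatingMap.alternatizeUncurryFinCLM ℝ (E n) ℂ)
  exact contDiffOn_ext (F := extDeriv (ext α)) (hL.comp_contDiffOn (contDiffOn_fderiv_ext h))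

theorem contDiffOn_codiff {α : Form n (p + 1)} (h : ContDiffOn ℝ (⊤ : ℕ∞) (ext α) {0}ᶜ) :
    ContDiffOn ℝ (⊤ : ℕ∞) (ext (codiff α)) {0}ᶜ := by
  refine contDiffOn_ext (F := fun y => -∑ i, (fderiv ℝ (ext α) y
    (EuclideanSpace.single i 1)).curryLeft (EuclideanSpace.single i 1)) ?_
  refine ContDiffOn.neg (ContDiffOn.sum fun i _ => ?_)
  have h1 := (contDiffOn_fderiv_ext h).clm_apply
    (contDiffOn_const (c := (EuclideanSpace.single i 1 : E n)))
  have h2 : ContDiff ℝ (⊤ : ℕ∞) (fun f : E n [⋀^Fin (p + 1)]→L[ℝ] ℂ => f.curryLeft) :=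
    ContinuousLinearMap.contDiff (𝕜 := ℝ) (E := E n [⋀^Fin (p + 1)]→L[ℝ] ℂ)
      (F := E n →L[ℝ] E n [⋀^Fin p]→L[ℝ] ℂ)
      (ContinuousAlternatingMap.curryLeftLI (𝕜 := ℝ) (E := E n) (F := ℂ)).toContinuousLinearMap
  exact (h2.comp_contDiffOn h1).clm_apply contDiffOn_const

theorem differentiableAt_ext {α : Form n p} (h : ContDiffOn ℝ (⊤ : ℕ∞) (ext α) {0}ᶜ)
    (x : Metric.sphere (0 : E n) 1) : DifferentiableAt ℝ (ext α) x := by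
  have hx : (x : E n) ≠ 0 := by
    intro h0
    have := x.2
    simp [h0] at this
  exact (h.contDiffAt (isOpen_compl_singleton.mem_nhds hx)).differentiableAt (by simp)

theorem d_add {α η : Form n p} (hα : ContDiffOn ℝ (⊤ : ℕ∞) (ext α) {0}ᶜ)
    (hη : ContDiffOn ℝ (⊤ : ℕ∞) (ext η) {0}ᶜ) : d (α + η) = d α + d η := by
  funext x
  simp only [d, ext_add, Pi.add_apply]
  exact extDeriv_add (differentiableAt_ext hα x) (differentiableAt_ext hη x)

theorem d_smul (c : ℂ) {α : Form n p} (hα : ContDiffOn ℝ (⊤ : ℕ∞) (ext α) {0}ᶜ) :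
    d (c • α) = c • d α := by
  funext x
  simp only [d, ext_smul, Pi.smul_apply]
  rw [extDeriv, fderiv_const_smul (differentiableAt_ext hα x)]
  ext v
  simp [extDeriv, ContinuousAlternatingMap.alternatizeUncurryFin_apply]

theorem codiff_add {α η : Form n (p + 1)} (hα : ContDiffOn ℝ (⊤ : ℕ∞) (ext α) {0}ᶜ)
    (hη : ContDiffOn ℝ (⊤ : ℕ∞) (ext η) {0}ᶜ) : codiff (α + η) = codiff α + codiff η := by
  funext x
  simp only [codiff, ext_add, Pi.add_apply]
  rw [fderiv_add (differentiableAt_ext hα x) (differentiableAt_ext hη x)]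
  ext v
  simp [Finset.sum_add_distrib]
  ring

theorem codiff_smul (c : ℂ) {α : Form n (p + 1)} (hα : ContDiffOn ℝ (⊤ : ℕ∞) (ext α) {0}ᶜ) :
    codiff (c • α) = c • codiff α := by
  funext x
  simp only [codiff, ext_smul, Pi.smul_apply]
  rw [fderiv_const_smul (differentiableAt_ext hα x)]
  ext v
  simp [Finset.mul_sum]

theorem hodgeLaplacian_add {α η : Form n p} (hα : ContDiffOn ℝ (⊤ : ℕ∞) (ext α) {0}ᶜ)
    (hη : ContDiffOn ℝ (⊤ : ℕ∞) (ext η) {0}ᶜ) :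
    hodgeLaplacian p (α + η) = hodgeLaplacian p α + hodgeLaplacian p η := by
  cases p with
  | zero =>
    simp only [hodgeLaplacian]
    rw [d_add hα hη, codiff_add (contDiffOn_d hα) (contDiffOn_d hη)]
  | succ p =>
    simp only [hodgeLaplacian]
    rw [d_add hα hη, codiff_add (contDiffOn_d hα) (contDiffOn_d hη), codiff_add hα hη,
      d_add (contDiffOn_codiff hα) (contDiffOn_codiff hη)]
    abel

theorem hodgeLaplacian_smul (c : ℂ) {α : Form n p} (hα : ContDiffOn ℝ (⊤ : ℕ∞) (ext α) {0}ᶜ) :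
    hodgeLaplacian p (c • α) = c • hodgeLaplacian p α := by
  cases p with
  | zero =>
    simp only [hodgeLaplacian]
    rw [d_smul c hα, codiff_smul c (contDiffOn_d hα)]
  | succ p =>
    simp only [hodgeLaplacian]
    rw [d_smul c hα, codiff_smul c (contDiffOn_d hα), codiff_smul c hα,
      d_smul c (contDiffOn_codiff hα), smul_add]

theorem contDiffOn_ext_zero : ContDiffOn ℝ (⊤ : ℕ∞) (ext (0 : Form n p)) {0}ᶜ := by
  have : ext (0 : Form n p) = fun _ => 0 := by
    funext y
    by_cases h : y = 0
    · simp only [ext, h, dite_true]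
    · simp only [ext, h, dite_false, Pi.zero_apply]
      ext v
      simp
  rw [this]
  exact contDiffOn_const

/-- The space of smooth `Γ`-invariant `p`-forms `α` on `S^{2n-1}` with `Δα = lam α`. Smooth
`p`-forms on `Γ\S^{2n-1}` are the same as smooth `Γ`-invariant `p`-forms on `S^{2n-1}`. -/
def eigenforms (Γ : Subgroup (SO n)) (p : ℕ) (lam : ℂ) : Submodule ℂ (Form n p) where
  carrier := {α | IsSmooth α ∧ IsInvariant Γ α ∧ hodgeLaplacian p α = lam • α}
  add_mem' {α η} hα hη := by
    refine ⟨⟨fun x => add_mem (hα.1.1 x) (hη.1.1 x), ?_⟩, ?_, ?_⟩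
    · rw [ext_add]; exact hα.1.2.add hη.1.2
    · intro γ hγ x y hxy
      have h1 := hα.2.1 γ hγ x y hxy
      have h2 := hη.2.1 γ hγ x y hxy
      rw [Pi.add_apply, Pi.add_apply, ← h1, ← h2]; rfl
    · rw [hodgeLaplacian_add hα.1.2 hη.1.2, hα.2.2, hη.2.2, smul_add]
  zero_mem' := by
    refine ⟨⟨fun x => zero_mem _, contDiffOn_ext_zero⟩, fun γ hγ x y hxy => rfl, ?_⟩
    have h := hodgeLaplacian_smul (0 : ℂ) (contDiffOn_ext_zero (n := n) (p := p))
    rw [zero_smul ℂ (hodgeLaplacian p (0 : Form n p)), zero_smul ℂ (0 : Form n p)] at h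
    exact h.trans (smul_zero (A := Form n p) lam).symm
  smul_mem' c α hα := by
    refine ⟨⟨fun x => Submodule.smul_mem _ c (hα.1.1 x), ?_⟩, ?_, ?_⟩
    · rw [ext_smul]; exact hα.1.2.const_smul c
    · intro γ hγ x y hxy
      rw [Pi.smul_apply, Pi.smul_apply, ← hα.2.1 γ hγ x y hxy]; rfl
    · rw [hodgeLaplacian_smul c hα.1.2, hα.2.2, smul_comm]

end Linearity

/-- `Γ\S^{2n-1}` and `Γ'\S^{2n-1}` are isospectral on `p`-forms: every `lam` has the same
multiplicity as an eigenvalue of the Hodge Laplacian on `p`-forms of either space. -/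
def IsospectralOnForms {n : ℕ} (p : ℕ) (Γ Γ' : Subgroup (SO n)) : Prop :=
  ∀ lam : ℂ, Module.rank ℂ (eigenforms Γ p lam) = Module.rank ℂ (eigenforms Γ' p lam)

/-! ### Lens space groups -/

/-- The subgroup of `SO(2n)` generated by `diag(R(2π s₁/q), …, R(2π sₙ/q))`. -/
def lensGroup {n : ℕ} (q : ℕ) (s : Fin n → ℤ) : Subgroup (SO n) :=
  Subgroup.zpowers (torus fun j => 2 * Real.pi * (s j : ℝ) / (q : ℝ))

/-- `Γ` acts freely on the unit sphere `S^{2n-1}`. -/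
def ActsFreely {n : ℕ} (Γ : Subgroup (SO n)) : Prop :=
  ∀ γ ∈ Γ, ∀ x : Metric.sphere (0 : E n) 1, act γ (x : E n) = x → γ = 1

/-- `Γ` and `Γ'` are conjugate in `O(2n)`. -/
def ConjugateInO {n : ℕ} (Γ Γ' : Subgroup (SO n)) : Prop :=
  ∃ g ∈ Matrix.orthogonalGroup (Fin 2 × Fin n) ℝ,
    (fun γ : SO n => (γ : Matrix (Fin 2 × Fin n) (Fin 2 × Fin n) ℝ)) '' (Γ' : Set (SO n)) =
      (fun γ : SO n => g * (γ : Matrix (Fin 2 × Fin n) (Fin 2 × Fin n) ℝ) * g.transpose) ''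
        (Γ : Set (SO n))

/-- The tuple `(1, …, 1, e)` of length `n`. -/
def onesLast (n : ℕ) (e : ℤ) : Fin n → ℤ := fun j => if (j : ℕ) + 1 = n then e else 1

end LensForms

end

/-!
The argument takes place in the middle-degree forms `⋀ⁿ(ℝ^{2n})^*_ℂ` (`MidForm`) with the action of
`SO(2n)` by pullback (`midRep`). The Hodge star (`star`) commutes with rotations, anticommutes with
reflections (`star_pull`), and its square is a scalar (`star_star`). So the forms split into two
eigenspaces of the star (`starSpace`) that a reflection exchanges; these are the representations
`π_±`.

* *Irreducibility.* A subspace stable under rotations is stable under all signed permutations of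
  determinant one. Averaging over diagonal sign changes, a nonzero element with the fewest nonzero
  coordinates is supported on one index set and its complement, and is therefore a multiple of
  `α + c⁻¹ ⋆α` for a coordinate form `α`, where `c` is the eigenvalue. Subtracting multiples of its
  images under signed permutations reduces every element of the eigenspace to zero
  (`starSpace_le_of_rotationInvariant`, `isIrrep_starRep`).
* *Highest weight.* In the basis of wedge products of the covectors `dx_j ± i dy_j` the torus acts
  diagonally. A weight `±ε₁ ± ⋯ ± εₙ` occurs once in all the middle-degree forms, and the star acts
  on its vector by a scalar proportional to the product of the signs. This decides which extreme
  weights occur in which eigenspace (`hasHighestWeight_starRep`).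
* *Multiplicity.* By Frobenius reciprocity, `n_Γ(π)` is the dimension of the `Γ`-invariant
  functionals on `π` (`mult_eq_finrank_invariantFunctionals`). An intertwining map into
  `L²(Γ\G)` consists of matrix coefficients almost everywhere, by Fubini's theorem. For a cyclic
  group this is the dimension of the space fixed by a generator (`mult_zpowers`).
* *Counting.* The reflection carries the fixed space of the generator of `Γ'` in `π_+` to the fixed
  space of the generator of `Γ` in `π_-`. So `n_Γ(π_+) - n_Γ'(π_+)` is the difference of the
  dimensions of the fixed spaces of one generator in `π_+` and `π_-`, which up to normalization is
  the trace of the star on the fixed middle-degree forms (`finrank_fixedSpace_sub`). Only extreme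
  weight vectors contribute to the trace. As `n < q`, the fixed ones have as many plus signs as
  minus signs; there are `n.choose (n / 2)` of these, each contributing `(-1) ^ (n / 2)`.
* *Spherical representations.* A tangential `(n-1)`-form, wedged with the covector of the base
  point, becomes a middle-degree form, and projecting its star to an eigenspace of the star gives a
  nonzero intertwining map of the isotropy group (`isSpherical_starRep`).
* *Isospectrality.* The reflection in the last coordinate is an isometry of the sphere that
  conjugates `Γ` to `Γ'`; pullback along it commutes with the Hodge Laplacian
  (`isospectralOnForms_of_reflConj`).
-/

noncomputable section

namespace LensForms

/-! ### The star operator on middle-degree forms -/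

/-- Complex alternating `n`-forms on `ℂ^{2n}`: a model of `⋀ⁿ(ℝ^{2n})^*_ℂ`. -/
abbrev MidForm (n : ℕ) := (Fin 2 × Fin n → ℂ) [⋀^Fin n]→ₗ[ℂ] ℂ

/-- A real matrix regarded as a complex one. -/
def cmat {n : ℕ} : Matrix (Fin 2 × Fin n) (Fin 2 × Fin n) ℝ →+*
    Matrix (Fin 2 × Fin n) (Fin 2 × Fin n) ℂ := Complex.ofRealHom.mapMatrix

theorem cmat_apply {n : ℕ} (A : Matrix (Fin 2 × Fin n) (Fin 2 × Fin n) ℝ) (i j) :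
    cmat A i j = (A i j : ℂ) := rfl

theorem cmat_transpose {n : ℕ} (A : Matrix (Fin 2 × Fin n) (Fin 2 × Fin n) ℝ) :
    (cmat A).transpose = cmat A.transpose := rfl

theorem cmat_det {n : ℕ} (A : Matrix (Fin 2 × Fin n) (Fin 2 × Fin n) ℝ) :
    (cmat A).det = (A.det : ℂ) := (RingHom.map_det Complex.ofRealHom A).symm

/-- Pullback of a form along a matrix. -/
def pull {n : ℕ} (A : Matrix (Fin 2 × Fin n) (Fin 2 × Fin n) ℂ) : MidForm n →ₗ[ℂ] MidForm n where
  toFun α := α.compLinearMap A.mulVecLin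
  map_add' _ _ := rfl
  map_smul' _ _ := rfl

theorem pull_apply {n : ℕ} (A : Matrix (Fin 2 × Fin n) (Fin 2 × Fin n) ℂ) (α : MidForm n)
    (v : Fin n → Fin 2 × Fin n → ℂ) : pull A α v = α fun i => A.mulVec (v i) := rfl

theorem pull_one {n : ℕ} : pull (1 : Matrix (Fin 2 × Fin n) (Fin 2 × Fin n) ℂ) = 1 := by
  ext α v
  simp [pull_apply]

theorem pull_mul {n : ℕ} (A B : Matrix (Fin 2 × Fin n) (Fin 2 × Fin n) ℂ) :
    pull (A * B) = pull B * pull A := by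
  ext α v
  simp [pull_apply]

/-- Evaluation of a form at a tuple of vectors. -/
def evalAt {n : ℕ} (v : Fin n → Fin 2 × Fin n → ℂ) : MidForm n →ₗ[ℂ] ℂ where
  toFun α := α v
  map_add' _ _ := rfl
  map_smul' _ _ := rfl

/-- The standard basis vector of `ℂ^{2n}` with label `k`. -/
def stdVec {n : ℕ} (k : Fin 2 × Fin n) : Fin 2 × Fin n → ℂ := Pi.single k 1

/-- The matrix whose rows with labels `(c, i)` are the `v i`, and whose remaining rows are the
`r i`. -/
def halfRows {n : ℕ} (c : Fin 2) (r v : Fin n → Fin 2 × Fin n → ℂ) :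
    Matrix (Fin 2 × Fin n) (Fin 2 × Fin n) ℂ :=
  Matrix.of fun p => if p.1 = c then v p.2 else r p.2

theorem halfRows_apply {n : ℕ} (c : Fin 2) (r v : Fin n → Fin 2 × Fin n → ℂ) (p q) :
    halfRows c r v p q = if p.1 = c then v p.2 q else r p.2 q := by
  rw [halfRows, Matrix.of_apply]
  split_ifs <;> rfl

theorem halfRows_update {n : ℕ} (c : Fin 2) (r v : Fin n → Fin 2 × Fin n → ℂ) (i : Fin n) (z) :
    halfRows c r (Function.update v i z) = (halfRows c r v).updateRow (c, i) z := by
  ext ⟨a, b⟩ q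
  rw [halfRows_apply, Matrix.updateRow_apply, halfRows_apply]
  by_cases ha : a = c <;> by_cases hb : b = i <;> simp [ha, hb]

/-- The form `v ↦ det`, where the `n` rows with labels `(c, i)` are the arguments `v i` and the
remaining `n` rows are the fixed vectors `r i`. -/
def halfDet {n : ℕ} (c : Fin 2) (r : Fin n → Fin 2 × Fin n → ℂ) : MidForm n where
  toFun v := (halfRows c r v).det
  map_update_add' := by
    intro inst v i x y
    obtain rfl : inst = instDecidableEqFin n := Subsingleton.elim _ _
    simp only [halfRows_update, Matrix.det_updateRow_add]
  map_update_smul' := by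
    intro inst v i s x
    obtain rfl : inst = instDecidableEqFin n := Subsingleton.elim _ _
    simp only [halfRows_update, Matrix.det_updateRow_smul, smul_eq_mul]
  map_eq_zero_of_eq' := by
    intro v i j hij hne
    refine Matrix.det_zero_of_row_eq (i := (c, i)) (j := (c, j)) (by simp [hne]) ?_
    funext q
    simp [halfRows_apply, hij]

theorem halfDet_apply {n : ℕ} (c : Fin 2) (r v : Fin n → Fin 2 × Fin n → ℂ) :
    halfDet c r v = (halfRows c r v).det := rfl

theorem halfDet_zero_apply {n : ℕ} (r v : Fin n → Fin 2 × Fin n → ℂ) :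
    halfDet 0 r v = halfDet 1 v r := by
  rw [halfDet_apply, halfDet_apply]
  congr 1
  ext ⟨a, b⟩ q
  fin_cases a <;> simp [halfRows_apply]

theorem halfDet_mulVec {n : ℕ} (A : Matrix (Fin 2 × Fin n) (Fin 2 × Fin n) ℂ) (c : Fin 2)
    (r v : Fin n → Fin 2 × Fin n → ℂ) :
    halfDet c (fun i => A.mulVec (r i)) (fun i => A.mulVec (v i)) = A.det * halfDet c r v := by
  rw [halfDet_apply, halfDet_apply, mul_comm, ← Matrix.det_transpose A, ← Matrix.det_mul]
  congr 1
  ext p q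
  rw [Matrix.mul_apply, halfRows_apply]
  by_cases h : p.1 = c <;> simp [h, halfRows_apply, Matrix.mulVec, dotProduct, mul_comm]

/-- Exchanging the two halves of the rows multiplies `halfDet` by a sign which does not depend on
the rows. -/
theorem exists_halfDet_comm (n : ℕ) : ∃ s : ℂ, s * s = 1 ∧
    ∀ r v : Fin n → Fin 2 × Fin n → ℂ, halfDet 1 v r = s * halfDet 1 r v := by
  let τ : Equiv.Perm (Fin 2 × Fin n) := Equiv.prodCongr (Equiv.swap 0 1) (Equiv.refl _)
  refine ⟨((Equiv.Perm.sign τ : ℤ) : ℂ), ?_, fun r v => ?_⟩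
  · rcases Int.units_eq_one_or (Equiv.Perm.sign τ) with h | h <;> rw [h] <;> simp
  · rw [halfDet_apply, halfDet_apply, ← Matrix.det_permute]
    congr 1
    ext ⟨a, b⟩ q
    fin_cases a <;> simp [τ, halfRows_apply]

/-- The Hodge star on middle-degree forms, up to the factor `n!`: the contraction of `α` with the
volume form. -/
def star {n : ℕ} : MidForm n →ₗ[ℂ] MidForm n where
  toFun α := ∑ w : Fin n → Fin 2 × Fin n,
    α (fun i => stdVec (w i)) • halfDet 1 (fun i => stdVec (w i))
  map_add' α β := by
    simp [add_smul, Finset.sum_add_distrib]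
  map_smul' c α := by
    simp [Finset.smul_sum, mul_smul]

theorem star_apply {n : ℕ} (α : MidForm n) (v : Fin n → Fin 2 × Fin n → ℂ) :
    star α v = ∑ w : Fin n → Fin 2 × Fin n,
      α (fun i => stdVec (w i)) * halfDet 1 (fun i => stdVec (w i)) v := by
  change evalAt v (∑ w : Fin n → Fin 2 × Fin n,
    α (fun i => stdVec (w i)) • halfDet 1 (fun i => stdVec (w i))) = _
  rw [map_sum]
  rfl

/-- Contraction of two multilinear maps over dual bases moves a linear map from one factor to the
other as its transpose. -/
theorem sum_multilinear_transpose {R S V V' ι : Type*} [CommSemiring R] [CommSemiring S]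
    [Algebra R S] [AddCommMonoid V] [Module R V] [AddCommMonoid V'] [Module R V'] [Fintype ι]
    [DecidableEq ι] {m : ℕ}
    (M : MultilinearMap R (fun _ : Fin m => V) S) (N : MultilinearMap R (fun _ : Fin m => V') S)
    (x : ι → V) (y : ι → V') (A : V → V) (B : V' → V') (a : ι → ι → R)
    (hA : ∀ k, A (x k) = ∑ l, a l k • x l) (hB : ∀ k, B (y k) = ∑ l, a k l • y l) :
    ∑ w : Fin m → ι, M (fun i => A (x (w i))) * N (fun i => y (w i)) =
      ∑ w : Fin m → ι, M (fun i => x (w i)) * N (fun i => B (y (w i))) := by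
  have h1 : ∀ w : Fin m → ι, M (fun i => A (x (w i))) =
      ∑ u : Fin m → ι, (∏ i, a (u i) (w i)) • M (fun i => x (u i)) := fun w => by
    simp only [hA, MultilinearMap.map_sum, MultilinearMap.map_smul_univ]
  have h2 : ∀ w : Fin m → ι, N (fun i => B (y (w i))) =
      ∑ u : Fin m → ι, (∏ i, a (w i) (u i)) • N (fun i => y (u i)) := fun w => by
    simp only [hB, MultilinearMap.map_sum, MultilinearMap.map_smul_univ]
  simp only [h1, h2, Finset.sum_mul, Finset.mul_sum]
  rw [Finset.sum_comm]
  simp only [smul_mul_assoc, mul_smul_comm]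

theorem mulVec_stdVec {n : ℕ} (A : Matrix (Fin 2 × Fin n) (Fin 2 × Fin n) ℂ) (k) :
    A.mulVec (stdVec k) = ∑ l, A l k • stdVec l := by
  funext j
  simp [stdVec, Finset.sum_apply, Pi.single_apply]

/-- The star operator commutes with rotations and anticommutes with reflections. -/
theorem star_pull {n : ℕ} {A : Matrix (Fin 2 × Fin n) (Fin 2 × Fin n) ℂ}
    (hA : A * A.transpose = 1) (α : MidForm n) : star (pull A α) = A.det • pull A (star α) := by
  have hd : A.det * A.det = 1 := by
    have := congrArg Matrix.det hA
    rwa [Matrix.det_mul, Matrix.det_transpose, Matrix.det_one] at this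
  ext v
  rw [AlternatingMap.smul_apply, smul_eq_mul, pull_apply, star_apply, star_apply]
  have h1 : ∀ w : Fin n → Fin 2 × Fin n, halfDet 1 (fun i => stdVec (w i)) v =
      A.det * pull A (halfDet 0 (fun i => A.mulVec (v i))) (fun i => stdVec (w i)) := fun w => by
    rw [pull_apply, halfDet_zero_apply, halfDet_mulVec, ← mul_assoc, hd, one_mul]
  simp only [h1, pull_apply]
  rw [Finset.mul_sum]
  have h2 := sum_multilinear_transpose α.toMultilinearMap
    (pull A (halfDet 0 (fun i => A.mulVec (v i)))).toMultilinearMap stdVec stdVec A.mulVec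
    A.transpose.mulVec A (mulVec_stdVec A) (mulVec_stdVec A.transpose)
  simp only [AlternatingMap.coe_multilinearMap, pull_apply, Matrix.mulVec_mulVec, hA,
    Matrix.one_mulVec] at h2
  simp only [mul_left_comm _ A.det]
  rw [← Finset.mul_sum, ← Finset.mul_sum, h2]
  simp only [halfDet_zero_apply]

/-- `w` and `u` together enumerate all coordinates. -/
def Complementary {n : ℕ} (w u : Fin n → Fin 2 × Fin n) : Prop :=
  Function.Bijective fun p : Fin 2 × Fin n => if p.1 = 1 then u p.2 else w p.2

theorem halfRows_stdVec {n : ℕ} (w u : Fin n → Fin 2 × Fin n) (p : Fin 2 × Fin n) :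
    halfRows 1 (fun i => stdVec (w i)) (fun i => stdVec (u i)) p =
      stdVec (if p.1 = 1 then u p.2 else w p.2) := by
  funext q
  rw [halfRows_apply]
  split_ifs <;> rfl

theorem halfDet_stdVec_sq {n : ℕ} {w u : Fin n → Fin 2 × Fin n} (h : Complementary w u) :
    halfDet 1 (fun i => stdVec (w i)) (fun i => stdVec (u i)) *
      halfDet 1 (fun i => stdVec (w i)) (fun i => stdVec (u i)) = 1 := by
  let σ : Equiv.Perm (Fin 2 × Fin n) := Equiv.ofBijective _ h
  have : halfDet 1 (fun i => stdVec (w i)) (fun i => stdVec (u i)) =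
      ((Equiv.Perm.sign σ : ℤ) : ℂ) := by
    rw [halfDet_apply, ← mul_one ((Equiv.Perm.sign σ : ℤ) : ℂ),
      ← Matrix.det_one (n := Fin 2 × Fin n) (R := ℂ), ← Matrix.det_permute]
    congr 1
    ext p q
    rw [halfRows_stdVec, Matrix.submatrix_apply, Matrix.one_apply, stdVec, Pi.single_apply, id_eq]
    exact if_congr eq_comm rfl rfl
  rw [this]
  rcases Int.units_eq_one_or (Equiv.Perm.sign σ) with h | h <;> rw [h] <;> simp

theorem halfDet_stdVec_eq_zero {n : ℕ} {w u : Fin n → Fin 2 × Fin n} (h : ¬ Complementary w u) :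
    halfDet 1 (fun i => stdVec (w i)) (fun i => stdVec (u i)) = 0 := by
  have h' : ¬ Function.Injective
      fun p : Fin 2 × Fin n => if p.1 = 1 then u p.2 else w p.2 :=
    fun hi => h (Finite.injective_iff_bijective.1 hi)
  simp only [Function.Injective, not_forall] at h'
  obtain ⟨p, q, hpq, hne⟩ := h'
  exact Matrix.det_zero_of_row_eq hne (by rw [halfRows_stdVec, halfRows_stdVec, hpq])

theorem complementary_iff {n : ℕ} {w u : Fin n → Fin 2 × Fin n} :
    Complementary w u ↔ Function.Injective w ∧ Function.Injective u ∧ ∀ i j, w i ≠ u j := by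
  rw [Complementary, ← Finite.injective_iff_bijective]
  constructor
  · intro h
    refine ⟨fun i j hij => ?_, fun i j hij => ?_, fun i j hij => ?_⟩
    · exact congrArg Prod.snd (@h (0, i) (0, j) (by simpa using hij))
    · exact congrArg Prod.snd (@h (1, i) (1, j) (by simpa using hij))
    · have := congrArg Prod.fst (@h (0, i) (1, j) (by simpa using hij))
      simp at this
  · rintro ⟨hw, hu, hwu⟩ ⟨a, i⟩ ⟨b, j⟩ hij
    fin_cases a <;> fin_cases b <;> simp at hij
    · rw [hw hij]
    · exact absurd hij (hwu _ _)
    · exact absurd hij.symm (hwu _ _)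
    · rw [hu hij]

theorem Complementary.symm {n : ℕ} {w u : Fin n → Fin 2 × Fin n} (h : Complementary w u) :
    Complementary u w := by
  rw [complementary_iff] at h ⊢
  exact ⟨h.2.1, h.1, fun i j => (h.2.2 j i).symm⟩

theorem complementary_iff_range {n : ℕ} {w u : Fin n → Fin 2 × Fin n} (hw : Function.Injective w)
    (hu : Function.Injective u) : Complementary w u ↔ Set.range u = (Set.range w)ᶜ := by
  constructor
  · intro h
    ext k
    constructor
    · rintro ⟨j, rfl⟩ ⟨i, hi⟩
      exact (complementary_iff.1 h).2.2 i j hi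
    · intro hk
      obtain ⟨⟨a, i⟩, hp⟩ := h.2 k
      by_cases ha : a = 1
      · exact ⟨i, by simpa [ha] using hp⟩
      · exact absurd ⟨i, by simpa [ha] using hp⟩ hk
  · intro h
    refine complementary_iff.2 ⟨hw, hu, fun i j hij => ?_⟩
    have : u j ∈ (Set.range w)ᶜ := h ▸ ⟨j, rfl⟩
    exact this ⟨i, hij⟩

theorem exists_complementary {n : ℕ} {w : Fin n → Fin 2 × Fin n} (hw : Function.Injective w) :
    ∃ u, Complementary w u := by
  classical
  have hc : Fintype.card {k // k ∉ Set.range w} = n := by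
    rw [Fintype.card_subtype_compl]
    have : Fintype.card {k // k ∈ Set.range w} = n :=
      (Fintype.card_congr (Equiv.ofInjective w hw)).symm.trans (Fintype.card_fin n)
    rw [this]
    simp
    omega
  let e := (Fintype.equivFinOfCardEq hc).symm
  exact ⟨fun i => (e i).1, complementary_iff.2 ⟨hw, fun i j h => e.injective (Subtype.ext h),
    fun i j h => (e j).2 ⟨i, h⟩⟩⟩

/-- Two tuples without repetitions with the same range differ by a permutation of the indices. -/
theorem exists_perm_of_range_eq {ι : Type*} {n : ℕ} {w u : Fin n → ι}
    (hu : Function.Injective u) (h : Set.range w = Set.range u) :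
    ∃ σ : Equiv.Perm (Fin n), u = w ∘ σ := by
  have h' : ∀ i, ∃ j, w j = u i := fun i => by
    have : u i ∈ Set.range w := h ▸ ⟨i, rfl⟩
    exact this
  choose f hf using h'
  have hfi : Function.Injective f := fun i j hij => hu (by rw [← hf, ← hf, hij])
  exact ⟨Equiv.ofBijective f (Finite.injective_iff_bijective.1 hfi),
    funext fun i => (hf i).symm⟩

/-- A sum over multi-indices of a function supported on the rearrangements of `w`, and invariant
under rearrangement. -/
theorem sum_eq_factorial_mul {ι : Type*} [Fintype ι] {m : ℕ} {f : (Fin m → ι) → ℂ}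
    {w : Fin m → ι} (hw : Function.Injective w)
    (hf : ∀ x, f x ≠ 0 → ∃ σ : Equiv.Perm (Fin m), x = w ∘ σ)
    (hσ : ∀ σ : Equiv.Perm (Fin m), f (w ∘ σ) = f w) : ∑ x, f x = m.factorial * f w := by
  classical
  have hinj : Set.InjOn (fun σ : Equiv.Perm (Fin m) => w ∘ σ)
      (Finset.univ : Finset (Equiv.Perm (Fin m))) := fun σ _ τ _ hστ =>
    Equiv.ext fun i => hw (congrFun hστ i)
  have h1 : ∑ x, f x = ∑ σ : Equiv.Perm (Fin m), f (w ∘ σ) := by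
    rw [← Finset.sum_image (s := Finset.univ) (f := f) hinj]
    symm
    refine Finset.sum_subset (Finset.subset_univ _) fun x _ hx => ?_
    by_contra h0
    obtain ⟨σ, rfl⟩ := hf x h0
    exact hx (Finset.mem_image.2 ⟨σ, Finset.mem_univ _, rfl⟩)
  rw [h1, Finset.sum_congr rfl fun σ _ => hσ σ]
  simp [Fintype.card_perm]

/-- The product of two alternating maps, evaluated on the same arguments, is symmetric. -/
theorem alternating_mul_comp_perm {R V V' ι : Type*} [CommRing R] [Algebra R ℂ] [AddCommGroup V]
    [Module R V] [AddCommGroup V'] [Module ℂ V'] {m : ℕ} (M : V [⋀^Fin m]→ₗ[R] ℂ)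
    (N : V' [⋀^Fin m]→ₗ[ℂ] ℂ) (x : ι → V) (y : ι → V') (w : Fin m → ι)
    (σ : Equiv.Perm (Fin m)) :
    M (fun i => x ((w ∘ σ) i)) * N (fun i => y ((w ∘ σ) i)) =
      M (fun i => x (w i)) * N (fun i => y (w i)) := by
  have e1 := M.map_perm (fun i => x (w i)) σ
  have e2 := N.map_perm (fun i => y (w i)) σ
  refine (congrArg₂ (· * ·) e1 e2).trans ?_
  rcases Int.units_eq_one_or (Equiv.Perm.sign σ) with h | h <;> rw [h] <;> simp

/-- In the standard basis, the star operator sends a multi-index to its complement. -/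
theorem star_apply_stdVec {n : ℕ} (α : MidForm n) {w u : Fin n → Fin 2 × Fin n}
    (h : Complementary w u) : star α (fun i => stdVec (u i)) =
      (n.factorial : ℂ) * (α (fun i => stdVec (w i)) *
        halfDet 1 (fun i => stdVec (w i)) (fun i => stdVec (u i))) := by
  obtain ⟨hw, hu, -⟩ := complementary_iff.1 h
  rw [star_apply]
  simp only [← halfDet_zero_apply]
  refine sum_eq_factorial_mul (f := fun x => α (fun i => stdVec (x i)) *
    halfDet 0 (fun i => stdVec (u i)) (fun i => stdVec (x i))) hw (fun x hx => ?_)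
    fun σ => alternating_mul_comp_perm α (halfDet 0 fun i => stdVec (u i)) stdVec stdVec w σ
  have hc : Complementary x u := by
    by_contra hc
    refine hx ?_
    rw [halfDet_zero_apply, halfDet_stdVec_eq_zero hc, mul_zero]
  have hxi := (complementary_iff.1 hc).1
  refine exists_perm_of_range_eq hxi ?_
  rw [(complementary_iff_range hu hw).1 h.symm, (complementary_iff_range hu hxi).1 hc.symm]

theorem midForm_ext {n : ℕ} {α β : MidForm n}
    (h : ∀ w : Fin n → Fin 2 × Fin n, Function.Injective w →
      α (fun i => stdVec (w i)) = β (fun i => stdVec (w i))) : α = β := by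
  refine Module.Basis.ext_alternating (Pi.basisFun ℂ (Fin 2 × Fin n)) fun w hw => ?_
  simpa [stdVec] using h w hw

theorem exists_star_star (n : ℕ) : ∃ κ : ℂ, κ ≠ 0 ∧ ∀ α : MidForm n, star (star α) = κ • α := by
  obtain ⟨s, hs, hcomm⟩ := exists_halfDet_comm n
  have hs0 : s ≠ 0 := fun h => by simp [h] at hs
  have hf : (n.factorial : ℂ) ≠ 0 := by exact_mod_cast n.factorial_ne_zero
  refine ⟨n.factorial * n.factorial * s, by simp [hs0, hf], fun α => midForm_ext fun w hw => ?_⟩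
  obtain ⟨u, hu⟩ := exists_complementary hw
  rw [star_apply_stdVec _ hu.symm, star_apply_stdVec _ hu, hcomm]
  have := halfDet_stdVec_sq hu.symm
  rw [AlternatingMap.smul_apply, smul_eq_mul]
  linear_combination (n.factorial * n.factorial * s * α fun i => stdVec (w i)) * this

/-! ### Irreducibility of the eigenspaces of the star operator -/

/-- The coordinate of a form at a multi-index of standard basis vectors. -/
def coord {n : ℕ} (α : MidForm n) (w : Fin n → Fin 2 × Fin n) : ℂ := α fun i => stdVec (w i)

/-- The set of multi-indices at which the coordinate of a form does not vanish. -/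
def coordSupport {n : ℕ} (α : MidForm n) : Finset (Fin n → Fin 2 × Fin n) := by
  classical exact Finset.univ.filter fun w => coord α w ≠ 0

theorem mem_coordSupport {n : ℕ} {α : MidForm n} {w : Fin n → Fin 2 × Fin n} :
    w ∈ coordSupport α ↔ coord α w ≠ 0 := by
  classical simp [coordSupport]

theorem injective_of_coord_ne_zero {n : ℕ} {α : MidForm n} {w : Fin n → Fin 2 × Fin n}
    (h : coord α w ≠ 0) : Function.Injective w := fun i j hij => by
  by_contra hne
  exact h (α.map_eq_zero_of_eq _ (by rw [hij]) hne)

theorem eq_zero_of_coord {n : ℕ} {α : MidForm n} (h : ∀ w, coord α w = 0) : α = 0 :=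
  midForm_ext fun w _ => h w

theorem coord_comp_perm_ne_zero {n : ℕ} {α : MidForm n} {w : Fin n → Fin 2 × Fin n}
    (σ : Equiv.Perm (Fin n)) : coord α (w ∘ σ) ≠ 0 ↔ coord α w ≠ 0 := by
  have := α.map_perm (fun i => stdVec (w i)) σ
  change α ((fun i => stdVec (w i)) ∘ σ) ≠ 0 ↔ α (fun i => stdVec (w i)) ≠ 0
  rw [this]
  rcases Int.units_eq_one_or (Equiv.Perm.sign σ) with h | h <;> rw [h] <;> simp

/-- The matrix sending the `k`-th standard basis vector to `d k` times the `σ k`-th one. -/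
def signedPerm {n : ℕ} (σ : Equiv.Perm (Fin 2 × Fin n)) (d : Fin 2 × Fin n → ℝ) :
    Matrix (Fin 2 × Fin n) (Fin 2 × Fin n) ℝ :=
  (Matrix.diagonal d).submatrix σ.symm id

theorem signedPerm_apply {n : ℕ} (σ : Equiv.Perm (Fin 2 × Fin n)) (d : Fin 2 × Fin n → ℝ) (i j) :
    signedPerm σ d i j = if i = σ j then d j else 0 := by
  rw [signedPerm, Matrix.submatrix_apply, Matrix.diagonal_apply, id_eq]
  by_cases h : i = σ j
  · subst h; simp
  · rw [if_neg h, if_neg]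
    rintro rfl
    simp at h

theorem signedPerm_mul_transpose {n : ℕ} (σ : Equiv.Perm (Fin 2 × Fin n))
    {d : Fin 2 × Fin n → ℝ} (hd : ∀ k, d k * d k = 1) :
    signedPerm σ d * (signedPerm σ d).transpose = 1 := by
  ext i j
  obtain ⟨k, rfl⟩ := σ.surjective i
  rw [Matrix.mul_apply, Finset.sum_eq_single k]
  · rw [Matrix.transpose_apply, signedPerm_apply, signedPerm_apply, if_pos rfl, Matrix.one_apply]
    by_cases h : j = σ k
    · rw [if_pos h, if_pos h.symm, hd]
    · rw [if_neg h, if_neg (Ne.symm h), mul_zero]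
  · intro l _ hl
    rw [signedPerm_apply, if_neg (σ.injective.ne hl.symm), zero_mul]
  · simp

theorem det_signedPerm {n : ℕ} (σ : Equiv.Perm (Fin 2 × Fin n)) (d : Fin 2 × Fin n → ℝ) :
    (signedPerm σ d).det = (Equiv.Perm.sign σ : ℤ) * ∏ k, d k := by
  rw [signedPerm, Matrix.det_permute, Matrix.det_diagonal, Equiv.Perm.sign_symm]

theorem signedPerm_mulVec {n : ℕ} (σ : Equiv.Perm (Fin 2 × Fin n)) (d : Fin 2 × Fin n → ℝ) (k) :
    (cmat (signedPerm σ d)).mulVec (stdVec k) = (d k : ℂ) • stdVec (σ k) := by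
  funext i
  simp only [stdVec, Matrix.mulVec_single_one, Matrix.col_apply, cmat_apply, signedPerm_apply,
    Pi.smul_apply, Pi.single_apply, smul_eq_mul, mul_ite, mul_one, mul_zero]
  split_ifs <;> simp

theorem coord_pull_signedPerm {n : ℕ} (σ : Equiv.Perm (Fin 2 × Fin n)) (d : Fin 2 × Fin n → ℝ)
    (α : MidForm n) (w : Fin n → Fin 2 × Fin n) :
    coord (pull (cmat (signedPerm σ d)) α) w = (∏ i, (d (w i) : ℂ)) * coord α (σ ∘ w) := by
  rw [coord, pull_apply]
  simp only [signedPerm_mulVec]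
  exact α.map_smul_univ (fun i => (d (w i) : ℂ)) fun i => stdVec (σ (w i))

/-- A subspace of forms is invariant if it is stable under the rotation group. -/
def RotationInvariant {n : ℕ} (W : Submodule ℂ (MidForm n)) : Prop :=
  ∀ A ∈ Matrix.specialOrthogonalGroup (Fin 2 × Fin n) ℝ, ∀ α ∈ W, pull (cmat A) α ∈ W

theorem signedPerm_mem {n : ℕ} {σ : Equiv.Perm (Fin 2 × Fin n)}
    {d : Fin 2 × Fin n → ℝ} (hd : ∀ k, d k * d k = 1)
    (h : ((Equiv.Perm.sign σ : ℤ) : ℝ) * ∏ k, d k = 1) :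
    signedPerm σ d ∈ Matrix.specialOrthogonalGroup (Fin 2 × Fin n) ℝ :=
  Matrix.mem_specialOrthogonalGroup_iff.2 ⟨(Matrix.mem_orthogonalGroup_iff _ _).2
    (signedPerm_mul_transpose σ hd), by rw [det_signedPerm, h]⟩

/-- The sign by which the reflection in the coordinate `a` acts on the multi-index `w`. -/
def reflSign {n : ℕ} (a : Fin 2 × Fin n) (w : Fin n → Fin 2 × Fin n) : ℂ :=
  ∏ i, if w i = a then -1 else 1

theorem reflSign_eq {n : ℕ} (a : Fin 2 × Fin n) {w : Fin n → Fin 2 × Fin n}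
    (hw : Function.Injective w) [Decidable (a ∈ Set.range w)] :
    reflSign a w = if a ∈ Set.range w then -1 else 1 := by
  rw [reflSign]
  split_ifs with h
  · obtain ⟨i, rfl⟩ := h
    rw [Finset.prod_eq_single i]
    · simp
    · intro j _ hj
      simp [hw.ne hj]
    · simp
  · refine Finset.prod_eq_one fun i _ => if_neg fun hi => h ⟨i, hi⟩

theorem exists_mem_rotation_reflSign {n : ℕ} {W : Submodule ℂ (MidForm n)}
    (hW : RotationInvariant W) (a b : Fin 2 × Fin n) {α : MidForm n} (hα : α ∈ W) :
    ∃ β ∈ W, ∀ w, coord β w = reflSign a w * reflSign b w * coord α w := by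
  let d : Fin 2 × Fin n → ℝ := fun k => (if k = a then -1 else 1) * (if k = b then -1 else 1)
  have hd : ∀ k, d k * d k = 1 := fun k => by
    simp only [d]
    split_ifs <;> norm_num
  refine ⟨_, hW _ (signedPerm_mem (σ := 1) hd ?_) α hα, fun w => ?_⟩
  · simp only [d, Finset.prod_mul_distrib]
    simp
  · rw [coord_pull_signedPerm, reflSign, reflSign, ← Finset.prod_mul_distrib]
    congr 1
    refine Finset.prod_congr rfl fun i _ => ?_
    simp only [d]
    split_ifs <;> simp

/-- In a nonzero invariant subspace there is a form whose coordinates live on one multi-index and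
its complement: diagonal sign changes of determinant `1` separate any other pair of multi-indices,
so a form of minimal support is of this kind. -/
theorem exists_mem_support_pair {n : ℕ} {W : Submodule ℂ (MidForm n)} (hW : RotationInvariant W)
    (hne : W ≠ ⊥) : ∃ α ∈ W, ∃ w, coord α w ≠ 0 ∧
      ∀ u, coord α u ≠ 0 → Set.range u = Set.range w ∨ Set.range u = (Set.range w)ᶜ := by
  classical
  obtain ⟨α₀, hα₀, hα₀ne⟩ := Submodule.exists_mem_ne_zero_of_ne_bot hne
  have hex : ∃ m, ∃ α ∈ W, α ≠ 0 ∧ (coordSupport α).card = m := ⟨_, α₀, hα₀, hα₀ne, rfl⟩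
  obtain ⟨α, hα, hα0, hcard⟩ := Nat.find_spec hex
  have hmin : ∀ β ∈ W, β ≠ 0 → (coordSupport α).card ≤ (coordSupport β).card := fun β hβ hβ0 => by
    rw [hcard]
    exact Nat.find_min' hex ⟨β, hβ, hβ0, rfl⟩
  obtain ⟨w, hw⟩ : ∃ w, coord α w ≠ 0 := by
    by_contra! h
    exact hα0 (eq_zero_of_coord h)
  refine ⟨α, hα, w, hw, fun u hu => ?_⟩
  by_contra! hnot
  have hwi := injective_of_coord_ne_zero hw
  have hui := injective_of_coord_ne_zero hu
  obtain ⟨a, ha⟩ : ∃ a, ¬(a ∈ Set.range u ↔ a ∈ Set.range w) := by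
    by_contra! h
    exact hnot.1 (Set.ext h)
  obtain ⟨b, hb⟩ : ∃ b, (b ∈ Set.range u ↔ b ∈ Set.range w) := by
    by_contra! h
    refine hnot.2 (Set.ext fun b => ?_)
    have := h b
    rw [Set.mem_compl_iff]
    tauto
  have hsign : reflSign a u * reflSign b u = -(reflSign a w * reflSign b w) := by
    simp only [reflSign_eq _ hwi, reflSign_eq _ hui]
    by_cases h1 : a ∈ Set.range u <;> by_cases h2 : a ∈ Set.range w <;>
      by_cases h3 : b ∈ Set.range u <;> by_cases h4 : b ∈ Set.range w <;>
      simp only [h1, h2, h3, h4, if_true, if_false] <;> first | tauto | norm_num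
  have hw0 : reflSign a w * reflSign b w ≠ 0 := by
    simp only [reflSign_eq _ hwi]
    split_ifs <;> norm_num
  obtain ⟨β, hβ, hβc⟩ := exists_mem_rotation_reflSign hW a b hα
  -- this combination kills the coordinate `u` and doubles the coordinate `w` up to sign
  let γ := β + (reflSign a w * reflSign b w) • α
  have hγc : ∀ x, coord γ x =
      (reflSign a x * reflSign b x + reflSign a w * reflSign b w) * coord α x := fun x => by
    rw [add_mul, ← hβc]
    rfl
  have hγ0 : γ ≠ 0 := fun h => by
    have h1 := hγc w
    rw [h] at h1
    have h2 : coord (0 : MidForm n) w = 0 := rfl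
    rw [h2, ← two_mul] at h1
    exact mul_ne_zero (mul_ne_zero two_ne_zero hw0) hw h1.symm
  have hsub : coordSupport γ ⊂ coordSupport α := by
    refine Finset.ssubset_iff_of_subset (fun x hx => ?_) |>.2 ⟨u, mem_coordSupport.2 hu, ?_⟩
    · rw [mem_coordSupport] at hx ⊢
      intro h0
      rw [hγc, h0, mul_zero] at hx
      exact hx rfl
    · rw [mem_coordSupport, hγc, hsign, neg_add_cancel, zero_mul]
      simp
  exact absurd (hmin γ (W.add_mem hβ (W.smul_mem _ hα)) hγ0) (not_le.2 (Finset.card_lt_card hsub))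

/-- Signed permutations of determinant `1` act transitively on multi-indices without repetition. -/
theorem exists_mem_support_pair_at {n : ℕ} {W : Submodule ℂ (MidForm n)} (hW : RotationInvariant W)
    (hne : W ≠ ⊥) {w : Fin n → Fin 2 × Fin n} (hw : Function.Injective w) :
    ∃ α ∈ W, coord α w = 1 ∧
      ∀ u, coord α u ≠ 0 → Set.range u = Set.range w ∨ Set.range u = (Set.range w)ᶜ := by
  classical
  obtain ⟨α, hα, x, hx, hsupp⟩ := exists_mem_support_pair hW hne
  have hxi := injective_of_coord_ne_zero hx
  obtain ⟨y, hy⟩ := exists_complementary hxi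
  obtain ⟨u, hu⟩ := exists_complementary hw
  let σ : Equiv.Perm (Fin 2 × Fin n) := (Equiv.ofBijective _ hu).symm.trans (Equiv.ofBijective _ hy)
  have hσ : ∀ p : Fin 2 × Fin n, σ (if p.1 = 1 then u p.2 else w p.2) =
      if p.1 = 1 then y p.2 else x p.2 := fun p => by
    have : (Equiv.ofBijective _ hu).symm (if p.1 = 1 then u p.2 else w p.2) = p :=
      (Equiv.ofBijective _ hu).symm_apply_apply p
    change (Equiv.ofBijective _ hy) ((Equiv.ofBijective _ hu).symm _) = _
    rw [this]
    rfl
  have hσw : σ ∘ w = x := funext fun i => by simpa using hσ (0, i)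
  rcases Nat.eq_zero_or_pos n with rfl | hn
  · refine ⟨(coord α x)⁻¹ • α, W.smul_mem _ hα, ?_, fun u _ => Or.inl ?_⟩
    · rw [Subsingleton.elim w x]
      exact inv_mul_cancel₀ hx
    · rw [Subsingleton.elim u w]
  let k₀ : Fin 2 × Fin n := (0, ⟨0, hn⟩)
  let d : Fin 2 × Fin n → ℝ := fun k => if k = k₀ then ((Equiv.Perm.sign σ : ℤ) : ℝ) else 1
  have hs : ((Equiv.Perm.sign σ : ℤ) : ℝ) * ((Equiv.Perm.sign σ : ℤ) : ℝ) = 1 := by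
    rcases Int.units_eq_one_or (Equiv.Perm.sign σ) with h | h <;> rw [h] <;> simp
  have hd : ∀ k, d k * d k = 1 := fun k => by
    simp only [d]
    split_ifs
    · exact hs
    · norm_num
  have hmem := hW _ (signedPerm_mem (σ := σ) hd (by simp [d, hs])) α hα
  set β := pull (cmat (signedPerm σ d)) α with hβ
  have hβc : ∀ v, coord β v ≠ 0 → coord α (σ ∘ v) ≠ 0 := fun v hv h0 => hv (by
    rw [hβ, coord_pull_signedPerm, h0, mul_zero])
  have hβw : coord β w ≠ 0 := by
    rw [hβ, coord_pull_signedPerm, hσw]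
    refine mul_ne_zero (Finset.prod_ne_zero_iff.2 fun i _ h => ?_) hx
    have h' : d (w i) = 0 := by exact_mod_cast h
    have := hd (w i)
    rw [h'] at this
    norm_num at this
  refine ⟨(coord β w)⁻¹ • β, W.smul_mem _ hmem, inv_mul_cancel₀ hβw, fun v hv => ?_⟩
  have hv' : coord β v ≠ 0 := fun h0 => hv (by
    change (coord β w)⁻¹ * coord β v = 0
    rw [h0, mul_zero])
  have := hsupp _ (hβc v hv')
  rw [← hσw, Set.range_comp, Set.range_comp, ← Set.image_compl_eq σ.bijective] at this
  exact this.imp (fun h => σ.injective.image_injective h) (fun h => σ.injective.image_injective h)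

/-- The eigenspace of the star operator for the eigenvalue `c`. -/
def starSpace (n : ℕ) (c : ℂ) : Submodule ℂ (MidForm n) := Module.End.eigenspace star c

theorem mem_starSpace {n : ℕ} {c : ℂ} {α : MidForm n} : α ∈ starSpace n c ↔ star α = c • α :=
  Module.End.mem_eigenspace_iff

/-- An eigenspace of the star operator contains no proper nonzero invariant subspace. -/
theorem starSpace_le_of_rotationInvariant {n : ℕ} {c : ℂ} {W : Submodule ℂ (MidForm n)}
    (hW : RotationInvariant W) (hne : W ≠ ⊥) (hle : W ≤ starSpace n c) : starSpace n c ≤ W := by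
  suffices h : ∀ m, ∀ β ∈ starSpace n c, (coordSupport β).card = m → β ∈ W from
    fun β hβ => h _ β hβ rfl
  intro m
  induction m using Nat.strong_induction_on with
  | _ m ih =>
    intro β hβ hm
    by_cases h0 : ∀ w, coord β w = 0
    · rw [eq_zero_of_coord h0]
      exact W.zero_mem
    push Not at h0
    obtain ⟨w, hw⟩ := h0
    have hwi := injective_of_coord_ne_zero hw
    obtain ⟨α, hα, hαw, hsupp⟩ := exists_mem_support_pair_at hW hne hwi
    have hβsupp : ∀ u, coord α u ≠ 0 → coord β u ≠ 0 := fun u hu => by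
      have hui := injective_of_coord_ne_zero hu
      rcases hsupp u hu with h | h
      · obtain ⟨σ, rfl⟩ := exists_perm_of_range_eq hui h.symm
        exact (coord_comp_perm_ne_zero σ).2 hw
      · -- the star operator couples the coordinates of complementary multi-indices
        have hc := (complementary_iff_range hwi hui).2 h
        have h1 := star_apply_stdVec β hc
        rw [mem_starSpace.1 hβ] at h1
        have h2 : c * coord β u = n.factorial * (coord β w *
          halfDet 1 (fun i => stdVec (w i)) (fun i => stdVec (u i))) := h1
        intro h3
        rw [h3, mul_zero] at h2
        have h4 := halfDet_stdVec_sq hc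
        have hf : (n.factorial : ℂ) ≠ 0 := by exact_mod_cast n.factorial_ne_zero
        refine mul_ne_zero hf (mul_ne_zero hw fun h5 => ?_) h2.symm
        rw [h5] at h4
        simp at h4
    let γ := β - coord β w • α
    have hγc : ∀ u, coord γ u = coord β u - coord β w * coord α u := fun u => rfl
    have hγ : γ ∈ W := by
      refine ih _ ?_ γ ((starSpace n c).sub_mem hβ ((starSpace n c).smul_mem _ (hle hα))) rfl
      rw [← hm]
      refine Finset.card_lt_card ?_
      refine Finset.ssubset_iff_of_subset (fun x hx => ?_) |>.2 ⟨w, mem_coordSupport.2 hw, ?_⟩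
      · rw [mem_coordSupport] at hx ⊢
        intro h
        rw [hγc, h, zero_sub, neg_ne_zero] at hx
        exact hβsupp x (right_ne_zero_of_mul hx) h
      · rw [mem_coordSupport, hγc, hαw]
        simp
    have : β = γ + coord β w • α := (sub_add_cancel _ _).symm
    rw [this]
    exact W.add_mem hγ (W.smul_mem _ hα)

/-! ### Weights of middle-degree forms -/

theorem torus_apply {n : ℕ} (θ : Fin n → ℝ) (p q : Fin 2 × Fin n) :
    (torus θ).1 p q = if p.2 = q.2 then rot (θ p.2) p.1 q.1 else 0 := by
  obtain ⟨a, j⟩ := p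
  obtain ⟨b, k⟩ := q
  exact Matrix.blockDiagonal_apply (fun j => rot (θ j)) (a, j) (b, k)

theorem rot_mul (s t : ℝ) : rot s * rot t = rot (s + t) := by
  ext i j
  fin_cases i <;> fin_cases j <;>
    simp [rot, Matrix.mul_apply, Fin.sum_univ_two, Real.cos_add, Real.sin_add] <;> ring

theorem torus_mul {n : ℕ} (θ φ : Fin n → ℝ) : torus θ * torus φ = torus (θ + φ) := by
  apply Subtype.ext
  change Matrix.blockDiagonal (fun j => rot (θ j)) * Matrix.blockDiagonal (fun j => rot (φ j)) = _
  rw [← Matrix.blockDiagonal_mul]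
  simp only [rot_mul]
  rfl

theorem torus_zero {n : ℕ} : torus (0 : Fin n → ℝ) = 1 := by
  apply Subtype.ext
  change Matrix.blockDiagonal (fun _ : Fin n => rot 0) = 1
  rw [← Matrix.blockDiagonal_one]
  congr 1
  funext j
  ext a b
  fin_cases a <;> fin_cases b <;> simp [rot]

theorem torus_inv {n : ℕ} (θ : Fin n → ℝ) : (torus θ)⁻¹ = torus (-θ) := by
  rw [inv_eq_iff_mul_eq_one, torus_mul, add_neg_cancel, torus_zero]

/-- The representation of `SO(2n)` on middle-degree forms. -/
def midRep (n : ℕ) : Representation ℂ (SO n) (MidForm n) where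
  toFun g := pull (cmat (g⁻¹).1)
  map_one' := by
    rw [inv_one]
    change pull (cmat 1) = 1
    rw [map_one, pull_one]
  map_mul' g h := by
    rw [mul_inv_rev]
    change pull (cmat (h⁻¹.1 * g⁻¹.1)) = _
    rw [map_mul, pull_mul]

theorem midRep_apply {n : ℕ} (g : SO n) (α : MidForm n) : midRep n g α = pull (cmat (g⁻¹).1) α :=
  rfl

theorem cmat_mul_transpose {n : ℕ} {A : Matrix (Fin 2 × Fin n) (Fin 2 × Fin n) ℝ}
    (hA : A * A.transpose = 1) : cmat A * (cmat A).transpose = 1 := by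
  rw [cmat_transpose, ← map_mul, hA, map_one]

theorem SO_mul_transpose {n : ℕ} (g : SO n) : g.1 * g.1.transpose = 1 :=
  (Matrix.mem_orthogonalGroup_iff _ _).1 (Matrix.mem_specialOrthogonalGroup_iff.1 g.2).1

theorem SO_inv_val {n : ℕ} (g : SO n) : (g⁻¹).1 = g.1.transpose := rfl

theorem star_midRep {n : ℕ} (g : SO n) (α : MidForm n) :
    star (midRep n g α) = midRep n g (star α) := by
  rw [midRep_apply, star_pull (cmat_mul_transpose (SO_mul_transpose g⁻¹)), cmat_det,
    (Matrix.mem_specialOrthogonalGroup_iff.1 (g⁻¹).2).2, Complex.ofReal_one, one_smul,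
    midRep_apply]

/-- The basis of isotropic weight vectors `e_{0,j} ± i e_{1,j}` of `ℂ^{2n}`, the sign being `+`
for the label `(0, j)` and `-` for the label `(1, j)`. -/
def isoBasis (n : ℕ) : Module.Basis (Fin 2 × Fin n) ℂ (Fin 2 × Fin n → ℂ) :=
  .ofEquivFun
    { toFun := fun v k =>
        (v (0, k.2) + (if k.1 = 0 then -Complex.I else Complex.I) * v (1, k.2)) / 2
      invFun := fun c k => if k.1 = 0 then c (0, k.2) + c (1, k.2)
        else Complex.I * (c (0, k.2) - c (1, k.2))
      map_add' := fun v w => by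
        funext k
        simp only [Pi.add_apply]
        ring
      map_smul' := fun c v => by
        funext k
        simp only [Pi.smul_apply, smul_eq_mul, RingHom.id_apply]
        ring
      left_inv := fun v => by
        funext ⟨a, j⟩
        fin_cases a
        · simp only [Fin.zero_eta, if_true, one_ne_zero, if_false]
          ring
        · simp only [Fin.mk_one, one_ne_zero, if_false, if_true]
          linear_combination (-v (1, j)) * Complex.I_mul_I
      right_inv := fun c => by
        funext ⟨a, j⟩
        fin_cases a
        · simp only [Fin.zero_eta, if_true, one_ne_zero, if_false]
          linear_combination (-(c (0, j) - c (1, j)) / 2) * Complex.I_mul_I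
        · simp only [Fin.mk_one, one_ne_zero, if_false, if_true]
          linear_combination ((c (0, j) - c (1, j)) / 2) * Complex.I_mul_I }

theorem isoBasis_repr {n : ℕ} (v : Fin 2 × Fin n → ℂ) (k) : (isoBasis n).repr v k =
    (v (0, k.2) + (if k.1 = 0 then -Complex.I else Complex.I) * v (1, k.2)) / 2 := rfl

theorem isoBasis_apply {n : ℕ} (k l : Fin 2 × Fin n) : isoBasis n k l =
    if k.2 = l.2 then (if l.1 = 0 then 1 else if k.1 = 0 then Complex.I else -Complex.I)
      else 0 := by
  have h : isoBasis n k = fun l : Fin 2 × Fin n =>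
      if l.1 = 0 then (Pi.single k 1 : Fin 2 × Fin n → ℂ) (0, l.2) +
        (Pi.single k 1 : Fin 2 × Fin n → ℂ) (1, l.2)
        else Complex.I * ((Pi.single k 1 : Fin 2 × Fin n → ℂ) (0, l.2) -
          (Pi.single k 1 : Fin 2 × Fin n → ℂ) (1, l.2)) := by
    rw [isoBasis, Module.Basis.coe_ofEquivFun]
    rfl
  rw [h]
  obtain ⟨a, j⟩ := k
  obtain ⟨b, i⟩ := l
  by_cases hij : j = i
  · subst hij
    fin_cases a <;> fin_cases b <;> simp
  · have hij' : ¬ i = j := fun h => hij h.symm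
    fin_cases a <;> fin_cases b <;> simp [hij, hij']

/-- The coefficient in `±ε_j` of the weight of a basis vector. -/
def labelSign (a : Fin 2) : ℤ := if a = 0 then 1 else -1

theorem torus_mulVec_isoBasis {n : ℕ} (θ : Fin n → ℝ) (k : Fin 2 × Fin n) :
    (cmat (torus (-θ)).1).mulVec (isoBasis n k) =
      Complex.exp (-Complex.I * ((labelSign k.1 : ℂ) * (θ k.2 : ℂ))) • isoBasis n k := by
  funext ⟨b, i⟩
  obtain ⟨a, j⟩ := k
  have h1 : (cmat (torus (-θ)).1).mulVec (isoBasis n (a, j)) (b, i) =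
      ∑ c : Fin 2, (rot (-θ i) b c : ℂ) * isoBasis n (a, j) (c, i) := by
    simp only [Matrix.mulVec, dotProduct, cmat_apply, torus_apply]
    rw [Fintype.sum_prod_type]
    refine Finset.sum_congr rfl fun c _ => ?_
    rw [Finset.sum_eq_single i]
    · simp
    · intro x _ hx
      simp [hx.symm]
    · simp
  rw [h1, Fin.sum_univ_two, Pi.smul_apply, smul_eq_mul]
  simp only [isoBasis_apply]
  by_cases hij : j = i
  · subst hij
    have e1 : Complex.exp (-Complex.I * (θ j : ℂ)) =
        Complex.cos (θ j) - Complex.sin (θ j) * Complex.I := by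
      rw [show -Complex.I * (θ j : ℂ) = (-(θ j : ℂ)) * Complex.I by ring, Complex.exp_mul_I,
        Complex.cos_neg, Complex.sin_neg]
      ring
    have e2 : Complex.exp (-Complex.I * (-1 * (θ j : ℂ))) =
        Complex.cos (θ j) + Complex.sin (θ j) * Complex.I := by
      rw [show -Complex.I * (-1 * (θ j : ℂ)) = ((θ j : ℂ)) * Complex.I by ring, Complex.exp_mul_I]
    fin_cases a <;> fin_cases b <;> simp [rot, labelSign] at e1 e2 ⊢ <;>
      simp only [e1, e2] <;> ring_nf <;> simp [Complex.I_sq]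
  · simp [hij]

/-- The weight of the tensor product of the isotropic basis vectors with labels `w`. -/
def indexWeight {n : ℕ} (w : Fin n → Fin 2 × Fin n) (j : Fin n) : ℤ :=
  ∑ i, if (w i).2 = j then labelSign (w i).1 else 0

theorem indexWeight_comp_perm {n : ℕ} (w : Fin n → Fin 2 × Fin n) (σ : Equiv.Perm (Fin n)) :
    indexWeight (w ∘ σ) = indexWeight w := by
  funext j
  exact Equiv.sum_comp σ fun i => if (w i).2 = j then labelSign (w i).1 else 0

/-- The coordinate of a form at a multi-index of isotropic basis vectors. -/
def isoCoord {n : ℕ} (α : MidForm n) (w : Fin n → Fin 2 × Fin n) : ℂ :=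
  α fun i => isoBasis n (w i)

theorem isoCoord_smul {n : ℕ} (c : ℂ) (α : MidForm n) (w) : isoCoord (c • α) w = c * isoCoord α w :=
  rfl

theorem midForm_ext_iso {n : ℕ} {α β : MidForm n}
    (h : ∀ w : Fin n → Fin 2 × Fin n, Function.Injective w → isoCoord α w = isoCoord β w) :
    α = β :=
  Module.Basis.ext_alternating (isoBasis n) h

theorem isoCoord_comp_perm {n : ℕ} (α : MidForm n) (w : Fin n → Fin 2 × Fin n)
    (σ : Equiv.Perm (Fin n)) :
    isoCoord α (w ∘ σ) = ((Equiv.Perm.sign σ : ℤ) : ℂ) * isoCoord α w := by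
  have := α.map_perm (fun i => isoBasis n (w i)) σ
  rw [Units.smul_def, zsmul_eq_mul] at this
  exact this

theorem injective_of_isoCoord_ne_zero {n : ℕ} {α : MidForm n} {w : Fin n → Fin 2 × Fin n}
    (h : isoCoord α w ≠ 0) : Function.Injective w := fun i j hij => by
  by_contra hne
  exact h (α.map_eq_zero_of_eq _ (by rw [hij]) hne)

theorem isoCoord_midRep_torus {n : ℕ} (θ : Fin n → ℝ) (α : MidForm n) (w) :
    isoCoord (midRep n (torus θ) α) w =
      Complex.exp (-Complex.I * ∑ j, (indexWeight w j : ℂ) * (θ j : ℂ)) * isoCoord α w := by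
  rw [midRep_apply, torus_inv, isoCoord, pull_apply]
  simp only [torus_mulVec_isoBasis]
  have h := α.map_smul_univ
    (fun i => Complex.exp (-Complex.I * ((labelSign (w i).1 : ℂ) * (θ (w i).2 : ℂ))))
    (fun i => isoBasis n (w i))
  refine h.trans ?_
  rw [← Complex.exp_sum, ← Finset.mul_sum, smul_eq_mul]
  congr 3
  simp only [indexWeight, Int.cast_sum, Finset.sum_mul]
  rw [Finset.sum_comm]
  refine Finset.sum_congr rfl fun i _ => ?_
  rw [Finset.sum_eq_single (w i).2]
  · simp
  · intro j _ hj
    simp [hj.symm]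
  · simp

theorem mem_weightSpace {n : ℕ} {V : Type} [AddCommGroup V] [Module ℂ V]
    {π : Representation ℂ (SO n) V} {a : Fin n → ℤ} {v : V} : v ∈ weightSpace π a ↔
      ∀ θ, π (torus θ) v = Complex.exp (-Complex.I * ∑ j, (a j : ℂ) * (θ j : ℂ)) • v := by
  simp [weightSpace]

/-- Distinct integral weights are distinct characters of the torus. -/
theorem eq_of_exp_eq {n : ℕ} {a b : Fin n → ℤ}
    (h : ∀ θ : Fin n → ℝ, Complex.exp (-Complex.I * ∑ j, (a j : ℂ) * (θ j : ℂ)) =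
      Complex.exp (-Complex.I * ∑ j, (b j : ℂ) * (θ j : ℂ))) : a = b := by
  funext j
  by_contra hne
  have hd : ((a j - b j : ℤ) : ℝ) ≠ 0 := by exact_mod_cast sub_ne_zero.2 hne
  have h1 := h (Pi.single j (Real.pi / (a j - b j : ℤ)))
  have hs : ∀ c : Fin n → ℤ, ∑ k, (c k : ℂ) *
      ((Pi.single j (Real.pi / (a j - b j : ℤ)) : Fin n → ℝ) k : ℂ) =
      (c j : ℂ) * ((Real.pi / (a j - b j : ℤ) : ℝ) : ℂ) := fun c => by
    rw [Finset.sum_eq_single j]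
    · simp
    · intro k _ hk
      simp [hk]
    · simp
  rw [hs, hs] at h1
  have h2 : Complex.exp (-Complex.I * ((a j : ℂ) * ((Real.pi / (a j - b j : ℤ) : ℝ) : ℂ)) -
      -Complex.I * ((b j : ℂ) * ((Real.pi / (a j - b j : ℤ) : ℝ) : ℂ))) = 1 := by
    rw [Complex.exp_sub, h1, div_self (Complex.exp_ne_zero _)]
  have hd' : ((a j : ℂ) - b j) ≠ 0 := by exact_mod_cast sub_ne_zero.2 hne
  have h3 : -Complex.I * ((a j : ℂ) * ((Real.pi / (a j - b j : ℤ) : ℝ) : ℂ)) -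
      -Complex.I * ((b j : ℂ) * ((Real.pi / (a j - b j : ℤ) : ℝ) : ℂ)) =
      -(Real.pi * Complex.I) := by
    push_cast
    field_simp
    ring
  rw [h3, Complex.exp_neg, Complex.exp_pi_mul_I] at h2
  norm_num at h2

theorem indexWeight_eq_of_mem_weightSpace {n : ℕ} {α : MidForm n} {η : Fin n → ℤ}
    (h : α ∈ weightSpace (midRep n) η) {w : Fin n → Fin 2 × Fin n} (hw : isoCoord α w ≠ 0) :
    indexWeight w = η := by
  refine eq_of_exp_eq fun θ => ?_
  have h1 := congrArg (fun β => isoCoord β w) (mem_weightSpace.1 h θ)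
  simp only [isoCoord_midRep_torus, isoCoord_smul] at h1
  exact mul_right_cancel₀ hw h1

theorem star_mem_weightSpace {n : ℕ} {α : MidForm n} {η : Fin n → ℤ}
    (h : α ∈ weightSpace (midRep n) η) : star α ∈ weightSpace (midRep n) η :=
  mem_weightSpace.2 fun θ => by
    rw [← star_midRep, mem_weightSpace.1 h θ, map_smul]

/-- The exterior product of the coordinate functionals with labels `w` of the isotropic basis. -/
def isoForm {n : ℕ} (w : Fin n → Fin 2 × Fin n) : MidForm n :=
  (Matrix.detRowAlternating (n := Fin n) (R := ℂ)).compLinearMap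
    (LinearMap.pi fun i => (isoBasis n).coord (w i))

theorem isoForm_apply {n : ℕ} (w : Fin n → Fin 2 × Fin n) (v) : isoForm w v =
    Matrix.det (Matrix.of fun k i => (isoBasis n).repr (v k) (w i)) := rfl

theorem isoCoord_isoForm {n : ℕ} (w u : Fin n → Fin 2 × Fin n) : isoCoord (isoForm w) u =
    Matrix.det (Matrix.of fun k i => if u k = w i then (1 : ℂ) else 0) := by
  rw [isoCoord, isoForm_apply]
  congr 1
  ext k i
  simp [Finsupp.single_apply]

theorem isoCoord_isoForm_self {n : ℕ} {w : Fin n → Fin 2 × Fin n} (hw : Function.Injective w) :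
    isoCoord (isoForm w) w = 1 := by
  rw [isoCoord_isoForm, ← Matrix.det_one (n := Fin n) (R := ℂ)]
  congr 1
  ext k i
  simp [Matrix.one_apply, hw.eq_iff]

theorem isoForm_comp_perm {n : ℕ} (w : Fin n → Fin 2 × Fin n) (σ : Equiv.Perm (Fin n)) :
    isoForm (w ∘ σ) = ((Equiv.Perm.sign σ : ℤ) : ℂ) • isoForm w := by
  ext v
  rw [AlternatingMap.smul_apply, smul_eq_mul, isoForm_apply, isoForm_apply, ← Matrix.det_permute']
  rfl

theorem range_eq_of_isoCoord_isoForm_ne_zero {n : ℕ} {w u : Fin n → Fin 2 × Fin n}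
    (h : isoCoord (isoForm w) u ≠ 0) : ∃ σ : Equiv.Perm (Fin n), u = w ∘ σ := by
  have hu := injective_of_isoCoord_ne_zero h
  have h' : ∀ k, ∃ i, w i = u k := fun k => by
    by_contra! hk
    refine h ?_
    rw [isoCoord_isoForm]
    exact Matrix.det_eq_zero_of_row_eq_zero k fun i => if_neg (hk i).symm
  choose f hf using h'
  have hfi : Function.Injective f := fun i j hij => hu (by rw [← hf, ← hf, hij])
  exact ⟨Equiv.ofBijective f (Finite.injective_iff_bijective.1 hfi), funext fun i => (hf i).symm⟩

theorem isoForm_mem_weightSpace {n : ℕ} (w : Fin n → Fin 2 × Fin n) :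
    isoForm w ∈ weightSpace (midRep n) (indexWeight w) :=
  mem_weightSpace.2 fun θ => midForm_ext_iso fun u _ => by
    rw [isoCoord_midRep_torus, isoCoord_smul]
    by_cases h : isoCoord (isoForm w) u = 0
    · rw [h, mul_zero, mul_zero]
    · obtain ⟨σ, rfl⟩ := range_eq_of_isoCoord_isoForm_ne_zero h
      rw [indexWeight_comp_perm]

/-- The multi-index of the extreme weight `∑ ±ε_j`, with the minus signs at the `j ∈ A`. -/
def extremeIndex {n : ℕ} (A : Finset (Fin n)) (j : Fin n) : Fin 2 × Fin n :=
  (if j ∈ A then 1 else 0, j)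

theorem extremeIndex_injective {n : ℕ} (A : Finset (Fin n)) :
    Function.Injective (extremeIndex A) := fun _ _ h => congrArg Prod.snd h

theorem indexWeight_extremeIndex {n : ℕ} (A : Finset (Fin n)) (j : Fin n) :
    indexWeight (extremeIndex A) j = if j ∈ A then -1 else 1 := by
  rw [indexWeight, Finset.sum_eq_single j]
  · simp only [extremeIndex, if_true, labelSign]
    split_ifs <;> simp_all
  · intro i _ hi
    simp [extremeIndex, hi]
  · simp

/-- The extreme weights have multiplicity one. -/
theorem exists_perm_of_indexWeight_eq {n : ℕ} {A : Finset (Fin n)} {u : Fin n → Fin 2 × Fin n}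
    (h : ∀ j, indexWeight u j = if j ∈ A then -1 else 1) :
    ∃ σ : Equiv.Perm (Fin n), u = extremeIndex A ∘ σ := by
  have h' : ∀ j, ∃ i, u i = extremeIndex A j := fun j => by
    by_contra! hj
    have h1 := h j
    rw [indexWeight] at h1
    by_cases hA : j ∈ A
    · have : 0 ≤ ∑ i, if (u i).2 = j then labelSign (u i).1 else 0 :=
        Finset.sum_nonneg fun i _ => by
          split_ifs with hi
          · have : (u i).1 ≠ 1 := fun h1 => hj i (by
              rw [extremeIndex, if_pos hA, ← hi, ← h1])
            have h0 : (u i).1 = 0 := by omega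
            simp [labelSign, h0]
          · exact le_rfl
      rw [h1, if_pos hA] at this
      omega
    · have : ∑ i, (if (u i).2 = j then labelSign (u i).1 else 0) ≤ 0 :=
        Finset.sum_nonpos fun i _ => by
          split_ifs with hi
          · have h0 : (u i).1 ≠ 0 := fun h1 => hj i (by
              rw [extremeIndex, if_neg hA, ← hi, ← h1])
            simp [labelSign, h0]
          · exact le_rfl
      rw [h1, if_neg hA] at this
      omega
  choose f hf using h'
  have hfi : Function.Injective f := fun i j hij =>
    extremeIndex_injective A (by rw [← hf, ← hf, hij])
  refine ⟨(Equiv.ofBijective f (Finite.injective_iff_bijective.1 hfi)).symm, funext fun i => ?_⟩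
  rw [Function.comp_apply, ← hf]
  exact congrArg u ((Equiv.ofBijective f _).apply_symm_apply i).symm

theorem eq_smul_isoForm_of_mem_weightSpace {n : ℕ} {A : Finset (Fin n)} {α : MidForm n}
    (h : α ∈ weightSpace (midRep n) (indexWeight (extremeIndex A))) :
    α = isoCoord α (extremeIndex A) • isoForm (extremeIndex A) := by
  refine midForm_ext_iso fun u _ => ?_
  rw [isoCoord_smul]
  by_cases hu : indexWeight u = indexWeight (extremeIndex A)
  · obtain ⟨σ, rfl⟩ := exists_perm_of_indexWeight_eq (u := u) (A := A) fun j => by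
      rw [hu, indexWeight_extremeIndex]
    rw [isoCoord_comp_perm, isoCoord_comp_perm, isoCoord_isoForm_self (extremeIndex_injective A)]
    ring
  · have h1 : isoCoord α u = 0 := by
      by_contra h0
      exact hu (indexWeight_eq_of_mem_weightSpace h h0)
    have h2 : isoCoord (isoForm (extremeIndex A)) u = 0 := by
      by_contra h0
      exact hu (indexWeight_eq_of_mem_weightSpace (isoForm_mem_weightSpace _) h0)
    rw [h1, h2, mul_zero]

/-! ### Diagonal entries of the star operator -/

/-- The reflection in the coordinate `(1, j)`. -/
def refl {n : ℕ} (j : Fin n) : Matrix (Fin 2 × Fin n) (Fin 2 × Fin n) ℝ :=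
  Matrix.diagonal fun k => if k = (1, j) then -1 else 1

theorem refl_transpose {n : ℕ} (j : Fin n) : (refl j).transpose = refl j :=
  Matrix.diagonal_transpose _

theorem refl_mul_self {n : ℕ} (j : Fin n) : refl j * refl j = 1 := by
  rw [refl, Matrix.diagonal_mul_diagonal, ← Matrix.diagonal_one]
  congr 1
  funext k
  split_ifs <;> norm_num

theorem refl_mul_transpose {n : ℕ} (j : Fin n) : refl j * (refl j).transpose = 1 := by
  rw [refl_transpose, refl_mul_self]

theorem det_refl {n : ℕ} (j : Fin n) : (refl j).det = -1 := by
  rw [refl, Matrix.det_diagonal, Finset.prod_ite_eq' Finset.univ (1, j) fun _ => (-1 : ℝ)]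
  simp

theorem star_pull_refl {n : ℕ} (j : Fin n) (α : MidForm n) :
    star (pull (cmat (refl j)) α) = -pull (cmat (refl j)) (star α) := by
  rw [star_pull (cmat_mul_transpose (refl_mul_transpose j)), cmat_det, det_refl]
  simp

theorem cmat_refl_mulVec {n : ℕ} (j : Fin n) (v : Fin 2 × Fin n → ℂ) (k) :
    (cmat (refl j)).mulVec v k = if k = (1, j) then -v k else v k := by
  have : cmat (refl j) = Matrix.diagonal fun k => if k = (1, j) then -1 else 1 := by
    ext a b
    rw [cmat_apply, refl, Matrix.diagonal_apply, Matrix.diagonal_apply]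
    split_ifs <;> simp
  rw [this, Matrix.mulVec_diagonal]
  split_ifs <;> simp

theorem isoBasis_repr_refl {n : ℕ} (j : Fin n) (v : Fin 2 × Fin n → ℂ) (k) :
    (isoBasis n).repr ((cmat (refl j)).mulVec v) k =
      (isoBasis n).repr v (Equiv.swap (0, j) (1, j) k) := by
  obtain ⟨a, i⟩ := k
  rw [isoBasis_repr, isoBasis_repr, cmat_refl_mulVec, cmat_refl_mulVec]
  by_cases hij : i = j
  · subst hij
    fin_cases a <;> simp
  · rw [Equiv.swap_apply_of_ne_of_ne (by simp [hij]) (by simp [hij])]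
    simp [hij]

theorem pull_refl_isoForm {n : ℕ} (j : Fin n) (w : Fin n → Fin 2 × Fin n) :
    pull (cmat (refl j)) (isoForm w) = isoForm (Equiv.swap (0, j) (1, j) ∘ w) := by
  ext v
  rw [pull_apply, isoForm_apply, isoForm_apply]
  simp only [isoBasis_repr_refl]
  rfl

theorem refl_mulVec_isoBasis {n : ℕ} (j : Fin n) (k) :
    (cmat (refl j)).mulVec (isoBasis n k) = isoBasis n (Equiv.swap (0, j) (1, j) k) := by
  refine (isoBasis n).repr.injective (Finsupp.ext fun l => ?_)
  rw [isoBasis_repr_refl, Module.Basis.repr_self, Module.Basis.repr_self, Finsupp.single_apply,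
    Finsupp.single_apply]
  exact if_congr (by rw [← Equiv.apply_eq_iff_eq (Equiv.swap ((0 : Fin 2), j) (1, j)),
    Equiv.swap_apply_self]) rfl rfl

theorem isoCoord_pull_refl {n : ℕ} (j : Fin n) (α : MidForm n) (w) :
    isoCoord (pull (cmat (refl j)) α) w = isoCoord α (Equiv.swap (0, j) (1, j) ∘ w) := by
  rw [isoCoord, pull_apply]
  simp only [refl_mulVec_isoBasis]
  rfl

/-- The diagonal entry of the star operator at the multi-index `w` of the isotropic basis. -/
def starDiag {n : ℕ} (w : Fin n → Fin 2 × Fin n) : ℂ := isoCoord (star (isoForm w)) w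

theorem starDiag_comp_perm {n : ℕ} (w : Fin n → Fin 2 × Fin n) (σ : Equiv.Perm (Fin n)) :
    starDiag (w ∘ σ) = starDiag w := by
  rw [starDiag, isoForm_comp_perm, map_smul, isoCoord_smul, isoCoord_comp_perm, starDiag]
  rcases Int.units_eq_one_or (Equiv.Perm.sign σ) with h | h <;> rw [h] <;> simp

theorem starDiag_swap {n : ℕ} (j : Fin n) (w : Fin n → Fin 2 × Fin n) :
    starDiag (Equiv.swap (0, j) (1, j) ∘ w) = -starDiag w := by
  rw [starDiag, ← pull_refl_isoForm, star_pull_refl]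
  change -isoCoord (pull (cmat (refl j)) (star (isoForm w))) _ = _
  rw [isoCoord_pull_refl, ← Function.comp_assoc, starDiag]
  congr 2
  funext i
  simp

theorem starDiag_eq_zero {n : ℕ} {w : Fin n → Fin 2 × Fin n} (hw : Function.Injective w)
    {i i' j : Fin n} (hi : w i = (0, j)) (hi' : w i' = (1, j)) : starDiag w = 0 := by
  have h : Equiv.swap (0, j) (1, j) ∘ w = w ∘ Equiv.swap i i' := by
    rw [← hi, ← hi']
    funext k
    rw [Function.comp_apply, Function.comp_apply, hw.swap_apply]
  have h1 := starDiag_swap j w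
  rw [h, starDiag_comp_perm] at h1
  linear_combination h1 / 2

theorem starDiag_extremeIndex {n : ℕ} (A : Finset (Fin n)) :
    starDiag (extremeIndex A) = (-1) ^ A.card * starDiag (extremeIndex (∅ : Finset (Fin n))) := by
  induction A using Finset.induction_on with
  | empty => simp
  | insert j A hj ih =>
    have h : extremeIndex (insert j A) = Equiv.swap (0, j) (1, j) ∘ extremeIndex A := by
      funext i
      by_cases hij : i = j
      · subst hij
        simp [extremeIndex, hj]
      · rw [Function.comp_apply, Equiv.swap_apply_of_ne_of_ne]
        · simp [extremeIndex, hij]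
        · simp [extremeIndex, hij]
        · simp [extremeIndex, hij]
    rw [h, starDiag_swap, ih, Finset.card_insert_of_notMem hj, pow_succ]
    ring

/-- The eigenvalue of the star operator on the form of highest weight `∑ ε_j`. -/
def starEigenvalue (n : ℕ) : ℂ := starDiag (extremeIndex (∅ : Finset (Fin n)))

theorem star_isoForm_extremeIndex {n : ℕ} (A : Finset (Fin n)) :
    star (isoForm (extremeIndex A)) =
      ((-1) ^ A.card * starEigenvalue n) • isoForm (extremeIndex A) := by
  rw [eq_smul_isoForm_of_mem_weightSpace
    (star_mem_weightSpace (isoForm_mem_weightSpace (extremeIndex A)))]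
  congr 1
  exact starDiag_extremeIndex A

theorem isoForm_ne_zero {n : ℕ} {w : Fin n → Fin 2 × Fin n} (hw : Function.Injective w) :
    isoForm w ≠ 0 := fun h => by
  have h1 := isoCoord_isoForm_self hw
  rw [h] at h1
  have h2 : isoCoord (0 : MidForm n) w = 0 := rfl
  rw [h2] at h1
  exact zero_ne_one h1

theorem star_star {n : ℕ} (α : MidForm n) :
    star (star α) = (starEigenvalue n * starEigenvalue n) • α := by
  obtain ⟨κ, -, h⟩ := exists_star_star n
  have h1 := h (isoForm (extremeIndex ∅))
  rw [star_isoForm_extremeIndex, map_smul, star_isoForm_extremeIndex, smul_smul] at h1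
  have h2 := smul_left_injective ℂ (isoForm_ne_zero (extremeIndex_injective ∅)) h1
  simp only [Finset.card_empty, pow_zero, one_mul] at h2
  rw [h, h2]

theorem starEigenvalue_ne_zero (n : ℕ) : starEigenvalue n ≠ 0 := fun h0 => by
  obtain ⟨κ, hκ, h⟩ := exists_star_star n
  have h1 := h (isoForm (extremeIndex ∅))
  rw [star_star, h0, zero_mul, zero_smul] at h1
  exact smul_ne_zero hκ (isoForm_ne_zero (extremeIndex_injective ∅)) h1.symm

/-! ### Dimension of the fixed spaces -/

/-- The difference of the dimensions of the `±c`-eigenspaces of `S` in the fixed space of `G` is the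
trace of `S / c` composed with the projection onto this fixed space by averaging. -/
theorem finrank_sub_finrank_eq_trace {M : Type*} [AddCommGroup M] [Module ℂ M]
    [FiniteDimensional ℂ M] {S G : Module.End ℂ M} {c : ℂ} (hc : c ≠ 0)
    (hS : ∀ v, S (S v) = (c * c) • v) {q : ℕ} (hq : q ≠ 0) (hG : G ^ q = 1)
    (hSG : Commute S G) :
    (Module.finrank ℂ ↥(Module.End.eigenspace S c ⊓ Module.End.eigenspace G 1) : ℂ) -
      Module.finrank ℂ ↥(Module.End.eigenspace S (-c) ⊓ Module.End.eigenspace G 1) =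
      c⁻¹ * LinearMap.trace ℂ M (S * ((q : ℂ)⁻¹ • ∑ k ∈ Finset.range q, G ^ k)) := by
  set P : Module.End ℂ M := (q : ℂ)⁻¹ • ∑ k ∈ Finset.range q, G ^ k with hP
  have hGP : ∀ v, G (P v) = P v := fun v => by
    have h1 : (G - 1) * P = 0 := by
      rw [hP, mul_smul_comm, mul_geom_sum, hG, sub_self, smul_zero]
    have h2 := LinearMap.congr_fun h1 v
    exact sub_eq_zero.1 h2
  have hPfix : ∀ v, G v = v → P v = v := fun v hv => by
    have hk : ∀ k : ℕ, (G ^ k) v = v := fun k => by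
      induction k with
      | zero => rfl
      | succ k ih => rw [pow_succ, Module.End.mul_apply, hv, ih]
    rw [hP, LinearMap.smul_apply, LinearMap.sum_apply, Finset.sum_congr rfl fun k _ => hk k,
      Finset.sum_const, Finset.card_range, ← Nat.cast_smul_eq_nsmul ℂ, smul_smul,
      inv_mul_cancel₀ (by exact_mod_cast hq), one_smul]
  have hSP : ∀ v, S (P v) = P (S v) := fun v => by
    have : Commute S P := (Commute.sum_right _ _ _ fun k _ => hSG.pow_right k).smul_right _
    exact LinearMap.congr_fun this.eq v
  have key : ∀ e : ℂ, e * e = c * c → LinearMap.trace ℂ M ((2 : ℂ)⁻¹ • (P + e⁻¹ • (S * P))) =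
      Module.finrank ℂ ↥(Module.End.eigenspace S e ⊓ Module.End.eigenspace G 1) := fun e he => by
    have he0 : e ≠ 0 := by
      rintro rfl
      exact hc (mul_self_eq_zero.1 (by rw [← he, mul_zero]))
    refine LinearMap.IsProj.trace ⟨fun v => ?_, fun v hv => ?_⟩
    · refine Submodule.mem_inf.2 ⟨Module.End.mem_eigenspace_iff.2 ?_,
        Module.End.mem_eigenspace_iff.2 ?_⟩
      · simp only [LinearMap.smul_apply, LinearMap.add_apply, Module.End.mul_apply, map_smul,
          map_add, hS, smul_add, smul_smul, ← he]
        rw [add_comm]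
        congr 2
        · field_simp
        · field_simp
      · simp only [LinearMap.smul_apply, LinearMap.add_apply, Module.End.mul_apply, map_smul,
          map_add, hSP, hGP, one_smul]
    · obtain ⟨h1, h2⟩ := Submodule.mem_inf.1 hv
      rw [Module.End.mem_eigenspace_iff] at h1 h2
      rw [one_smul] at h2
      simp only [LinearMap.smul_apply, LinearMap.add_apply, Module.End.mul_apply, hPfix v h2, h1,
        smul_smul, inv_mul_cancel₀ he0, one_smul]
      rw [← two_smul ℂ v, smul_smul, inv_mul_cancel₀ two_ne_zero, one_smul]
  rw [← key c rfl, ← key (-c) (by ring), ← map_sub, ← smul_eq_mul (c⁻¹), ← LinearMap.map_smul]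
  congr 1
  rw [inv_neg, neg_smul, ← smul_sub, add_sub_add_left_eq_sub, sub_neg_eq_add, ← two_smul ℂ,
    smul_smul, inv_mul_cancel₀ two_ne_zero, one_smul]

/-- An enumeration of an `n`-element set of labels. -/
def enumOf {n : ℕ} (S : {S : Finset (Fin 2 × Fin n) // S.card = n}) (i : Fin n) : Fin 2 × Fin n :=
  ((S.1.equivFinOfCardEq S.2).symm i).1

theorem enumOf_injective {n : ℕ} (S : {S : Finset (Fin 2 × Fin n) // S.card = n}) :
    Function.Injective (enumOf S) := fun _ _ h =>
  (S.1.equivFinOfCardEq S.2).symm.injective (Subtype.ext h)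

theorem image_enumOf {n : ℕ} (S : {S : Finset (Fin 2 × Fin n) // S.card = n}) :
    Finset.univ.image (enumOf S) = S.1 := by
  refine Finset.eq_of_subset_of_card_le (fun k hk => ?_) ?_
  · obtain ⟨i, -, rfl⟩ := Finset.mem_image.1 hk
    exact ((S.1.equivFinOfCardEq S.2).symm i).2
  · rw [Finset.card_image_of_injective _ (enumOf_injective S), S.2, Finset.card_fin]

theorem exists_enumOf_comp_perm {n : ℕ} {w : Fin n → Fin 2 × Fin n} (hw : Function.Injective w) :
    ∃ S, ∃ σ : Equiv.Perm (Fin n), w = enumOf S ∘ σ := by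
  refine ⟨⟨Finset.univ.image w, by
    rw [Finset.card_image_of_injective _ hw, Finset.card_fin]⟩, ?_⟩
  refine exists_perm_of_range_eq hw ?_
  have := congrArg (fun s : Finset (Fin 2 × Fin n) => (s : Set (Fin 2 × Fin n)))
    (image_enumOf ⟨Finset.univ.image w, by
      rw [Finset.card_image_of_injective _ hw, Finset.card_fin]⟩)
  simpa using this

theorem isoCoord_isoForm_enumOf {n : ℕ} (S T : {S : Finset (Fin 2 × Fin n) // S.card = n}) :
    isoCoord (isoForm (enumOf S)) (enumOf T) = if S = T then 1 else 0 := by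
  split_ifs with h
  · rw [h, isoCoord_isoForm_self (enumOf_injective T)]
  · by_contra h0
    obtain ⟨σ, hσ⟩ := range_eq_of_isoCoord_isoForm_ne_zero h0
    refine h (Subtype.ext ?_)
    rw [← image_enumOf S, ← image_enumOf T, hσ, ← Finset.image_image,
      Finset.image_univ_of_surjective σ.surjective]

/-- The basis of middle-degree forms dual to the coordinates at multi-indices of the isotropic
basis. -/
def isoFormBasis (n : ℕ) :
    Module.Basis {S : Finset (Fin 2 × Fin n) // S.card = n} ℂ (MidForm n) :=
  .ofEquivFun
    { toFun := fun α S => isoCoord α (enumOf S)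
      invFun := fun c => ∑ S, c S • isoForm (enumOf S)
      map_add' := fun _ _ => rfl
      map_smul' := fun _ _ => rfl
      left_inv := fun α => by
        refine midForm_ext_iso fun w hw => ?_
        obtain ⟨T, σ, rfl⟩ := exists_enumOf_comp_perm hw
        rw [isoCoord_comp_perm, isoCoord_comp_perm]
        congr 1
        change evalAt _ (∑ S, isoCoord α (enumOf S) • isoForm (enumOf S)) = _
        rw [map_sum, Finset.sum_eq_single T]
        · change isoCoord α (enumOf T) * isoCoord (isoForm (enumOf T)) (enumOf T) = _
          rw [isoCoord_isoForm_enumOf, if_pos rfl, mul_one]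
        · intro S _ hS
          change isoCoord α (enumOf S) * isoCoord (isoForm (enumOf S)) (enumOf T) = _
          rw [isoCoord_isoForm_enumOf, if_neg hS, mul_zero]
        · simp
      right_inv := fun c => by
        funext T
        change evalAt _ (∑ S, c S • isoForm (enumOf S)) = _
        rw [map_sum, Finset.sum_eq_single T]
        · change c T * isoCoord (isoForm (enumOf T)) (enumOf T) = _
          rw [isoCoord_isoForm_enumOf, if_pos rfl, mul_one]
        · intro S _ hS
          change c S * isoCoord (isoForm (enumOf S)) (enumOf T) = _
          rw [isoCoord_isoForm_enumOf, if_neg hS, mul_zero]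
        · simp }

theorem isoFormBasis_repr {n : ℕ} (α : MidForm n) (S) :
    (isoFormBasis n).repr α S = isoCoord α (enumOf S) := rfl

theorem isoFormBasis_apply {n : ℕ} (S) : isoFormBasis n S = isoForm (enumOf S) := by
  refine (isoFormBasis n).repr.injective (Finsupp.ext fun T => ?_)
  rw [Module.Basis.repr_self, isoFormBasis_repr, isoCoord_isoForm_enumOf, Finsupp.single_apply]

instance (n : ℕ) : FiniteDimensional ℂ (MidForm n) := (isoFormBasis n).finiteDimensional_of_finite

theorem trace_midForm {n : ℕ} (A : Module.End ℂ (MidForm n)) : LinearMap.trace ℂ (MidForm n) A =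
    ∑ S : {S : Finset (Fin 2 × Fin n) // S.card = n},
      isoCoord (A (isoForm (enumOf S))) (enumOf S) := by
  classical
  rw [LinearMap.trace_eq_matrix_trace ℂ (isoFormBasis n), Matrix.trace]
  refine Finset.sum_congr rfl fun S _ => ?_
  rw [Matrix.diag_apply, LinearMap.toMatrix_apply, isoFormBasis_repr, isoFormBasis_apply]

/-- The generator of the lens group with parameters `s`. -/
def lensGen {n : ℕ} (q : ℕ) (s : Fin n → ℤ) : SO n :=
  torus fun j => 2 * Real.pi * (s j : ℝ) / (q : ℝ)

theorem torus_pow {n : ℕ} (θ : Fin n → ℝ) (k : ℕ) : torus θ ^ k = torus ((k : ℝ) • θ) := by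
  induction k with
  | zero => simp [torus_zero]
  | succ k ih =>
    rw [pow_succ, ih, torus_mul]
    congr 1
    push_cast
    rw [add_smul, one_smul]

theorem rot_two_pi_mul_int (m : ℤ) : rot (2 * Real.pi * m) = 1 := by
  have h1 : Real.cos (2 * Real.pi * m) = 1 := by
    rw [mul_comm]
    exact Real.cos_int_mul_two_pi m
  have h2 : Real.sin (2 * Real.pi * m) = 0 := by
    rw [show 2 * Real.pi * (m : ℝ) = ((2 * m : ℤ) : ℝ) * Real.pi by push_cast; ring]
    exact Real.sin_int_mul_pi _
  ext a b
  fin_cases a <;> fin_cases b <;> simp [rot, h1, h2]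

theorem lensGen_pow {n : ℕ} {q : ℕ} (hq : q ≠ 0) (s : Fin n → ℤ) : lensGen q s ^ q = 1 := by
  rw [lensGen, torus_pow]
  apply Subtype.ext
  change Matrix.blockDiagonal (fun j => rot ((q : ℝ) * (2 * Real.pi * (s j : ℝ) / (q : ℝ)))) = 1
  rw [← Matrix.blockDiagonal_one]
  congr 1
  funext j
  have hq' : (q : ℝ) ≠ 0 := by exact_mod_cast hq
  rw [mul_div_cancel₀ _ hq', rot_two_pi_mul_int]
  rfl

/-- The part of the `c`-eigenspace of the star operator fixed by `g`. -/
def fixedSpace {n : ℕ} (c : ℂ) (g : SO n) : Submodule ℂ (MidForm n) :=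
  starSpace n c ⊓ Module.End.eigenspace (midRep n g) 1

theorem lensGen_isoForm {n : ℕ} (q : ℕ) (s : Fin n → ℤ) (w : Fin n → Fin 2 × Fin n) :
    midRep n (lensGen q s) (isoForm w) =
      Complex.exp (2 * Real.pi * Complex.I * (-∑ j, indexWeight w j * s j : ℤ) / q) •
        isoForm w := by
  rw [lensGen, mem_weightSpace.1 (isoForm_mem_weightSpace w)]
  congr 2
  push_cast
  rw [mul_div_assoc, ← Finset.sum_neg_distrib, Finset.sum_div, Finset.mul_sum, Finset.mul_sum]
  exact Finset.sum_congr rfl fun j _ => by ring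

/-- Averages of powers of a root of unity. -/
theorem sum_pow_exp {q : ℕ} (hq : q ≠ 0) (m : ℤ) :
    (q : ℂ)⁻¹ * ∑ k ∈ Finset.range q, Complex.exp (2 * Real.pi * Complex.I * m / q) ^ k =
      if (q : ℤ) ∣ m then 1 else 0 := by
  have hq' : (q : ℂ) ≠ 0 := by exact_mod_cast hq
  split_ifs with h
  · obtain ⟨l, rfl⟩ := h
    have : Complex.exp (2 * Real.pi * Complex.I * ((q * l : ℤ) : ℂ) / q) = 1 := by
      rw [Complex.exp_eq_one_iff]
      refine ⟨l, ?_⟩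
      push_cast
      field_simp
    rw [this]
    simp [hq']
  · have h1 : Complex.exp (2 * Real.pi * Complex.I * m / q) ≠ 1 := fun h1 => by
      obtain ⟨l, hl⟩ := Complex.exp_eq_one_iff.1 h1
      refine h ⟨l, ?_⟩
      have hpi : (2 * Real.pi * Complex.I : ℂ) ≠ 0 := Complex.two_pi_I_ne_zero
      have h2 : (m : ℂ) = q * l := by
        field_simp at hl
        exact hl
      exact_mod_cast h2
    have h2 : Complex.exp (2 * Real.pi * Complex.I * m / q) ^ q = 1 := by
      rw [← Complex.exp_nat_mul, Complex.exp_eq_one_iff]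
      refine ⟨m, ?_⟩
      field_simp
    rw [geom_sum_eq h1, h2, sub_self, zero_div, mul_zero]

theorem onesLast_one (n : ℕ) : onesLast n 1 = fun _ => 1 := by
  funext j
  simp [onesLast]

theorem sum_indexWeight_extremeIndex {n : ℕ} (A : Finset (Fin n)) :
    ∑ j, indexWeight (extremeIndex A) j = (n : ℤ) - 2 * A.card := by
  have h : ∀ j, indexWeight (extremeIndex A) j = 1 - 2 * (if j ∈ A then 1 else 0) := fun j => by
    rw [indexWeight_extremeIndex]
    split_ifs <;> norm_num
  simp [h, Finset.sum_sub_distrib, mul_comm]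

/-- A multi-index on which the star operator has a nonzero diagonal entry is extreme. -/
theorem exists_extremeIndex_of_starDiag_ne_zero {n : ℕ} {w : Fin n → Fin 2 × Fin n}
    (hw : Function.Injective w) (h : starDiag w ≠ 0) :
    ∃ A : Finset (Fin n), ∃ σ : Equiv.Perm (Fin n), w = extremeIndex A ∘ σ := by
  have hinj : Function.Injective fun i => (w i).2 := fun i i' hii => by
    by_contra hne
    have h2 : (w i).2 = (w i').2 := hii
    have h1 : (w i).1 ≠ (w i').1 := fun h1 => hne (hw (Prod.ext h1 h2))
    have : ((w i).1 = 0 ∧ (w i').1 = 1) ∨ ((w i').1 = 0 ∧ (w i).1 = 1) := by omega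
    rcases this with ⟨ha, hb⟩ | ⟨ha, hb⟩
    · exact h (starDiag_eq_zero hw (j := (w i).2) (Prod.ext ha rfl) (Prod.ext hb h2.symm))
    · exact h (starDiag_eq_zero hw (j := (w i).2) (Prod.ext ha h2.symm) (Prod.ext hb rfl))
  let σ : Equiv.Perm (Fin n) := Equiv.ofBijective _ (Finite.injective_iff_bijective.1 hinj)
  refine ⟨Finset.univ.filter fun j => (w (σ.symm j)).1 = 1, σ, funext fun i => ?_⟩
  have h1 : (extremeIndex (Finset.univ.filter fun j => (w (σ.symm j)).1 = 1) ∘ σ) i =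
      (if (w i).1 = 1 then 1 else 0, (w i).2) := by
    simp only [Function.comp_apply, extremeIndex, Finset.mem_filter, Finset.mem_univ, true_and,
      Equiv.symm_apply_apply]
    rfl
  rw [h1]
  refine Prod.ext ?_ rfl
  change (w i).1 = if (w i).1 = 1 then 1 else 0
  split_ifs <;> omega

/-- The weight space decomposition of the fixed spaces: only the extreme weights contribute to the
difference, and those fixed by the generator have equally many plus and minus signs. -/
theorem finrank_fixedSpace_sub {n : ℕ} (heven : Even n) {q : ℕ} (hq : n < q) :
    (Module.finrank ℂ (fixedSpace (starEigenvalue n) (lensGen q (onesLast n 1))) : ℤ) -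
      Module.finrank ℂ (fixedSpace (-starEigenvalue n) (lensGen q (onesLast n 1))) =
      (-1) ^ (n / 2) * (n.choose (n / 2) : ℤ) := by
  classical
  have hq0 : q ≠ 0 := by omega
  set g := lensGen q (onesLast n 1) with hg
  have hG : (midRep n g) ^ q = 1 := by
    rw [← map_pow, hg, lensGen_pow hq0, map_one]
  have h := finrank_sub_finrank_eq_trace (S := (star : Module.End ℂ (MidForm n)))
    (starEigenvalue_ne_zero n) star_star hq0 hG (LinearMap.ext fun α => star_midRep g α)
  have hfix : ∀ w : Fin n → Fin 2 × Fin n,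
      ((q : ℂ)⁻¹ • ∑ k ∈ Finset.range q, midRep n g ^ k) (isoForm w) =
        (if (q : ℤ) ∣ ∑ j, indexWeight w j then (1 : ℂ) else 0) • isoForm w := fun w => by
    have hk : ∀ k : ℕ, (midRep n g ^ k) (isoForm w) =
        (Complex.exp (2 * Real.pi * Complex.I * (-∑ j, indexWeight w j * onesLast n 1 j : ℤ) / q)
          ^ k) • isoForm w := fun k => by
      induction k with
      | zero => simp
      | succ k ih =>
        rw [pow_succ, Module.End.mul_apply, hg, lensGen_isoForm, map_smul, ← hg, ih, smul_smul,
          pow_succ, mul_comm]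
    rw [LinearMap.smul_apply, LinearMap.sum_apply, Finset.sum_congr rfl fun k _ => hk k,
      ← Finset.sum_smul, smul_smul, sum_pow_exp hq0]
    simp only [onesLast_one, mul_one, dvd_neg]
  let F : Finset (Fin n) → ℂ := fun A => if A.card = n / 2 then (-1) ^ (n / 2) else 0
  have hF : ∀ A : Finset (Fin n),
      (if (q : ℤ) ∣ ∑ j, indexWeight (extremeIndex A) j then (1 : ℂ) else 0) *
      starDiag (extremeIndex A) = starEigenvalue n * F A := fun A => by
    have hd : ((q : ℤ) ∣ ∑ j, indexWeight (extremeIndex A) j) ↔ A.card = n / 2 := by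
      rw [sum_indexWeight_extremeIndex]
      have hA : A.card ≤ n := by simpa using A.card_le_univ
      obtain ⟨m, hm⟩ := heven
      constructor
      · intro hdvd
        have := Int.eq_zero_of_abs_lt_dvd hdvd (by rw [abs_lt]; constructor <;> omega)
        omega
      · intro hA
        have : (n : ℤ) - 2 * A.card = 0 := by omega
        rw [this]
        exact dvd_zero _
    rw [starDiag_extremeIndex]
    by_cases hA : A.card = n / 2
    · rw [if_pos (hd.2 hA)]
      simp only [F, if_pos hA, hA, starEigenvalue]
      ring
    · rw [if_neg (fun h => hA (hd.1 h))]
      simp [F, if_neg hA]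
  have hsum : (starEigenvalue n)⁻¹ * LinearMap.trace ℂ (MidForm n)
      (star * ((q : ℂ)⁻¹ • ∑ k ∈ Finset.range q, midRep n g ^ k)) =
      ∑ A : Finset (Fin n), F A := by
    rw [trace_midForm, inv_mul_eq_iff_eq_mul₀ (starEigenvalue_ne_zero n), Finset.mul_sum]
    simp only [Module.End.mul_apply, hfix, map_smul, isoCoord_smul]
    change ∑ S, _ * starDiag (enumOf S) = _
    have hcard : ∀ A : Finset (Fin n), (Finset.univ.image (extremeIndex A)).card = n := fun A => by
      rw [Finset.card_image_of_injective _ (extremeIndex_injective A), Finset.card_fin]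
    have hperm : ∀ A : Finset (Fin n), ∃ σ : Equiv.Perm (Fin n),
        extremeIndex A = enumOf ⟨_, hcard A⟩ ∘ σ := fun A => by
      refine exists_perm_of_range_eq (extremeIndex_injective A) ?_
      have := congrArg (fun s : Finset (Fin 2 × Fin n) => (s : Set (Fin 2 × Fin n)))
        (image_enumOf ⟨_, hcard A⟩)
      simpa using this
    symm
    refine Finset.sum_of_injOn (fun A => ⟨Finset.univ.image (extremeIndex A), hcard A⟩)
      ?_ (fun _ _ => Finset.mem_coe.2 (Finset.mem_univ _)) ?_ ?_
    · intro A _ B _ hAB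
      have h1 : Finset.univ.image (extremeIndex A) = Finset.univ.image (extremeIndex B) :=
        congrArg Subtype.val hAB
      have key : ∀ (A : Finset (Fin n)) (j : Fin n),
          (1, j) ∈ Finset.univ.image (extremeIndex A) ↔ j ∈ A := fun A j => by
        simp [extremeIndex]
      ext j
      rw [← key, h1, key]
    · intro S _ hS
      by_cases h0 : starDiag (enumOf S) = 0
      · rw [h0, mul_zero]
      · exfalso
        obtain ⟨A, σ, hσ⟩ := exists_extremeIndex_of_starDiag_ne_zero (enumOf_injective S) h0
        refine hS ⟨A, Finset.mem_coe.2 (Finset.mem_univ _), Subtype.ext ?_⟩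
        change Finset.univ.image (extremeIndex A) = S.1
        rw [← image_enumOf S, hσ, ← Finset.image_image,
          Finset.image_univ_of_surjective σ.surjective]
    · intro A _
      obtain ⟨σ, hσ⟩ := hperm A
      have h2 := hF A
      rw [hσ, starDiag_comp_perm, indexWeight_comp_perm] at h2
      exact h2.symm
  have hval : ∑ A : Finset (Fin n), F A = (-1) ^ (n / 2) * (n.choose (n / 2) : ℂ) := by
    simp only [F]
    rw [← Finset.sum_filter, Finset.sum_const, Finset.univ_filter_card_eq]
    simp [mul_comm]
  rw [hsum, hval] at h
  have h' : ((Module.finrank ℂ (fixedSpace (starEigenvalue n) g) : ℤ) : ℂ) -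
      ((Module.finrank ℂ (fixedSpace (-starEigenvalue n) g) : ℤ) : ℂ) =
      (-1) ^ (n / 2) * (n.choose (n / 2) : ℂ) := by
    rw [Int.cast_natCast, Int.cast_natCast]
    exact h
  exact_mod_cast h'

/-! ### Multiplicities in `L²(Γ\G)` -/

instance (n : ℕ) : SecondCountableTopology (SO n) :=
  inferInstanceAs (SecondCountableTopology
    {A : (Fin 2 × Fin n) → (Fin 2 × Fin n) → ℝ //
      Matrix.of A ∈ Matrix.specialOrthogonalGroup (Fin 2 × Fin n) ℝ})

section Mult

variable {n : ℕ} {V : Type} [AddCommGroup V] [Module ℂ V] {π : Representation ℂ (SO n) V}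

theorem memLp_matrixCoeff (hπ : ∀ (f : Module.Dual ℂ V) (v : V), Continuous fun g => f (π g v))
    (f : Module.Dual ℂ V) (v : V) : MemLp (fun g => f (π g v)) 2 (haarSO n) := by
  obtain ⟨C, hC⟩ := isCompact_univ.exists_bound_of_continuousOn (hπ f v).continuousOn
  exact MemLp.of_bound (hπ f v).aestronglyMeasurable C (.of_forall fun x => hC x (Set.mem_univ x))

/-- The map sending a vector `v` to the matrix coefficient `g ↦ f (π g v)`. -/
def matrixCoeff (hπ : ∀ (f : Module.Dual ℂ V) (v : V), Continuous fun g => f (π g v))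
    (f : Module.Dual ℂ V) : V →ₗ[ℂ] Lp ℂ 2 (haarSO n) where
  toFun v := (memLp_matrixCoeff hπ f v).toLp _
  map_add' v w := by
    rw [← MemLp.toLp_add]
    refine MemLp.toLp_congr _ _ (.of_forall fun x => ?_)
    simp
  map_smul' c v := by
    rw [RingHom.id_apply, ← MemLp.toLp_const_smul]
    refine MemLp.toLp_congr _ _ (.of_forall fun x => ?_)
    simp

theorem matrixCoeff_apply (hπ : ∀ (f : Module.Dual ℂ V) (v : V), Continuous fun g => f (π g v))
    (f : Module.Dual ℂ V) (v : V) : matrixCoeff hπ f v = (memLp_matrixCoeff hπ f v).toLp _ := rfl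

theorem rightRegular_matrixCoeff
    (hπ : ∀ (f : Module.Dual ℂ V) (v : V), Continuous fun g => f (π g v))
    (f : Module.Dual ℂ V) (g : SO n) (v : V) :
    matrixCoeff hπ f (π g v) = rightRegular n g (matrixCoeff hπ f v) := by
  change _ = DomMulAct.mk (MulOpposite.op g) • matrixCoeff hπ f v
  rw [matrixCoeff_apply, matrixCoeff_apply, DomMulAct.mk_smul_toLp]
  refine MemLp.toLp_congr _ _ (.of_forall fun x => ?_)
  simp

/-- The functionals on `V` invariant under `Γ`. -/
def invariantFunctionals (π : Representation ℂ (SO n) V) (Γ : Subgroup (SO n)) :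
    Submodule ℂ (Module.Dual ℂ V) where
  carrier := {f | ∀ γ ∈ Γ, ∀ v, f (π γ v) = f v}
  add_mem' {f f'} hf hf' γ hγ v := by
    rw [LinearMap.add_apply, LinearMap.add_apply, hf γ hγ, hf' γ hγ]
  zero_mem' _ _ _ := rfl
  smul_mem' c f hf γ hγ v := by
    rw [LinearMap.smul_apply, LinearMap.smul_apply, hf γ hγ]

theorem matrixCoeff_mem (hπ : ∀ (f : Module.Dual ℂ V) (v : V), Continuous fun g => f (π g v))
    {Γ : Subgroup (SO n)} {f : Module.Dual ℂ V} (hf : f ∈ invariantFunctionals π Γ) (v : V) :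
    matrixCoeff hπ f v ∈ (L2Quotient Γ).toSubmodule := by
  intro γ hγ
  rw [matrixCoeff_apply, DomMulAct.mk_smul_toLp]
  refine MemLp.toLp_congr _ _ (.of_forall fun x => ?_)
  change f (π (γ • x) v) = f (π x v)
  rw [smul_eq_mul, map_mul, Module.End.mul_apply, hf γ hγ]

/-- An equality of continuous functions on `SO(2n)` holding almost everywhere holds everywhere. -/
theorem eq_of_toLp_eq {f g : SO n → ℂ} (hf : Continuous f) (hg : Continuous g)
    (hf' : MemLp f 2 (haarSO n)) (hg' : MemLp g 2 (haarSO n)) (h : hf'.toLp f = hg'.toLp g) :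
    f = g :=
  (Continuous.ae_eq_iff_eq (haarSO n) hf hg).1 ((MemLp.toLp_eq_toLp_iff hf' hg').1 h)

theorem ae_ae_swap {p : SO n → SO n → Prop} (hp : MeasurableSet {x : SO n × SO n | p x.1 x.2})
    (h : ∀ g : SO n, ∀ᵐ x ∂haarSO n, p g x) : ∀ᵐ x ∂haarSO n, ∀ᵐ g ∂haarSO n, p g x := by
  rw [← Measure.ae_ae_comm hp]
  exact Filter.Eventually.of_forall h

theorem ae_mul_left {p : SO n → Prop} (h : ∀ᵐ g ∂haarSO n, p g) (x : SO n) :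
    ∀ᵐ y ∂haarSO n, p (x * y) :=
  (measurePreserving_mul_left (haarSO n) x).quasiMeasurePreserving.ae h

/-- Functions on `SO(2n)` whose right translates are linear combinations of them, for each group
element `g` at almost all points `x`, are determined by their values at one point `x₀`: Fubini's
theorem provides a point `x₀` at which the relation holds for almost all `g`. -/
theorem exists_eq_sum_mul_of_translation {m : ℕ} {F : Fin m → SO n → ℂ} (hF : ∀ i, Measurable (F i))
    {c : Fin m → Fin m → SO n → ℂ} (hc : ∀ i j, Measurable (c i j))
    (h : ∀ g : SO n, ∀ᵐ x ∂haarSO n, ∀ i, F i (x * g) = ∑ j, c i j g * F j x) :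
    ∃ x₀, ∀ᵐ y ∂haarSO n, ∀ i, F i y = ∑ j, c i j (x₀⁻¹ * y) * F j x₀ := by
  have h2 : ∀ᵐ x ∂haarSO n, ∀ᵐ g ∂haarSO n, ∀ i, F i (x * g) = ∑ j, c i j g * F j x := by
    refine ae_ae_swap (p := fun g x => ∀ i, F i (x * g) = ∑ j, c i j g * F j x) ?_ h
    rw [Set.ofPred_forall]
    refine MeasurableSet.iInter fun i => measurableSet_eq_fun ?_ ?_
    · exact (hF i).comp (measurable_snd.mul measurable_fst)
    · exact Finset.measurable_sum _ fun j _ =>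
        ((hc i j).comp measurable_fst).mul ((hF j).comp measurable_snd)
  obtain ⟨x₀, hx₀⟩ := h2.exists
  have h3 : ∀ᵐ y ∂haarSO n, ∀ i, F i (x₀ * (x₀⁻¹ * y)) = ∑ j, c i j (x₀⁻¹ * y) * F j x₀ :=
    ae_mul_left (p := fun g => ∀ i, F i (x₀ * g) = ∑ j, c i j g * F j x₀) hx₀ x₀⁻¹
  simp only [mul_inv_cancel_left] at h3
  exact ⟨x₀, h3⟩

theorem translation_eq_sum_of_equivariant {ι : Type*} [Fintype ι] (b : Module.Basis ι ℂ V)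
    (T : V →ₗ[ℂ] Lp ℂ 2 (haarSO n)) (hT : ∀ g v, T (π g v) = rightRegular n g (T v)) (g : SO n)
    (i : ι) : ∀ᵐ x ∂haarSO n,
      T (b i) (x * g) = ∑ j, b.coord j (π g (b i)) * T (b j) x := by
  have e1 : T (π g (b i)) = ∑ j, b.coord j (π g (b i)) • T (b j) := by
    conv_lhs => rw [← b.sum_repr (π g (b i)), map_sum]
    exact Finset.sum_congr rfl fun j _ => map_smul T _ _
  have e2 : (T (π g (b i)) : SO n → ℂ) =ᵐ[haarSO n] fun x => T (b i) (x * g) := by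
    rw [hT]
    exact DomMulAct.smul_Lp_ae_eq (DomMulAct.mk (MulOpposite.op g)) (T (b i))
  have e3 : (T (π g (b i)) : SO n → ℂ) =ᵐ[haarSO n]
      fun x => ∑ j, b.coord j (π g (b i)) * T (b j) x := by
    rw [e1]
    refine (Lp.coeFn_finsetSum Finset.univ fun j => b.coord j (π g (b i)) • T (b j)).trans ?_
    have e4 : ∀ᵐ x ∂haarSO n, ∀ j, (b.coord j (π g (b i)) • T (b j) : Lp ℂ 2 (haarSO n)) x =
        b.coord j (π g (b i)) * T (b j) x :=
      ae_all_iff.2 fun j => Lp.coeFn_smul (b.coord j (π g (b i))) (T (b j))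
    filter_upwards [e4] with x hx
    rw [Finset.sum_apply]
    exact Finset.sum_congr rfl fun j _ => hx j
  exact e2.symm.trans e3

/-- An equivariant map from a finite-dimensional continuous representation to `L²(G)` consists of
matrix coefficients. -/
theorem exists_eq_matrixCoeff [FiniteDimensional ℂ V]
    (hπ : ∀ (f : Module.Dual ℂ V) (v : V), Continuous fun g => f (π g v))
    (T : V →ₗ[ℂ] Lp ℂ 2 (haarSO n)) (hT : ∀ g v, T (π g v) = rightRegular n g (T v)) :
    ∃ f : Module.Dual ℂ V, T = matrixCoeff hπ f := by
  let b := Module.finBasis ℂ V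
  obtain ⟨x₀, h⟩ := exists_eq_sum_mul_of_translation (F := fun i x => T (b i) x)
    (c := fun i j g => b.coord j (π g (b i)))
    (fun i => (Lp.stronglyMeasurable (T (b i))).measurable) (fun i j => (hπ _ _).measurable)
    fun g => ae_all_iff.2 fun i => translation_eq_sum_of_equivariant b T hT g i
  let f₀ : Module.Dual ℂ V := ∑ j, (T (b j) x₀) • b.coord j
  refine ⟨f₀ ∘ₗ π x₀⁻¹, b.ext fun i => ?_⟩
  rw [matrixCoeff_apply]
  refine Lp.ext ?_
  refine Filter.EventuallyEq.trans ?_ (MemLp.coeFn_toLp _).symm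
  filter_upwards [h] with y hy
  refine (hy i).trans ?_
  simp only [f₀, LinearMap.comp_apply, LinearMap.sum_apply, LinearMap.smul_apply, map_mul,
    Module.End.mul_apply, smul_eq_mul]
  exact Finset.sum_congr rfl fun j _ => mul_comm _ _

/-- Frobenius reciprocity: `n_Γ(π)` is the dimension of the space of `Γ`-invariant functionals. -/
theorem mult_eq_finrank_invariantFunctionals [FiniteDimensional ℂ V]
    (hπ : ∀ (f : Module.Dual ℂ V) (v : V), Continuous fun g => f (π g v)) (Γ : Subgroup (SO n)) :
    mult Γ π = Module.finrank ℂ (invariantFunctionals π Γ) := by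
  let Φ : invariantFunctionals π Γ →ₗ[ℂ]
      Representation.IntertwiningMap π (L2Quotient Γ).toRepresentation :=
    { toFun := fun f =>
        { toLinearMap := (matrixCoeff hπ f.1).codRestrict _ (matrixCoeff_mem hπ f.2)
          isIntertwining' := fun g => LinearMap.ext fun v => Subtype.ext
            (rightRegular_matrixCoeff hπ f.1 g v) }
      map_add' := fun f f' => Representation.IntertwiningMap.ext (LinearMap.ext fun v =>
        Subtype.ext (by
          change matrixCoeff hπ (f.1 + f'.1) v = matrixCoeff hπ f.1 v + matrixCoeff hπ f'.1 v
          rw [matrixCoeff_apply, matrixCoeff_apply, matrixCoeff_apply, ← MemLp.toLp_add]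
          rfl))
      map_smul' := fun c f => Representation.IntertwiningMap.ext (LinearMap.ext fun v =>
        Subtype.ext (by
          change matrixCoeff hπ (c • f.1) v = c • matrixCoeff hπ f.1 v
          rw [matrixCoeff_apply, matrixCoeff_apply, ← MemLp.toLp_const_smul]
          rfl)) }
  have hΦ : ∀ f v, ((Φ f v : (L2Quotient Γ).toSubmodule) : Lp ℂ 2 (haarSO n)) =
      matrixCoeff hπ f.1 v := fun _ _ => rfl
  refine (LinearEquiv.finrank_eq (LinearEquiv.ofBijective Φ ⟨?_, ?_⟩)).symm
  · intro f f' hff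
    refine Subtype.ext (LinearMap.ext fun v => ?_)
    have h1 : matrixCoeff hπ f.1 v = matrixCoeff hπ f'.1 v := by rw [← hΦ, ← hΦ, hff]
    have h2 := congrFun (eq_of_toLp_eq (hπ _ _) (hπ _ _) (memLp_matrixCoeff hπ _ _)
      (memLp_matrixCoeff hπ _ _) h1) 1
    simpa using h2
  · intro T
    obtain ⟨f, hf⟩ := exists_eq_matrixCoeff hπ
      ((L2Quotient Γ).toSubmodule.subtype ∘ₗ T.toLinearMap) fun g v => by
        change ((T (π g v) : (L2Quotient Γ).toSubmodule) : Lp ℂ 2 (haarSO n)) = _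
        rw [T.isIntertwining]
        rfl
    have hfv : ∀ v, ((T v : (L2Quotient Γ).toSubmodule) : Lp ℂ 2 (haarSO n)) =
        matrixCoeff hπ f v := fun v => LinearMap.congr_fun hf v
    have hmem : f ∈ invariantFunctionals π Γ := fun γ hγ v => by
      have h1 := (T v).2 γ hγ
      rw [hfv, matrixCoeff_apply, DomMulAct.mk_smul_toLp] at h1
      have h2 := congrFun
        (eq_of_toLp_eq ((hπ f v).comp (continuous_const_smul γ)) (hπ f v) _ _ h1) 1
      simpa using h2
    exact ⟨⟨f, hmem⟩, Representation.IntertwiningMap.ext (LinearMap.ext fun v =>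
      Subtype.ext (hfv v).symm)⟩

theorem mem_invariantFunctionals_zpowers {γ : SO n} {f : Module.Dual ℂ V} :
    f ∈ invariantFunctionals π (Subgroup.zpowers γ) ↔ ∀ v, f (π γ v) = f v := by
  refine ⟨fun h => h γ (Subgroup.mem_zpowers γ), fun h => ?_⟩
  let H : Subgroup (SO n) :=
    { carrier := {g | ∀ v, f (π g v) = f v}
      mul_mem' := fun {a b} ha hb v => by
        rw [map_mul, Module.End.mul_apply, ha, hb]
      one_mem' := fun v => by rw [map_one, Module.End.one_apply]
      inv_mem' := fun {a} ha v => by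
        have h1 := ha (π a⁻¹ v)
        rw [← Module.End.mul_apply, ← map_mul, mul_inv_cancel, map_one, Module.End.one_apply] at h1
        exact h1.symm }
  have hle : Subgroup.zpowers γ ≤ H := by
    rw [Subgroup.zpowers_le]
    exact h
  exact fun g hg => hle hg

/-- For a cyclic group, `n_Γ(π)` is the dimension of the fixed space of a generator. -/
theorem mult_zpowers [FiniteDimensional ℂ V]
    (hπ : ∀ (f : Module.Dual ℂ V) (v : V), Continuous fun g => f (π g v)) (γ : SO n) :
    mult (Subgroup.zpowers γ) π = Module.finrank ℂ (Module.End.eigenspace (π γ) 1) := by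
  rw [mult_eq_finrank_invariantFunctionals hπ]
  have h1 : invariantFunctionals π (Subgroup.zpowers γ) = LinearMap.ker (π γ - 1).dualMap := by
    ext f
    rw [mem_invariantFunctionals_zpowers, LinearMap.mem_ker, LinearMap.ext_iff]
    refine forall_congr' fun v => ?_
    rw [LinearMap.dualMap_apply, LinearMap.sub_apply, map_sub, Module.End.one_apply,
      LinearMap.zero_apply, sub_eq_zero]
  rw [h1, Module.End.eigenspace_def, one_smul]
  have h2 := LinearMap.finrank_range_add_finrank_ker (π γ - 1)
  have h3 := LinearMap.finrank_range_add_finrank_ker (π γ - 1).dualMap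
  rw [LinearMap.finrank_range_dualMap_eq_finrank_range, Subspace.dual_finrank_eq] at h3
  omega

end Mult

/-! ### The representations on the eigenspaces of the star operator -/

/-- The representation of `SO(2n)` on an eigenspace of the star operator. -/
def starRep (n : ℕ) (c : ℂ) : Representation ℂ (SO n) (starSpace n c) where
  toFun g := (midRep n g).restrict fun α hα => mem_starSpace.2 (by
    rw [star_midRep, mem_starSpace.1 hα, map_smul])
  map_one' := by
    ext1 v
    exact Subtype.ext (by simp)
  map_mul' g h := by
    ext1 v
    exact Subtype.ext (by simp)

theorem coe_starRep {n : ℕ} {c : ℂ} (g : SO n) (v : starSpace n c) :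
    ((starRep n c g v : starSpace n c) : MidForm n) = midRep n g v := rfl

theorem continuous_isoForm_midRep {n : ℕ} (w : Fin n → Fin 2 × Fin n)
    (v : Fin n → Fin 2 × Fin n → ℂ) : Continuous fun g : SO n => midRep n g (isoForm w) v := by
  have h : ∀ (k : Fin n) (p : Fin 2 × Fin n),
      Continuous fun g : SO n => (cmat (g⁻¹).1).mulVec (v k) p := fun k p => by
    simp only [Matrix.mulVec, dotProduct, cmat_apply]
    refine continuous_finsetSum _ fun l _ => Continuous.mul ?_ continuous_const
    refine Complex.continuous_ofReal.comp ?_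
    exact (continuous_subtype_val.comp continuous_inv).matrix_elem p l
  simp only [midRep_apply, pull_apply, isoForm_apply, isoBasis_repr]
  refine Continuous.matrix_det (continuous_matrix fun k i => ?_)
  simp only [Matrix.of_apply]
  exact ((h k _).add (continuous_const.mul (h k _))).div_const _

theorem continuous_dual_midRep {n : ℕ} (F : Module.Dual ℂ (MidForm n)) (α : MidForm n) :
    Continuous fun g : SO n => F (midRep n g α) := by
  have h1 : ∀ β : MidForm n, F β =
      ∑ S, isoCoord β (enumOf S) * F (isoForm (enumOf S)) := fun β => by
    conv_lhs => rw [← (isoFormBasis n).sum_repr β, map_sum]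
    refine Finset.sum_congr rfl fun S _ => ?_
    rw [map_smul, isoFormBasis_repr, isoFormBasis_apply, smul_eq_mul]
  have h2 : ∀ (g : SO n) (T : {S : Finset (Fin 2 × Fin n) // S.card = n}),
      isoCoord (midRep n g α) (enumOf T) = ∑ S, isoCoord α (enumOf S) *
        midRep n g (isoForm (enumOf S)) (fun i => isoBasis n (enumOf T i)) := fun g T => by
    change evalAt _ (midRep n g α) = _
    conv_lhs => rw [← (isoFormBasis n).sum_repr α, map_sum, map_sum]
    refine Finset.sum_congr rfl fun S _ => ?_
    rw [map_smul, map_smul, isoFormBasis_repr, isoFormBasis_apply, smul_eq_mul]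
    rfl
  simp only [h1 (midRep n _ α), h2]
  exact continuous_finsetSum _ fun T _ => (continuous_finsetSum _ fun S _ =>
    continuous_const.mul (continuous_isoForm_midRep _ _)).mul continuous_const

theorem continuous_dual_starRep {n : ℕ} {c : ℂ} (f : Module.Dual ℂ (starSpace n c))
    (v : starSpace n c) : Continuous fun g => f (starRep n c g v) := by
  obtain ⟨F, hF⟩ := LinearMap.exists_extend f
  have : ∀ w : starSpace n c, f w = F w := fun w => by rw [← hF]; rfl
  simp only [this, coe_starRep]
  exact continuous_dual_midRep F v

theorem isIrrep_starRep {n : ℕ} {c : ℂ} (hc : starSpace n c ≠ ⊥) : IsIrrep (starRep n c) where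
  finiteDimensional := inferInstance
  continuous := continuous_dual_starRep
  irreducible := by
    have hnt : Nontrivial (starSpace n c) := Submodule.nontrivial_iff_ne_bot.2 hc
    refine { exists_pair_ne := ⟨⊥, ⊤, fun h => ?_⟩, eq_bot_or_eq_top := fun σ => ?_ }
    · have : (⊥ : Submodule ℂ (starSpace n c)) = ⊤ := congrArg Subrepresentation.toSubmodule h
      exact bot_ne_top this
    · by_cases hσ : σ.toSubmodule = ⊥
      · exact Or.inl (Subrepresentation.toSubmodule_injective hσ)
      · right
        apply Subrepresentation.toSubmodule_injective
        change σ.toSubmodule = ⊤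
        have hinv : RotationInvariant (σ.toSubmodule.map (starSpace n c).subtype) := by
          rintro A hA _ ⟨v, hv, rfl⟩
          refine ⟨_, σ.apply_mem_toSubmodule (⟨A, hA⟩ : SO n)⁻¹ hv, ?_⟩
          change midRep n (⟨A, hA⟩ : SO n)⁻¹ v = _
          rw [midRep_apply, inv_inv]
          rfl
        have hle := starSpace_le_of_rotationInvariant hinv (fun h => hσ
          (Submodule.map_injective_of_injective (starSpace n c).subtype_injective
            (h.trans (Submodule.map_bot _).symm))) (Submodule.map_subtype_le _ _)
        rw [eq_top_iff]
        intro v _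
        obtain ⟨v', hv', h⟩ := hle v.2
        rwa [← Subtype.ext h]

theorem mem_weightSpace_starRep {n : ℕ} {c : ℂ} {v : starSpace n c} {η : Fin n → ℤ} :
    v ∈ weightSpace (starRep n c) η ↔ (v : MidForm n) ∈ weightSpace (midRep n) η := by
  rw [mem_weightSpace, mem_weightSpace]
  refine forall_congr' fun θ => ?_
  rw [Subtype.ext_iff]
  rfl

/-! ### Highest weights -/

/-- An even nonnegative vector, none of whose entries exceeds the sum of the others, is a sum of
roots `ε_i + ε_j`: this is the degree sequence of a loopless multigraph. -/
theorem mem_closure_positiveRoots {n : ℕ} (b : Fin n → ℕ) (heven : Even (∑ j, b j))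
    (hb : ∀ k, 2 * b k ≤ ∑ j, b j) :
    (fun j => (b j : ℤ)) ∈ AddSubmonoid.closure (positiveRoots n) := by
  obtain ⟨m, hm⟩ := heven
  induction m generalizing b with
  | zero =>
    have h0 : ∀ j, b j = 0 := fun j => by
      have := Finset.single_le_sum (f := b) (fun _ _ => Nat.zero_le _) (Finset.mem_univ j)
      omega
    have : (fun j => (b j : ℤ)) = 0 := by
      funext j
      simp [h0]
    rw [this]
    exact zero_mem _
  | succ m ih =>
    obtain ⟨i, -, hi⟩ : ∃ i ∈ (Finset.univ : Finset (Fin n)), ∀ k ∈ Finset.univ, b k ≤ b i := by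
      refine Finset.exists_max_image _ b ?_
      by_contra h
      rw [Finset.not_nonempty_iff_eq_empty] at h
      rw [h] at hm
      simp at hm
    have hsum : ∑ k ∈ Finset.univ.erase i, b k + b i = ∑ k, b k :=
      Finset.sum_erase_add _ _ (Finset.mem_univ i)
    have hpos : 0 < ∑ k ∈ Finset.univ.erase i, b k := by
      have := hb i
      omega
    obtain ⟨j, hj, hjmax⟩ : ∃ j ∈ Finset.univ.erase i, ∀ k ∈ Finset.univ.erase i, b k ≤ b j := by
      refine Finset.exists_max_image _ b ?_
      by_contra h
      rw [Finset.not_nonempty_iff_eq_empty] at h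
      rw [h] at hpos
      simp at hpos
    have hji : j ≠ i := Finset.ne_of_mem_erase hj
    have hjpos : 0 < b j := by
      by_contra h0
      have : ∑ k ∈ Finset.univ.erase i, b k = 0 := Finset.sum_eq_zero fun k hk => by
        have := hjmax k hk
        omega
      omega
    have hij : b j ≤ b i := hi j (Finset.mem_univ j)
    let r : Fin n → ℕ := Pi.single i 1 + Pi.single j 1
    have hri : r i = 1 := by simp [r, hji]
    have hrj : r j = 1 := by simp [r, hji]
    have hrk : ∀ k, k ≠ i → k ≠ j → r k = 0 := fun k h1 h2 => by simp [r, h1, h2]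
    have hr : ∀ k, r k ≤ b k := fun k => by
      by_cases h1 : k = i
      · subst h1; omega
      · by_cases h2 : k = j
        · subst h2; omega
        · rw [hrk k h1 h2]; omega
    have hrsum : ∑ k, r k = 2 := by
      simp [r, Finset.sum_add_distrib]
    have hsub : ∑ k, (b k - r k) + ∑ k, r k = ∑ k, b k := by
      rw [← Finset.sum_add_distrib]
      exact Finset.sum_congr rfl fun k _ => Nat.sub_add_cancel (hr k)
    have key := ih (fun k => b k - r k) (fun k => by
      by_cases h1 : k = i
      · subst h1
        have := hb k
        omega
      · by_cases h2 : k = j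
        · subst h2
          have := hb k
          omega
        · -- `b k ≤ b j ≤ b i` and the three together are at most the sum
          have h3 := hjmax k (Finset.mem_erase.2 ⟨h1, Finset.mem_univ k⟩)
          have h4 : b k + (b j + b i) ≤ ∑ k, b k := by
            have e1 : ∑ l ∈ ({k, j, i} : Finset (Fin n)), b l = b k + (b j + b i) := by
              rw [Finset.sum_insert (by simp [h1, h2]), Finset.sum_insert (by simp [hji]),
                Finset.sum_singleton]
            rw [← e1]
            exact Finset.sum_le_sum_of_subset (Finset.subset_univ _)
          have := hrk k h1 h2
          omega) (by omega)
    have hdecomp : (fun k => (b k : ℤ)) =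
        (fun k => ((b k - r k : ℕ) : ℤ)) + (Pi.single i 1 + Pi.single j 1) := by
      funext k
      have e1 : ((r k : ℕ) : ℤ) = (Pi.single i 1 + Pi.single j 1 : Fin n → ℤ) k := by
        simp only [r, Pi.add_apply, Pi.single_apply]
        push_cast
        rfl
      rw [Pi.add_apply, ← e1]
      have := hr k
      omega
    rw [hdecomp]
    refine add_mem key (AddSubmonoid.subset_closure ?_)
    rcases lt_or_gt_of_ne hji with h | h
    · exact ⟨j, i, h, Or.inl (add_comm _ _)⟩
    · exact ⟨i, j, h, Or.inl rfl⟩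

theorem onesLast_mul_self {n : ℕ} {e : ℤ} (he : e = 1 ∨ e = -1) (j : Fin n) :
    onesLast n e j * onesLast n e j = 1 := by
  rw [onesLast]
  rcases he with rfl | rfl <;> split_ifs <;> rfl

/-- The sign change of the last coordinate preserves the cone of positive roots. -/
theorem onesLast_mul_mem_closure {n : ℕ} {e : ℤ} (he : e = 1 ∨ e = -1) {x : Fin n → ℤ}
    (hx : x ∈ AddSubmonoid.closure (positiveRoots n)) :
    onesLast n e * x ∈ AddSubmonoid.closure (positiveRoots n) := by
  induction hx using AddSubmonoid.closure_induction with
  | mem x hx =>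
    obtain ⟨i, j, hij, hx⟩ := hx
    refine AddSubmonoid.subset_closure ⟨i, j, hij, ?_⟩
    have h1 : ∀ k : Fin n, onesLast n e * Pi.single k 1 =
        Pi.single k (onesLast n e k) := fun k => by
      funext l
      by_cases h : l = k
      · subst h; simp
      · simp [h]
    have hi : onesLast n e i = 1 := by
      rw [onesLast, if_neg]
      have := j.2
      have : (i : ℕ) < j := hij
      omega
    have hj : onesLast n e j = 1 ∨ onesLast n e j = -1 := by
      rw [onesLast]
      split_ifs
      · exact he
      · exact Or.inl rfl
    rcases hx with rfl | rfl
    · rw [mul_add, h1, h1, hi]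
      rcases hj with hj | hj <;> rw [hj]
      · exact Or.inl rfl
      · exact Or.inr (by rw [sub_eq_add_neg, ← Pi.single_neg])
    · rw [mul_sub, h1, h1, hi]
      rcases hj with hj | hj <;> rw [hj]
      · exact Or.inr rfl
      · exact Or.inl (by rw [sub_eq_add_neg, ← Pi.single_neg, neg_neg])
  | zero => rw [mul_zero]; exact zero_mem _
  | add x y _ _ hx hy => rw [mul_add]; exact add_mem hx hy

theorem prod_onesLast {n : ℕ} (hn : 0 < n) (e : ℤ) : ∏ j, onesLast n e j = e := by
  rw [Finset.prod_eq_single (⟨n - 1, by omega⟩ : Fin n)]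
  · rw [onesLast, if_pos]
    change n - 1 + 1 = n
    omega
  · intro j _ hj
    rw [onesLast, if_neg]
    intro h
    exact hj (Fin.ext (by change (j : ℕ) = n - 1; omega))
  · simp

theorem abs_indexWeight_le {n : ℕ} {w : Fin n → Fin 2 × Fin n} (hw : Function.Injective w)
    (j : Fin n) : indexWeight w j = 0 ∨ indexWeight w j = 1 ∨ indexWeight w j = -1 := by
  have h : ∀ a : Fin 2, ∑ i, (if w i = (a, j) then (1 : ℤ) else 0) = 0 ∨
      ∑ i, (if w i = (a, j) then (1 : ℤ) else 0) = 1 := fun a => by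
    by_cases ha : ∃ i, w i = (a, j)
    · obtain ⟨i, hi⟩ := ha
      right
      rw [Finset.sum_eq_single i]
      · simp [hi]
      · intro k _ hk
        rw [← hi, if_neg (hw.ne hk)]
      · simp
    · push Not at ha
      left
      exact Finset.sum_eq_zero fun i _ => if_neg (ha i)
  have hw' : indexWeight w j = ∑ i, (if w i = (0, j) then (1 : ℤ) else 0) -
      ∑ i, (if w i = (1, j) then (1 : ℤ) else 0) := by
    rw [indexWeight, ← Finset.sum_sub_distrib]
    refine Finset.sum_congr rfl fun i _ => ?_
    rcases w i with ⟨a, k⟩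
    fin_cases a <;> simp [labelSign]
    split_ifs <;> simp
  rw [hw']
  rcases h 0 with h0 | h0 <;> rcases h 1 with h1 | h1 <;> rw [h0, h1] <;> norm_num

theorem even_sub_sum_indexWeight {n : ℕ} (w : Fin n → Fin 2 × Fin n) :
    Even ((n : ℤ) - ∑ j, indexWeight w j) := by
  have h : ∑ j, indexWeight w j = ∑ i, labelSign (w i).1 := by
    simp only [indexWeight]
    rw [Finset.sum_comm]
    exact Finset.sum_congr rfl fun i _ => by simp
  have h2 : (n : ℤ) = ∑ _i : Fin n, 1 := by simp
  rw [h]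
  conv => arg 1; arg 1; rw [h2]
  rw [← Finset.sum_sub_distrib]
  refine Finset.even_sum _ fun i _ => ?_
  rw [labelSign]
  split_ifs
  · exact ⟨0, rfl⟩
  · exact ⟨1, rfl⟩

/-- The sign pattern of an extreme weight occurring in an eigenspace of the star operator. -/
theorem prod_eq_of_extreme_weight {n : ℕ} {e : ℤ} {α : MidForm n}
    (hα : star α = ((e : ℂ) * starEigenvalue n) • α) (h0 : α ≠ 0) {η : Fin n → ℤ}
    (hη : α ∈ weightSpace (midRep n) η) (hext : ∀ j, η j = 1 ∨ η j = -1) : ∏ j, η j = e := by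
  classical
  let A : Finset (Fin n) := Finset.univ.filter fun j => η j = -1
  have hA : indexWeight (extremeIndex A) = η := by
    funext j
    rw [indexWeight_extremeIndex]
    simp only [A, Finset.mem_filter, Finset.mem_univ, true_and]
    rcases hext j with h | h <;> rw [h] <;> norm_num
  rw [← hA] at hη
  have h1 := eq_smul_isoForm_of_mem_weightSpace hη
  have h2 : star α = ((-1) ^ A.card * starEigenvalue n) • α := by
    rw [h1, map_smul, star_isoForm_extremeIndex, smul_comm]
  rw [hα] at h2
  have h3 := mul_right_cancel₀ (starEigenvalue_ne_zero n) (smul_left_injective ℂ h0 h2)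
  have h4 : e = (-1) ^ A.card := by exact_mod_cast h3
  rw [h4, ← hA]
  simp only [indexWeight_extremeIndex]
  rw [Finset.prod_ite]
  simp

theorem hasHighestWeight_starRep {n : ℕ} (hn : 0 < n) {e : ℤ} (he : e = 1 ∨ e = -1) :
    HasHighestWeight (starRep n ((e : ℂ) * starEigenvalue n)) (onesLast n e) := by
  constructor
  · let A : Finset (Fin n) := if e = 1 then ∅ else {⟨n - 1, by omega⟩}
    have hA : indexWeight (extremeIndex A) = onesLast n e := by
      funext j
      rw [indexWeight_extremeIndex, onesLast]
      have hj : (j : ℕ) + 1 = n ↔ j = ⟨n - 1, by omega⟩ := by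
        rw [Fin.ext_iff]
        change _ ↔ (j : ℕ) = n - 1
        omega
      rcases he with rfl | rfl <;> simp [A, hj]
    have hcard : ((-1 : ℂ) ^ A.card) = e := by
      rcases he with rfl | rfl <;> simp [A]
    have hmem : isoForm (extremeIndex A) ∈ starSpace n ((e : ℂ) * starEigenvalue n) := by
      rw [mem_starSpace, star_isoForm_extremeIndex, hcard]
    intro hbot
    have h1 : (⟨_, hmem⟩ : starSpace n ((e : ℂ) * starEigenvalue n)) ∈
        weightSpace (starRep n ((e : ℂ) * starEigenvalue n)) (onesLast n e) := by
      rw [mem_weightSpace_starRep, ← hA]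
      exact isoForm_mem_weightSpace _
    rw [hbot, Submodule.mem_bot] at h1
    exact isoForm_ne_zero (extremeIndex_injective A) (congrArg Subtype.val h1)
  · intro η hη
    obtain ⟨v, hv, hv0⟩ := Submodule.exists_mem_ne_zero_of_ne_bot hη
    rw [mem_weightSpace_starRep] at hv
    have hv0' : (v : MidForm n) ≠ 0 := fun h => hv0 (Subtype.ext h)
    obtain ⟨w, hw⟩ : ∃ w, isoCoord (v : MidForm n) w ≠ 0 := by
      by_contra! h
      exact hv0' (midForm_ext_iso fun w _ => h w)
    have hwi := injective_of_isoCoord_ne_zero hw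
    have hwη := indexWeight_eq_of_mem_weightSpace hv hw
    have hη3 : ∀ j, η j = 0 ∨ η j = 1 ∨ η j = -1 := fun j => hwη ▸ abs_indexWeight_le hwi j
    have hs : ∀ j, onesLast n e j = 1 ∨ onesLast n e j = -1 := fun j => by
      rw [onesLast]
      split_ifs
      · exact he
      · exact Or.inl rfl
    -- after the sign change of the last coordinate, the difference has entries in `{0, 1, 2}`
    let b : Fin n → ℕ := fun j => (1 - onesLast n e j * η j).toNat
    have hb : ∀ j, (b j : ℤ) = 1 - onesLast n e j * η j := fun j => by
      refine Int.toNat_of_nonneg ?_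
      rcases hs j with h | h <;> rcases hη3 j with h' | h' | h' <;> rw [h, h'] <;> norm_num
    have hble : ∀ j, b j ≤ 2 := fun j => by
      have := hb j
      rcases hs j with h | h <;> rcases hη3 j with h' | h' | h' <;> rw [h, h'] at this <;> omega
    have hsumZ : ((∑ j, b j : ℕ) : ℤ) = n - ∑ j, onesLast n e j * η j := by
      push_cast
      simp [hb, Finset.sum_sub_distrib]
    have heven : Even (∑ j, b j) := by
      rw [← Int.even_coe_nat, hsumZ]
      have h1 := even_sub_sum_indexWeight w
      rw [hwη] at h1
      have h2 : Even (∑ j, (η j - onesLast n e j * η j)) := Finset.even_sum _ fun j _ => by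
        rcases hs j with h | h <;> rw [h]
        · exact ⟨0, by ring⟩
        · exact ⟨η j, by ring⟩
      rw [Finset.sum_sub_distrib] at h2
      have := h1.add h2
      rwa [sub_add_sub_cancel] at this
    have hbal : ∀ k, 2 * b k ≤ ∑ j, b j := fun k => by
      have hk := Finset.sum_erase_add Finset.univ b (Finset.mem_univ k)
      have hk2 := hble k
      obtain ⟨m, hm⟩ := heven
      by_contra hlt
      -- the excluded case is a single entry `2`, that is an extreme weight of the wrong parity
      have hbk : b k = 2 := by omega
      have hrest : ∑ j ∈ Finset.univ.erase k, b j = 0 := by omega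
      have hj0 : ∀ j, j ≠ k → b j = 0 := fun j hj =>
        (Finset.sum_eq_zero_iff.1 hrest) j (Finset.mem_erase.2 ⟨hj, Finset.mem_univ j⟩)
      have hprod : ∏ j, onesLast n e j * η j = -1 := by
        rw [Finset.prod_eq_single k]
        · have := hb k
          rw [hbk] at this
          push_cast at this
          linarith
        · intro j _ hj
          have := hb j
          rw [hj0 j hj] at this
          push_cast at this
          linarith
        · simp
      rw [Finset.prod_mul_distrib, prod_onesLast hn] at hprod
      have hext : ∀ j, η j = 1 ∨ η j = -1 := fun j => by
        rcases hη3 j with h | h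
        · have h1 := hb j
          rw [h] at h1
          by_cases hjk : j = k
          · subst hjk
            rw [hbk] at h1
            norm_num at h1
          · rw [hj0 j hjk] at h1
            norm_num at h1
        · exact h
      rw [prod_eq_of_extreme_weight (mem_starSpace.1 v.2) hv0' hv hext] at hprod
      rcases he with rfl | rfl <;> norm_num at hprod
    have hmem := onesLast_mul_mem_closure he (mem_closure_positiveRoots b heven hbal)
    have heq : onesLast n e * (fun j => (b j : ℤ)) = onesLast n e - η := by
      funext j
      rw [Pi.mul_apply, hb, Pi.sub_apply, mul_sub, mul_one, ← mul_assoc, onesLast_mul_self he,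
        one_mul]
    rwa [heq] at hmem

theorem starSpace_ne_bot {n : ℕ} (hn : 0 < n) {e : ℤ} (he : e = 1 ∨ e = -1) :
    starSpace n ((e : ℂ) * starEigenvalue n) ≠ ⊥ := fun h => by
  refine (hasHighestWeight_starRep hn he).1 (eq_bot_iff.2 fun v _ => ?_)
  have : (v : MidForm n) ∈ (⊥ : Submodule ℂ (MidForm n)) := h ▸ v.2
  exact (Submodule.mem_bot ℂ).2 (Subtype.ext ((Submodule.mem_bot ℂ).1 this))

/-! ### Multiplicities of the two representations -/

theorem mult_starRep {n : ℕ} (c : ℂ) (g : SO n) :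
    mult (Subgroup.zpowers g) (starRep n c) = Module.finrank ℂ (fixedSpace c g) := by
  rw [mult_zpowers continuous_dual_starRep, ← Submodule.finrank_map_subtype_eq]
  suffices h : Submodule.map (starSpace n c).subtype (Module.End.eigenspace (starRep n c g) 1) =
      fixedSpace c g by rw [h]
  ext α
  rw [Submodule.mem_map, fixedSpace, Submodule.mem_inf]
  constructor
  · rintro ⟨v, hv, rfl⟩
    exact ⟨v.2, Module.End.mem_eigenspace_iff.2
      (congrArg Subtype.val (Module.End.mem_eigenspace_iff.1 hv))⟩
  · rintro ⟨h1, h2⟩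
    exact ⟨⟨α, h1⟩, Module.End.mem_eigenspace_iff.2
      (Subtype.ext (Module.End.mem_eigenspace_iff.1 h2)), rfl⟩

theorem pull_refl_pull_refl {n : ℕ} (j : Fin n) (α : MidForm n) :
    pull (cmat (refl j)) (pull (cmat (refl j)) α) = α := by
  rw [← Module.End.mul_apply, ← pull_mul, ← map_mul, refl_mul_self, map_one, pull_one,
    Module.End.one_apply]

theorem pull_refl_mem_fixedSpace {n : ℕ} {j : Fin n} {g g' : SO n}
    (h : g'.1 = refl j * g.1 * refl j) {c : ℂ} {α : MidForm n} (hα : α ∈ fixedSpace c g) :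
    pull (cmat (refl j)) α ∈ fixedSpace (-c) g' := by
  obtain ⟨h1, h2⟩ := Submodule.mem_inf.1 hα
  refine Submodule.mem_inf.2 ⟨mem_starSpace.2 ?_, Module.End.mem_eigenspace_iff.2 ?_⟩
  · rw [star_pull_refl, mem_starSpace.1 h1, map_smul, neg_smul]
  · rw [Module.End.mem_eigenspace_iff, one_smul, midRep_apply] at h2
    have hg : (g'⁻¹).1 = refl j * (g⁻¹).1 * refl j := by
      rw [SO_inv_val, SO_inv_val, h, Matrix.transpose_mul, Matrix.transpose_mul, refl_transpose,
        mul_assoc]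
    rw [one_smul, midRep_apply, hg, map_mul, map_mul, pull_mul, pull_mul, Module.End.mul_apply,
      Module.End.mul_apply, pull_refl_pull_refl, h2]

/-- Conjugation of the group element by a reflection exchanges the two eigenspaces of the star
operator. -/
theorem finrank_fixedSpace_conj {n : ℕ} {j : Fin n} {g g' : SO n}
    (h : g'.1 = refl j * g.1 * refl j) (c : ℂ) :
    Module.finrank ℂ (fixedSpace c g') = Module.finrank ℂ (fixedSpace (-c) g) := by
  have h' : g.1 = refl j * g'.1 * refl j := by
    rw [h, mul_assoc, mul_assoc, refl_mul_self, mul_one, ← mul_assoc, refl_mul_self, one_mul]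
  refine (LinearEquiv.finrank_eq
    { toFun := fun α => ⟨pull (cmat (refl j)) α.1, pull_refl_mem_fixedSpace h' α.2⟩
      invFun := fun α => ⟨pull (cmat (refl j)) α.1, by
        have := pull_refl_mem_fixedSpace h α.2
        rwa [neg_neg] at this⟩
      map_add' := fun α β => Subtype.ext (map_add _ _ _)
      map_smul' := fun a α => Subtype.ext (map_smul _ _ _)
      left_inv := fun α => Subtype.ext (pull_refl_pull_refl j α.1)
      right_inv := fun α => Subtype.ext (pull_refl_pull_refl j α.1) })

theorem refl_mul_torus_mul_refl {n : ℕ} (j : Fin n) (θ : Fin n → ℝ) :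
    refl j * (torus θ).1 * refl j = (torus (Function.update θ j (-θ j))).1 := by
  ext ⟨a, i⟩ ⟨b, k⟩
  rw [refl, Matrix.mul_diagonal, Matrix.diagonal_mul, torus_apply, torus_apply]
  by_cases hik : i = k
  · subst hik
    by_cases hij : i = j
    · subst hij
      fin_cases a <;> fin_cases b <;> simp [rot]
    · simp [hij]
  · simp [hik]

theorem lensGen_neg {n : ℕ} (hn : 0 < n) (q : ℕ) :
    (lensGen q (onesLast n (-1))).1 =
      refl (⟨n - 1, by omega⟩ : Fin n) * (lensGen q (onesLast n 1)).1 *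
        refl (⟨n - 1, by omega⟩ : Fin n) := by
  rw [lensGen, lensGen, refl_mul_torus_mul_refl]
  congr 2
  funext j
  by_cases hj : j = ⟨n - 1, by omega⟩
  · subst hj
    rw [Function.update_self, onesLast_one, onesLast, if_pos (by change n - 1 + 1 = n; omega)]
    push_cast
    ring
  · rw [Function.update_of_ne hj, onesLast_one, onesLast, if_neg]
    intro h
    exact hj (Fin.ext (by change (j : ℕ) = n - 1; omega))

theorem mult_starRep_sub {n : ℕ} (hn : 0 < n) (heven : Even n) {q : ℕ} (hq : n < q) {e : ℤ}
    (he : e = 1 ∨ e = -1) :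
    (mult (lensGroup q (onesLast n 1)) (starRep n ((e : ℂ) * starEigenvalue n)) : ℤ) -
      mult (lensGroup q (onesLast n (-1))) (starRep n ((e : ℂ) * starEigenvalue n)) =
      e * (-1) ^ (n / 2) * (n.choose (n / 2) : ℤ) := by
  have h := finrank_fixedSpace_sub heven hq
  change (mult (Subgroup.zpowers (lensGen q (onesLast n 1))) _ : ℤ) -
    mult (Subgroup.zpowers (lensGen q (onesLast n (-1)))) _ = _
  rw [mult_starRep, mult_starRep, finrank_fixedSpace_conj (lensGen_neg hn q)]
  rcases he with rfl | rfl
  · rw [Int.cast_one, one_mul, one_mul, h]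
  · rw [Int.cast_neg, Int.cast_one, neg_one_mul, neg_neg, mul_assoc, ← h]
    ring

/-! ### The isotropy representation inside the eigenspaces of the star operator -/

theorem curryLeft_halfDet {m : ℕ} (o : Fin 2 × Fin (m + 1) → ℂ)
    (v : Fin (m + 1) → Fin 2 × Fin (m + 1) → ℂ) (y : Fin m → Fin 2 × Fin (m + 1) → ℂ) :
    (halfDet 0 v).curryLeft o y = halfDet 1 (Fin.cons o y : Fin (m + 1) → _) v := by
  rw [AlternatingMap.curryLeft_apply_apply, halfDet_zero_apply]
  rfl

/-- The multi-index `(o, x)`. -/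
abbrev consIndex {m : ℕ} (o : Fin 2 × Fin (m + 1)) (x : Fin m → Fin 2 × Fin (m + 1)) :
    Fin (m + 1) → Fin 2 × Fin (m + 1) := Fin.cons o x

theorem stdVec_consIndex {m : ℕ} (o : Fin 2 × Fin (m + 1)) (x : Fin m → Fin 2 × Fin (m + 1)) :
    (fun i => stdVec (consIndex o x i)) =
      (Fin.cons (stdVec o) fun i => stdVec (x i) : Fin (m + 1) → Fin 2 × Fin (m + 1) → ℂ) := by
  funext i
  refine Fin.cases ?_ (fun i => ?_) i <;> rfl

/-- The Hodge star of `o ∧ α`, for a form `α` on the tangent space at the base point `o`. -/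
def cotangentStar {m : ℕ} (o : Fin 2 × Fin (m + 1)) :
    cotangent (n := m + 1) (basePoint o) m →ₗ[ℂ] MidForm (m + 1) where
  toFun α := ∑ x : Fin m → Fin 2 × Fin (m + 1),
    α.1 (fun i => EuclideanSpace.single (x i) 1) • halfDet 1 (fun i => stdVec (consIndex o x i))
  map_add' α β := by simp [add_smul, Finset.sum_add_distrib]
  map_smul' c α := by simp [Finset.smul_sum, mul_smul]

theorem cotangentStar_apply {m : ℕ} (o : Fin 2 × Fin (m + 1))
    (α : cotangent (n := m + 1) (basePoint o) m) (v : Fin (m + 1) → Fin 2 × Fin (m + 1) → ℂ) :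
    cotangentStar o α v = ∑ x : Fin m → Fin 2 × Fin (m + 1),
      α.1 (fun i => EuclideanSpace.single (x i) 1) *
        halfDet 1 (fun i => stdVec (consIndex o x i)) v := by
  change evalAt v (∑ x : Fin m → Fin 2 × Fin (m + 1),
    α.1 (fun i => EuclideanSpace.single (x i) 1) •
      halfDet 1 (fun i => stdVec (consIndex o x i))) = _
  rw [map_sum]
  rfl

theorem act_single {n : ℕ} (g : SO n) (k : Fin 2 × Fin n) :
    act g (EuclideanSpace.single k 1) = ∑ l, g.1 l k • EuclideanSpace.single l (1 : ℝ) := by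
  ext j
  change (Matrix.toEuclideanCLM (n := Fin 2 × Fin n) (𝕜 := ℝ) g.1
    (EuclideanSpace.single k 1)).ofLp j = _
  rw [Matrix.ofLp_toEuclideanCLM, PiLp.ofLp_single, Matrix.mulVec_single_one]
  simp [Finset.sum_apply, Pi.single_apply]

theorem cotangentStar_tau {m : ℕ} (o : Fin 2 × Fin (m + 1)) (k : isotropy o)
    (α : cotangent (n := m + 1) (basePoint o) m) :
    cotangentStar o (tau o m k α) = midRep (m + 1) k.1 (cotangentStar o α) := by
  have hk : (cmat k.1.1).mulVec (stdVec o) = stdVec o := by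
    have h1 : act k.1 (basePoint o) = basePoint o := k.2
    rw [basePoint, act_single] at h1
    rw [mulVec_stdVec]
    funext j
    have h2 := congrArg (fun v : E (m + 1) => v.ofLp j) h1
    simp only [WithLp.ofLp_sum, Finset.sum_apply, WithLp.ofLp_smul, Pi.smul_apply,
      PiLp.ofLp_single, smul_eq_mul, Pi.single_apply] at h2
    simp only [Finset.sum_apply, Pi.smul_apply, stdVec, Pi.single_apply, smul_eq_mul, cmat_apply]
    have h3 := congrArg Complex.ofReal h2
    simp only [mul_ite, mul_one, mul_zero, Finset.sum_ite_eq, Finset.mem_univ, if_true] at h3 ⊢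
    rw [h3]
    split_ifs <;> simp
  ext v
  rw [cotangentStar_apply, midRep_apply, pull_apply, cotangentStar_apply]
  have h1 := sum_multilinear_transpose (R := ℝ) (S := ℂ) α.1.toMultilinearMap
    (((halfDet 0 v).curryLeft (stdVec o)).toMultilinearMap.restrictScalars ℝ)
    (fun k => EuclideanSpace.single k (1 : ℝ)) stdVec (act (k.1⁻¹)) (cmat k.1.1).mulVec
    (fun l k' => (k.1⁻¹).1 l k') (act_single _) (fun l => by
      rw [mulVec_stdVec]
      rfl)
  simp only [stdVec_consIndex]
  refine Eq.trans ?_ (h1.trans ?_)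
  · refine Finset.sum_congr rfl fun x _ => ?_
    congr 1
    exact (curryLeft_halfDet _ _ _).symm
  · refine Finset.sum_congr rfl fun x _ => ?_
    congr 1
    change (halfDet 0 v).curryLeft (stdVec o) (fun i => (cmat k.1.1).mulVec (stdVec (x i))) = _
    have hdet : (cmat k.1.1).det = 1 := by
      rw [cmat_det, (Matrix.mem_specialOrthogonalGroup_iff.1 k.1.2).2, Complex.ofReal_one]
    have hv : v = fun i => (cmat k.1.1).mulVec ((cmat (k.1⁻¹).1).mulVec (v i)) := by
      funext i
      rw [Matrix.mulVec_mulVec, SO_inv_val, ← cmat_transpose,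
        cmat_mul_transpose (SO_mul_transpose k.1), Matrix.one_mulVec]
    rw [curryLeft_halfDet]
    conv_lhs => rw [hv]
    have hc : (Fin.cons (stdVec o) (fun i => (cmat k.1.1).mulVec (stdVec (x i))) :
        Fin (m + 1) → Fin 2 × Fin (m + 1) → ℂ) = fun i => (cmat k.1.1).mulVec
          ((Fin.cons (stdVec o) fun i => stdVec (x i) :
            Fin (m + 1) → Fin 2 × Fin (m + 1) → ℂ) i) := by
      funext i
      refine Fin.cases ?_ (fun i => ?_) i
      · exact hk.symm
      · rfl
    rw [hc, halfDet_mulVec, hdet, one_mul]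

/-- The coordinate form `dx_{x 1} ∧ ⋯ ∧ dx_{x m}` on `ℝ^{2n}`. -/
def coordForm {n m : ℕ} (x : Fin m → Fin 2 × Fin n) : E n [⋀^Fin m]→L[ℝ] ℂ :=
  { toMultilinearMap := (Complex.ofRealCLM.toLinearMap.compAlternatingMap
      ((Matrix.detRowAlternating (n := Fin m) (R := ℝ)).compLinearMap
        (LinearMap.pi fun i =>
          (EuclideanSpace.proj (x i) : E n →L[ℝ] ℝ).toLinearMap))).toMultilinearMap
    cont := by
      refine Complex.continuous_ofReal.comp
        (Continuous.matrix_det (continuous_matrix fun k i => ?_))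
      exact (EuclideanSpace.proj (x i) : E n →L[ℝ] ℝ).continuous.comp (continuous_apply k)
    map_eq_zero_of_eq' := AlternatingMap.map_eq_zero_of_eq _ }

theorem coordForm_apply {n m : ℕ} (x : Fin m → Fin 2 × Fin n) (v : Fin m → E n) :
    coordForm x v = ((Matrix.of fun k i => (v k) (x i)).det : ℝ) := rfl

theorem coordForm_self {n m : ℕ} {x : Fin m → Fin 2 × Fin n} (hx : Function.Injective x) :
    coordForm x (fun i => EuclideanSpace.single (x i) 1) = 1 := by
  rw [coordForm_apply, ← Complex.ofReal_one, ← Matrix.det_one (n := Fin m) (R := ℝ)]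
  congr 2
  ext k i
  simp [Matrix.one_apply, hx.eq_iff, eq_comm]

theorem exists_perm_of_coordForm_ne_zero {n m : ℕ} {x y : Fin m → Fin 2 × Fin n}
    (h : coordForm x (fun i => EuclideanSpace.single (y i) 1) ≠ 0) :
    ∃ σ : Equiv.Perm (Fin m), y = x ∘ σ := by
  have hy : Function.Injective y := fun i j hij => by
    by_contra hne
    exact h ((coordForm x).map_eq_zero_of_eq _ (by rw [hij]) hne)
  have h' : ∀ k, ∃ i, x i = y k := fun k => by
    by_contra! hk
    refine h ?_
    rw [coordForm_apply, Matrix.det_eq_zero_of_row_eq_zero k fun i => ?_, Complex.ofReal_zero]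
    simp [hk i]
  choose f hf using h'
  have hfi : Function.Injective f := fun i j hij => hy (by rw [← hf, ← hf, hij])
  exact ⟨Equiv.ofBijective f (Finite.injective_iff_bijective.1 hfi), funext fun i => (hf i).symm⟩

theorem coordForm_mem_cotangent {n m : ℕ} {o : Fin 2 × Fin n} {x : Fin m → Fin 2 × Fin n}
    (hx : ∀ i, x i ≠ o) : coordForm x ∈ cotangent (basePoint o) m := by
  rintro v ⟨k, hk⟩
  rw [coordForm_apply, Matrix.det_eq_zero_of_row_eq_zero k fun i => ?_, Complex.ofReal_zero]
  rw [Matrix.of_apply, hk, basePoint]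
  simp [hx i]

/-- The representation on an eigenspace of the star operator contains the isotropy representation
on middle-degree cotangent forms: project `⋆(o ∧ α)` to the eigenspace. -/
theorem isSpherical_starRep {m : ℕ} {o : Fin 2 × Fin (m + 1)} {x : Fin m → Fin 2 × Fin (m + 1)}
    (hx : Function.Injective (consIndex o x)) {c : ℂ} (hc : c ≠ 0)
    (hcc : ∀ α : MidForm (m + 1), star (star α) = (c * c) • α) :
    IsSpherical o m (starRep (m + 1) c) := by
  let T₀ : cotangent (n := m + 1) (basePoint o) m →ₗ[ℂ] MidForm (m + 1) :=
    cotangentStar o + c⁻¹ • (star ∘ₗ cotangentStar o)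
  have hT₀ : ∀ α, T₀ α = cotangentStar o α + c⁻¹ • star (cotangentStar o α) := fun _ => rfl
  have hmem : ∀ α, T₀ α ∈ starSpace (m + 1) c := fun α => by
    rw [mem_starSpace, hT₀, map_add, map_smul, hcc, smul_add, smul_smul, smul_smul, ← mul_assoc,
      inv_mul_cancel₀ hc, mul_inv_cancel₀ hc, one_mul, one_smul]
    exact add_comm _ _
  refine ⟨{ toLinearMap := T₀.codRestrict _ hmem, isIntertwining' := fun k => ?_ }, fun hT => ?_⟩
  · refine LinearMap.ext fun α => Subtype.ext ?_
    change T₀ (tau o m k α) = midRep (m + 1) k.1 (T₀ α)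
    rw [hT₀, hT₀, cotangentStar_tau, star_midRep, map_add, map_smul]
  · have hxi : Function.Injective x := fun i j hij => by
      have : consIndex o x i.succ = consIndex o x j.succ := by simpa [consIndex] using hij
      exact Fin.succ_injective _ (hx this)
    have hxo : ∀ i, x i ≠ o := fun i hi => by
      have : consIndex o x i.succ = consIndex o x 0 := by simpa [consIndex] using hi
      exact Fin.succ_ne_zero i (hx this)
    let α : cotangent (n := m + 1) (basePoint o) m := ⟨coordForm x, coordForm_mem_cotangent hxo⟩
    obtain ⟨u, hu⟩ := exists_complementary hx
    have h0 : T₀ α = 0 := congrArg Subtype.val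
      (LinearMap.congr_fun (congrArg Representation.IntertwiningMap.toLinearMap hT) α)
    have h1 : T₀ α (fun i => stdVec (u i)) = 0 := by rw [h0]; rfl
    -- the star of `cotangentStar o α` is a multiple of `o ∧ α`, and so vanishes at `u`
    have h2 : star (cotangentStar o α) (fun i => stdVec (u i)) = 0 := by
      rw [star_apply_stdVec _ hu, cotangentStar_apply, Finset.sum_eq_zero, zero_mul, mul_zero]
      intro y _
      rw [halfDet_stdVec_eq_zero, mul_zero]
      intro hcomp
      exact (complementary_iff.1 hcomp).2.2 0 0 rfl
    have h3 : cotangentStar o α (fun i => stdVec (u i)) = m.factorial *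
        halfDet 1 (fun i => stdVec (consIndex o x i)) (fun i => stdVec (u i)) := by
      rw [cotangentStar_apply]
      have := sum_eq_factorial_mul (f := fun y => coordForm x
        (fun i => EuclideanSpace.single (y i) 1) *
          (halfDet 0 fun i => stdVec (u i)).curryLeft (stdVec o) (fun i => stdVec (y i))) hxi
        (fun y hy => exists_perm_of_coordForm_ne_zero (left_ne_zero_of_mul hy))
        (fun σ => alternating_mul_comp_perm (coordForm x).toAlternatingMap
          ((halfDet 0 fun i => stdVec (u i)).curryLeft (stdVec o))
          (fun k => EuclideanSpace.single k (1 : ℝ)) stdVec x σ)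
      simp only [curryLeft_halfDet, ← stdVec_consIndex] at this
      refine this.trans ?_
      rw [coordForm_self hxi, one_mul]
    rw [hT₀, AlternatingMap.add_apply, AlternatingMap.smul_apply, h2, smul_zero, add_zero, h3] at h1
    have h4 := halfDet_stdVec_sq hu
    rcases mul_eq_zero.1 h1 with h | h
    · exact absurd h (by exact_mod_cast m.factorial_ne_zero)
    · rw [h] at h4
      simp at h4

/-! ### Isospectrality: pullback along a reflection -/

/-- The reflection of `ℝ^{2n}` in the coordinate `(1, j)`. -/
def reflCLM {n : ℕ} (j : Fin n) : E n →L[ℝ] E n :=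
  Matrix.toEuclideanCLM (n := Fin 2 × Fin n) (𝕜 := ℝ) (refl j)

theorem reflCLM_apply {n : ℕ} (j : Fin n) (v : E n) (k) :
    reflCLM j v k = if k = (1, j) then -v k else v k := by
  change (Matrix.toEuclideanCLM (n := Fin 2 × Fin n) (𝕜 := ℝ) (refl j) v).ofLp k = _
  rw [Matrix.ofLp_toEuclideanCLM, refl, Matrix.mulVec_diagonal]
  split_ifs <;> simp

theorem reflCLM_comp_self {n : ℕ} (j : Fin n) : (reflCLM j).comp (reflCLM j) = .id ℝ (E n) := by
  change reflCLM j * reflCLM j = 1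
  rw [reflCLM, ← map_mul, refl_mul_self, map_one]

theorem reflCLM_reflCLM {n : ℕ} (j : Fin n) (v : E n) : reflCLM j (reflCLM j v) = v :=
  congrArg (fun f : E n →L[ℝ] E n => f v) (reflCLM_comp_self j)

theorem norm_reflCLM {n : ℕ} (j : Fin n) (v : E n) : ‖reflCLM j v‖ = ‖v‖ := by
  rw [EuclideanSpace.norm_eq, EuclideanSpace.norm_eq]
  congr 1
  refine Finset.sum_congr rfl fun k _ => ?_
  rw [reflCLM_apply]
  split_ifs <;> simp

theorem reflCLM_ne_zero {n : ℕ} (j : Fin n) {v : E n} (hv : v ≠ 0) : reflCLM j v ≠ 0 := by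
  rw [← norm_ne_zero_iff, norm_reflCLM]
  exact norm_ne_zero_iff.2 hv

theorem reflCLM_single {n : ℕ} (j : Fin n) (k : Fin 2 × Fin n) :
    reflCLM j (EuclideanSpace.single k 1) =
      (if k = (1, j) then (-1 : ℝ) else 1) • EuclideanSpace.single k (1 : ℝ) := by
  ext l
  rw [reflCLM_apply]
  by_cases h : l = k
  · subst h
    split_ifs <;> simp
  · split_ifs <;> simp [h]

/-- The reflection as a map of the unit sphere. -/
def reflSphere {n : ℕ} (j : Fin n) (x : Metric.sphere (0 : E n) 1) : Metric.sphere (0 : E n) 1 :=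
  ⟨reflCLM j x, by
    rw [mem_sphere_zero_iff_norm, norm_reflCLM]
    exact mem_sphere_zero_iff_norm.1 x.2⟩

theorem reflSphere_reflSphere {n : ℕ} (j : Fin n) (x : Metric.sphere (0 : E n) 1) :
    reflSphere j (reflSphere j x) = x := Subtype.ext (reflCLM_reflCLM j x)

/-- The pullback of a differential form on the sphere along the reflection. -/
def reflPullback {n p : ℕ} (j : Fin n) (α : Form n p) : Form n p := fun x =>
  (α (reflSphere j x)).compContinuousLinearMap (reflCLM j)

theorem reflPullback_reflPullback {n p : ℕ} (j : Fin n) (α : Form n p) :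
    reflPullback j (reflPullback j α) = α := by
  funext x
  ext v
  change α (reflSphere j (reflSphere j x)) (fun i => reflCLM j (reflCLM j (v i))) = _
  simp only [reflSphere_reflSphere, reflCLM_reflCLM]

theorem ext_reflPullback {n p : ℕ} (j : Fin n) (α : Form n p) (y : E n) :
    ext (reflPullback j α) y = (ext α (reflCLM j y)).compContinuousLinearMap (reflCLM j) := by
  by_cases h : y = 0
  · subst h
    rw [map_zero]
    simp only [ext, dite_true]
    rfl
  · simp only [ext, dif_neg h, dif_neg (reflCLM_ne_zero j h)]
    ext v
    have hs : ∀ hy, reflSphere j (⟨‖y‖⁻¹ • y, hy⟩ : Metric.sphere (0 : E n) 1) =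
        ⟨‖reflCLM j y‖⁻¹ • reflCLM j y, by
          simp [norm_smul, norm_ne_zero_iff.2 (reflCLM_ne_zero j h)]⟩ := fun hy => Subtype.ext (by
      change reflCLM j (‖y‖⁻¹ • y) = ‖reflCLM j y‖⁻¹ • reflCLM j y
      rw [map_smul, norm_reflCLM])
    simp only [reflPullback, hs, ContinuousAlternatingMap.smul_apply,
      ContinuousAlternatingMap.compContinuousLinearMap_apply, norm_reflCLM]

theorem hasFDerivAt_ext_reflPullback {n p : ℕ} (j : Fin n) {α : Form n p} {x : E n}
    (h : DifferentiableAt ℝ (ext α) (reflCLM j x)) :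
    HasFDerivAt (ext (reflPullback j α))
      (((ContinuousAlternatingMap.compContinuousLinearMapCLM (reflCLM j)).comp
        (fderiv ℝ (ext α) (reflCLM j x))).comp (reflCLM j)) x := by
  have h1 : ext (reflPullback j α) = fun y =>
      ContinuousAlternatingMap.compContinuousLinearMapCLM (reflCLM j) (ext α (reflCLM j y)) :=
    funext fun y => ext_reflPullback j α y
  rw [h1]
  exact (ContinuousLinearMap.hasFDerivAt _).comp x
    (h.hasFDerivAt.comp x (ContinuousLinearMap.hasFDerivAt (reflCLM j)))

theorem contDiffOn_ext_reflPullback {n p : ℕ} (j : Fin n) {α : Form n p}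
    (h : ContDiffOn ℝ (⊤ : ℕ∞) (ext α) {0}ᶜ) :
    ContDiffOn ℝ (⊤ : ℕ∞) (ext (reflPullback j α)) {0}ᶜ := by
  have h1 : ext (reflPullback j α) = fun y =>
      ContinuousAlternatingMap.compContinuousLinearMapCLM (reflCLM j) (ext α (reflCLM j y)) :=
    funext fun y => ext_reflPullback j α y
  rw [h1]
  refine (ContinuousLinearMap.contDiff _).comp_contDiffOn
    (h.comp (ContinuousLinearMap.contDiff (reflCLM j)).contDiffOn fun y hy => ?_)
  exact reflCLM_ne_zero j hy

theorem d_reflPullback {n p : ℕ} (j : Fin n) {α : Form n p}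
    (h : ContDiffOn ℝ (⊤ : ℕ∞) (ext α) {0}ᶜ) :
    d (reflPullback j α) = reflPullback j (d α) := by
  funext x
  have h1 : ext (reflPullback j α) = fun y =>
      (ext α (reflCLM j y)).compContinuousLinearMap (fderiv ℝ (reflCLM j) y) := by
    funext y
    rw [ext_reflPullback, ContinuousLinearMap.fderiv]
  have h2 := extDeriv_pullback (ω := ext α) (f := reflCLM j) (x := (x : E n)) (r := ⊤)
    (differentiableAt_ext h (reflSphere j x)) (ContinuousLinearMap.contDiff (reflCLM j)).contDiffAt
    (by simp)
  rw [ContinuousLinearMap.fderiv] at h2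
  change extDeriv (ext (reflPullback j α)) x = _
  rw [h1, h2]
  rfl

theorem codiff_reflPullback {n p : ℕ} (j : Fin n) {α : Form n (p + 1)}
    (h : ContDiffOn ℝ (⊤ : ℕ∞) (ext α) {0}ᶜ) :
    codiff (reflPullback j α) = reflPullback j (codiff α) := by
  funext x
  have h1 := (hasFDerivAt_ext_reflPullback j (α := α)
    (differentiableAt_ext h (reflSphere j x))).fderiv
  have h2 : codiff (reflPullback j α) x = -∑ i, (fderiv ℝ (ext (reflPullback j α)) x
    (EuclideanSpace.single i 1)).curryLeft (EuclideanSpace.single i 1) := rfl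
  have h3 : reflPullback j (codiff α) x = -∑ i, ((fderiv ℝ (ext α) (reflCLM j x)
      (EuclideanSpace.single i 1)).curryLeft (EuclideanSpace.single i 1)).compContinuousLinearMap
        (reflCLM j) := by
    change ContinuousAlternatingMap.compContinuousLinearMapCLM (reflCLM j)
      (-∑ i, (fderiv ℝ (ext α) (reflCLM j x) (EuclideanSpace.single i 1)).curryLeft
        (EuclideanSpace.single i 1)) = _
    rw [map_neg, map_sum]
    rfl
  rw [h2, h3, h1]
  congr 1
  refine Finset.sum_congr rfl fun i _ => ?_
  -- the reflection multiplies the basis vector by a sign, which occurs twice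
  have h4 : ∀ (s : ℝ), s * s = 1 → ∀ B : E n →L[ℝ] E n [⋀^Fin (p + 1)]→L[ℝ] ℂ, ∀ w : E n,
      (B (s • w)).curryLeft (s • w) = (B w).curryLeft w := fun s hs B w => by
    rw [map_smul, ← ContinuousAlternatingMap.curryLeftLI_apply, map_smul, map_smul,
      smul_apply, smul_smul, hs, one_smul]
    rfl
  have h5 : (((ContinuousAlternatingMap.compContinuousLinearMapCLM (reflCLM j)).comp
      (fderiv ℝ (ext α) (reflCLM j x))).comp (reflCLM j) (EuclideanSpace.single i 1)).curryLeft
        (EuclideanSpace.single i 1) =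
      ((fderiv ℝ (ext α) (reflCLM j x) (reflCLM j (EuclideanSpace.single i 1))).curryLeft
        (reflCLM j (EuclideanSpace.single i 1))).compContinuousLinearMap (reflCLM j) := by
    ext v
    simp only [ContinuousAlternatingMap.curryLeft_apply_apply, ContinuousLinearMap.comp_apply,
      ContinuousAlternatingMap.compContinuousLinearMapCLM_apply,
      ContinuousAlternatingMap.compContinuousLinearMap_apply]
    congr 1
    funext k
    refine Fin.cases ?_ (fun k => ?_) k <;> rfl
  refine h5.trans ?_
  rw [reflCLM_single, h4]
  split_ifs <;> norm_num

theorem hodgeLaplacian_reflPullback {n p : ℕ} (j : Fin n) {α : Form n p}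
    (h : ContDiffOn ℝ (⊤ : ℕ∞) (ext α) {0}ᶜ) :
    hodgeLaplacian p (reflPullback j α) = reflPullback j (hodgeLaplacian p α) := by
  cases p with
  | zero =>
    simp only [hodgeLaplacian]
    rw [d_reflPullback j h, codiff_reflPullback j (contDiffOn_d h)]
  | succ p =>
    simp only [hodgeLaplacian]
    rw [d_reflPullback j h, codiff_reflPullback j (contDiffOn_d h), codiff_reflPullback j h,
      d_reflPullback j (contDiffOn_codiff h)]
    rfl

/-- Conjugation by the reflection, as an automorphism of `SO(2n)`. -/
def reflConj {n : ℕ} (j : Fin n) : SO n →* SO n where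
  toFun g := ⟨refl j * g.1 * refl j, by
    have hg := Matrix.mem_specialOrthogonalGroup_iff.1 g.2
    refine Matrix.mem_specialOrthogonalGroup_iff.2 ⟨?_, ?_⟩
    · have hr : refl j ∈ Matrix.orthogonalGroup (Fin 2 × Fin n) ℝ :=
        (Matrix.mem_orthogonalGroup_iff _ _).2 (refl_mul_transpose j)
      exact mul_mem (mul_mem hr hg.1) hr
    · rw [Matrix.det_mul, Matrix.det_mul, hg.2, det_refl]
      norm_num⟩
  map_one' := Subtype.ext (by
    change refl j * 1 * refl j = 1
    rw [mul_one, refl_mul_self])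
  map_mul' g h := Subtype.ext (by
    change refl j * (g.1 * h.1) * refl j = refl j * g.1 * refl j * (refl j * h.1 * refl j)
    rw [show refl j * g.1 * refl j * (refl j * h.1 * refl j) =
      refl j * g.1 * (refl j * refl j) * h.1 * refl j by simp only [mul_assoc], refl_mul_self,
      mul_one]
    simp only [mul_assoc])

theorem reflConj_reflConj {n : ℕ} (j : Fin n) (g : SO n) : reflConj j (reflConj j g) = g := by
  apply Subtype.ext
  change refl j * (refl j * g.1 * refl j) * refl j = g.1
  rw [mul_assoc, mul_assoc, refl_mul_self, mul_one, ← mul_assoc, refl_mul_self, one_mul]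

theorem act_reflConj_comp {n : ℕ} (j : Fin n) (g : SO n) :
    (act (reflConj j g)).comp (reflCLM j) = (reflCLM j).comp (act g) := by
  change Matrix.toEuclideanCLM (n := Fin 2 × Fin n) (𝕜 := ℝ) (refl j * g.1 * refl j) *
    Matrix.toEuclideanCLM (n := Fin 2 × Fin n) (𝕜 := ℝ) (refl j) =
    Matrix.toEuclideanCLM (n := Fin 2 × Fin n) (𝕜 := ℝ) (refl j) *
      Matrix.toEuclideanCLM (n := Fin 2 × Fin n) (𝕜 := ℝ) g.1
  rw [← map_mul, ← map_mul, mul_assoc, refl_mul_self, mul_one]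

theorem reflPullback_mem_eigenforms {n p : ℕ} (j : Fin n) {Γ Γ' : Subgroup (SO n)}
    (h : ∀ γ ∈ Γ, reflConj j γ ∈ Γ') {lam : ℂ} {α : Form n p} (hα : α ∈ eigenforms Γ' p lam) :
    reflPullback j α ∈ eigenforms Γ p lam := by
  obtain ⟨⟨h1, h2⟩, h3, h4⟩ := hα
  refine ⟨⟨fun x v => ?_, contDiffOn_ext_reflPullback j h2⟩, fun γ hγ x y hxy => ?_, ?_⟩
  · rintro ⟨i, hi⟩
    exact h1 (reflSphere j x) _ ⟨i, congrArg (reflCLM j) hi⟩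
  · have hc : ∀ v, act (reflConj j γ) (reflCLM j v) = reflCLM j (act γ v) := fun v =>
      congrArg (fun f : E n →L[ℝ] E n => f v) (act_reflConj_comp j γ)
    have h5 := h3 _ (h γ hγ) (reflSphere j x) (reflSphere j y) (by
      change reflCLM j y = act (reflConj j γ) (reflCLM j x)
      rw [hc, hxy])
    ext v
    change α (reflSphere j y) (fun i => reflCLM j (act γ (v i))) =
      α (reflSphere j x) fun i => reflCLM j (v i)
    rw [← h5]
    change _ = α (reflSphere j y) fun i => act (reflConj j γ) (reflCLM j (v i))
    simp only [hc]
  · rw [hodgeLaplacian_reflPullback j h2, h4]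
    rfl

/-- Subgroups conjugate by a reflection have isospectral quotients. -/
theorem isospectralOnForms_of_reflConj {n : ℕ} (p : ℕ) (j : Fin n) {Γ Γ' : Subgroup (SO n)}
    (h : ∀ γ ∈ Γ, reflConj j γ ∈ Γ') (h' : ∀ γ ∈ Γ', reflConj j γ ∈ Γ) :
    IsospectralOnForms p Γ Γ' := fun _ =>
  LinearEquiv.rank_eq
    { toFun := fun α => ⟨reflPullback j α.1, reflPullback_mem_eigenforms j h' α.2⟩
      invFun := fun α => ⟨reflPullback j α.1, reflPullback_mem_eigenforms j h α.2⟩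
      map_add' := fun _ _ => rfl
      map_smul' := fun _ _ => rfl
      left_inv := fun α => Subtype.ext (reflPullback_reflPullback j α.1)
      right_inv := fun α => Subtype.ext (reflPullback_reflPullback j α.1) }

/-! ### The two lens groups -/

theorem torus_zpow {n : ℕ} (θ : Fin n → ℝ) (k : ℤ) : torus θ ^ k = torus ((k : ℝ) • θ) := by
  cases k with
  | ofNat k => simp [torus_pow]
  | negSucc k =>
    rw [zpow_negSucc, torus_pow, torus_inv]
    congr 1
    push_cast
    rw [← neg_smul]

theorem lensGen_zpow_apply {n : ℕ} (q : ℕ) (s : Fin n → ℤ) (k : ℤ) (a b : Fin 2) (j : Fin n) :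
    (lensGen q s ^ k).1 (a, j) (b, j) = rot (2 * Real.pi * (k * s j : ℤ) / q) a b := by
  rw [lensGen, torus_zpow, torus_apply, if_pos rfl]
  congr 1
  simp only [Pi.smul_apply, smul_eq_mul]
  push_cast
  ring_nf

theorem dvd_of_cos_eq_one {q : ℕ} (hq : q ≠ 0) {m : ℤ}
    (h : Real.cos (2 * Real.pi * m / q) = 1) : (q : ℤ) ∣ m := by
  obtain ⟨l, hl⟩ := (Real.cos_eq_one_iff _).1 h
  refine ⟨l, ?_⟩
  have hq' : (q : ℝ) ≠ 0 := by exact_mod_cast hq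
  have hpi : (2 * Real.pi) ≠ 0 := by positivity
  have : (m : ℝ) = q * l := by
    rw [eq_div_iff hq'] at hl
    refine mul_left_cancel₀ hpi ?_
    linarith
  exact_mod_cast this

theorem dvd_of_dvd_mul_sign {q : ℕ} {k s : ℤ} (hs : s = 1 ∨ s = -1) (h : (q : ℤ) ∣ k * s) :
    (q : ℤ) ∣ k := by
  rcases hs with rfl | rfl
  · rwa [mul_one] at h
  · rwa [mul_neg_one, dvd_neg] at h

theorem lensGen_zpow_eq_one {n : ℕ} {q : ℕ} (hq : q ≠ 0) (s : Fin n → ℤ) {k : ℤ}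
    (h : (q : ℤ) ∣ k) : lensGen q s ^ k = 1 := by
  obtain ⟨l, rfl⟩ := h
  rw [zpow_mul, zpow_natCast, lensGen_pow hq, one_zpow]

theorem card_lensGroup {n : ℕ} (hn : 0 < n) {q : ℕ} (hq : q ≠ 0) {s : Fin n → ℤ}
    (hs : ∀ j, s j = 1 ∨ s j = -1) : Nat.card (lensGroup q s) = q := by
  change Nat.card (Subgroup.zpowers (lensGen q s)) = q
  rw [Nat.card_zpowers]
  refine Nat.dvd_antisymm (orderOf_dvd_of_pow_eq_one (lensGen_pow hq s)) ?_
  have h1 : lensGen q s ^ ((orderOf (lensGen q s) : ℕ) : ℤ) = 1 := by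
    rw [zpow_natCast, pow_orderOf_eq_one]
  have h2 := lensGen_zpow_apply q s (orderOf (lensGen q s) : ℕ) 0 0 ⟨0, hn⟩
  rw [h1] at h2
  have h3 : (1 : ℝ) =
      rot (2 * Real.pi * ((orderOf (lensGen q s) : ℕ) * s ⟨0, hn⟩ : ℤ) / q) 0 0 := by
    rw [← h2]
    exact (Matrix.one_apply_eq _).symm
  have h4 := dvd_of_dvd_mul_sign (hs _) (dvd_of_cos_eq_one hq (h3.symm : Real.cos _ = 1))
  exact_mod_cast h4

theorem actsFreely_lensGroup {n : ℕ} {q : ℕ} (hq : q ≠ 0) {s : Fin n → ℤ}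
    (hs : ∀ j, s j = 1 ∨ s j = -1) : ActsFreely (lensGroup q s) := by
  rintro γ hγ x hx
  obtain ⟨k, rfl⟩ := Subgroup.mem_zpowers_iff.1 hγ
  change lensGen q s ^ k = 1
  change act (lensGen q s ^ k) x = x at hx
  have hx0 : (x : E n) ≠ 0 := fun h0 => by
    have := x.2
    simp [h0] at this
  obtain ⟨⟨a, j⟩, ha⟩ : ∃ p, (x : E n) p ≠ 0 := by
    by_contra! h
    exact hx0 (by ext p; simpa using h p)
  set φ : ℝ := 2 * Real.pi * (k * s j : ℤ) / q with hφ
  have hrow : ∀ b : Fin 2, rot φ b 0 * (x : E n) (0, j) + rot φ b 1 * (x : E n) (1, j) =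
      (x : E n) (b, j) := fun b => by
    have h1 : (act (lensGen q s ^ k) x).ofLp (b, j) = (x : E n).ofLp (b, j) := by rw [hx]
    change (Matrix.toEuclideanCLM (n := Fin 2 × Fin n) (𝕜 := ℝ) (lensGen q s ^ k).1 x).ofLp (b, j) =
      _ at h1
    rw [Matrix.ofLp_toEuclideanCLM] at h1
    rw [← h1, Matrix.mulVec, dotProduct, Fintype.sum_prod_type, Fin.sum_univ_two]
    have h2 : ∀ c : Fin 2, ∑ i : Fin n, (lensGen q s ^ k).1 (b, j) (c, i) * (x : E n).ofLp (c, i) =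
        rot φ b c * (x : E n) (c, j) := fun c => by
      rw [Finset.sum_eq_single j]
      · rw [lensGen_zpow_apply]
      · intro i _ hi
        rw [lensGen, torus_zpow, torus_apply, if_neg (Ne.symm hi), zero_mul]
      · simp
    rw [h2, h2]
  have h0 := hrow 0
  have h1 := hrow 1
  simp only [rot, Matrix.of_apply, Matrix.cons_val_zero, Matrix.cons_val_one,
    Matrix.cons_val_fin_one, Matrix.cons_val'] at h0 h1
  set u := (x : E n) (0, j)
  set v := (x : E n) (1, j)
  have hpos : u ^ 2 + v ^ 2 ≠ 0 := by
    have hu : u ≠ 0 ∨ v ≠ 0 := by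
      fin_cases a
      · exact Or.inl ha
      · exact Or.inr ha
    rcases hu with h | h <;> positivity
  have hcos : Real.cos φ = 1 := by
    have h2 : (Real.cos φ - 1) * (u ^ 2 + v ^ 2) = 0 := by
      linear_combination u * h0 + v * h1
    rcases mul_eq_zero.1 h2 with h | h
    · linarith
    · exact absurd h hpos
  exact lensGen_zpow_eq_one hq s (dvd_of_dvd_mul_sign (hs j) (dvd_of_cos_eq_one hq hcos))

theorem onesLast_eq_or {n : ℕ} {e : ℤ} (he : e = 1 ∨ e = -1) (j : Fin n) :
    onesLast n e j = 1 ∨ onesLast n e j = -1 := by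
  rw [onesLast]
  split_ifs
  · exact he
  · exact Or.inl rfl

theorem map_reflConj_lensGroup {n : ℕ} (hn : 0 < n) (q : ℕ) :
    (lensGroup q (onesLast n 1)).map (reflConj (⟨n - 1, by omega⟩ : Fin n)) =
      lensGroup q (onesLast n (-1)) := by
  change (Subgroup.zpowers (lensGen q (onesLast n 1))).map _ =
    Subgroup.zpowers (lensGen q (onesLast n (-1)))
  rw [MonoidHom.map_zpowers]
  congr 1
  exact Subtype.ext (lensGen_neg hn q).symm

theorem conjugateInO_lensGroup {n : ℕ} (hn : 0 < n) (q : ℕ) :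
    ConjugateInO (lensGroup q (onesLast n 1)) (lensGroup q (onesLast n (-1))) := by
  refine ⟨refl (⟨n - 1, by omega⟩ : Fin n),
    (Matrix.mem_orthogonalGroup_iff _ _).2 (refl_mul_transpose _), ?_⟩
  rw [← map_reflConj_lensGroup hn, Subgroup.coe_map, Set.image_image, refl_transpose]
  rfl

theorem isospectralOnForms_lensGroup {n : ℕ} (hn : 0 < n) (q p : ℕ) :
    IsospectralOnForms p (lensGroup q (onesLast n 1)) (lensGroup q (onesLast n (-1))) := by
  have h := map_reflConj_lensGroup hn q
  refine isospectralOnForms_of_reflConj p (⟨n - 1, by omega⟩ : Fin n) (fun γ hγ => ?_)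
    fun γ hγ => ?_
  · rw [← h]
    exact Subgroup.mem_map_of_mem _ hγ
  · rw [← h] at hγ
    obtain ⟨γ, hγ, rfl⟩ := hγ
    rwa [reflConj_reflConj]

theorem consIndex_rev_injective (m : ℕ) :
    Function.Injective (consIndex (m := m) (1, Fin.last m) fun i => (1, (Fin.succ i).rev)) := by
  have h : (consIndex (m := m) (1, Fin.last m) fun i => (1, (Fin.succ i).rev)) =
      fun i => (1, Fin.rev i) := by
    funext i
    refine Fin.cases ?_ (fun i => ?_) i
    · simp [consIndex]
    · rfl
  rw [h]
  exact fun i j hij => Fin.rev_injective (congrArg Prod.snd hij)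

end LensForms

end

theorem theorem4p8 (n : ℕ) (hn : 2 ≤ n) (heven : Even n) (q : ℕ) (hq : n < q) :
    let o : Fin 2 × Fin n := (1, ⟨n - 1, by omega⟩)
    let Γ : Subgroup (LensForms.SO n) := LensForms.lensGroup q (LensForms.onesLast n 1)
    let Γ' : Subgroup (LensForms.SO n) := LensForms.lensGroup q (LensForms.onesLast n (-1))
    IsCyclic Γ ∧ IsCyclic Γ' ∧ Nat.card Γ = q ∧ Nat.card Γ' = q ∧
    LensForms.ActsFreely Γ ∧ LensForms.ActsFreely Γ' ∧
    LensForms.ConjugateInO Γ Γ' ∧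
    LensForms.IsospectralOnForms (n - 1) Γ Γ' ∧
    ¬ LensForms.RepEquivalent o (n - 1) Γ Γ' ∧
    ∀ e : ℤ, e = 1 ∨ e = -1 →
      ∃ (V : Type) (_ : AddCommGroup V) (_ : Module ℂ V)
        (π : Representation ℂ (LensForms.SO n) V),
        LensForms.IsIrrep π ∧
        LensForms.HasHighestWeight π (LensForms.onesLast n e) ∧
        LensForms.IsSpherical o (n - 1) π ∧
        (LensForms.mult Γ π : ℤ) - (LensForms.mult Γ' π : ℤ) =
          e * (-1) ^ (n / 2) * (n.choose (n / 2) : ℤ) := by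
  intro o Γ Γ'
  have hn0 : 0 < n := by omega
  have hq0 : q ≠ 0 := by omega
  have hsph : ∀ e : ℤ, e = 1 ∨ e = -1 → LensForms.IsSpherical o (n - 1)
      (LensForms.starRep n ((e : ℂ) * LensForms.starEigenvalue n)) := fun e he => by
    obtain ⟨m, rfl⟩ : ∃ m, n = m + 1 := ⟨n - 1, by omega⟩
    have he0 : (e : ℂ) ≠ 0 := by rcases he with rfl | rfl <;> norm_num
    have hee : (e : ℂ) * e = 1 := by rcases he with rfl | rfl <;> norm_num
    refine LensForms.isSpherical_starRep (LensForms.consIndex_rev_injective m)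
      (mul_ne_zero he0 (LensForms.starEigenvalue_ne_zero _)) fun α => ?_
    rw [LensForms.star_star, mul_mul_mul_comm, hee, one_mul]
  have hmain : ∀ e : ℤ, e = 1 ∨ e = -1 → (LensForms.mult Γ (LensForms.starRep n
      ((e : ℂ) * LensForms.starEigenvalue n)) : ℤ) - LensForms.mult Γ' (LensForms.starRep n
        ((e : ℂ) * LensForms.starEigenvalue n)) = e * (-1) ^ (n / 2) * (n.choose (n / 2) : ℤ) :=
    fun e he => LensForms.mult_starRep_sub hn0 heven hq he
  have h1 := LensForms.onesLast_eq_or (n := n) (e := 1) (Or.inl rfl)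
  have h2 := LensForms.onesLast_eq_or (n := n) (e := -1) (Or.inr rfl)
  refine ⟨inferInstanceAs (IsCyclic (Subgroup.zpowers _)),
    inferInstanceAs (IsCyclic (Subgroup.zpowers _)), LensForms.card_lensGroup hn0 hq0 h1,
    LensForms.card_lensGroup hn0 hq0 h2, LensForms.actsFreely_lensGroup hq0 h1,
    LensForms.actsFreely_lensGroup hq0 h2, LensForms.conjugateInO_lensGroup hn0 q,
    LensForms.isospectralOnForms_lensGroup hn0 q _, fun hequiv => ?_, fun e he =>
    ⟨_, _, _, LensForms.starRep n ((e : ℂ) * LensForms.starEigenvalue n),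
      LensForms.isIrrep_starRep (LensForms.starSpace_ne_bot hn0 he),
      LensForms.hasHighestWeight_starRep hn0 he, hsph e he, hmain e he⟩⟩
  have h3 := hmain 1 (Or.inl rfl)
  rw [hequiv _ _ (LensForms.isIrrep_starRep (LensForms.starSpace_ne_bot hn0 (Or.inl rfl)))
    (hsph 1 (Or.inl rfl)), sub_self, one_mul] at h3
  have h4 : (n.choose (n / 2) : ℤ) ≠ 0 := by
    exact_mod_cast (Nat.choose_pos (Nat.div_le_self n 2)).ne'
  exact mul_ne_zero (pow_ne_zero _ (by norm_num)) h4 h3.symm
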